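/- Let $\mathcal G$ be a connected, locally finite metric graph with countably many vertices, without loops or multiple edges, whose edges $e$ are identified with intervals $[0,\ell_e]$, $0<\ell_e<\infty$. Equip $\mathcal G$ with the geodesic distance, and let $\overline{\mathcal G}$ be its metric completion. Let $\partial\overline{\mathcal G}\subset\overline{\mathcal G}$ be the set consisting of the vertices of degree one and of all points of $\overline{\mathcal G}\setminus\mathcal G$. Assume that $\overline{\mathcal G}$ is compact and weakly connected, that is, for all distinct $x,y\in\overline{\mathcal G}$ there are a finite set $W\subset\mathcal G$ and disjoint open sets $A\ni x$, $B\ni y$ with $\overline{\mathcal G}\setminus W=A\cup B$. Let $q:\mathcal G\to[0,\infty)$ be integrable over $\mathcal G$, and assume that there are weights $\omega(e)>0$, one for each edge, with $\sum_e\omega(e)<\infty$ and $\sum_e\int_e(\omega(e)^{-1}q)^2\,\omega(e)\,dx<\infty$. A function $u:\mathcal G\to\mathbb R$ is $q$-harmonic if on each closed edge it is differentiable with $u'$ absolutely continuous and $u''=qu$ a.e., and if it is continuous at each vertex of degree at least $2$, where moreover the sum of its derivatives along the incident edges, in coordinates starting at the vertex, is $0$. Let $\mathcal A$ be the set of continuous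 functions $\phi:\overline{\mathcal G}\to\mathbb R$ that are infinitely differentiable on the open edges and satisfy $\phi'=0$ outside of finitely many edges and in a neighborhood of each vertex. For a continuous $U:\partial\overline{\mathcal G}\to\mathbb R$ and a clopen $E\subset\partial\overline{\mathcal G}$ put $$\Lambda_q(U,E)=\int_{\mathcal G}u\,(-\phi''+q\phi),$$ where $u:\overline{\mathcal G}\to\mathbb R$ is the continuous extension of $U$ that is $q$-harmonic on $\mathcal G$, and $\phi\in\mathcal A$ is a function with $\phi=1$ on $E$ and $\phi=0$ on $\partial\overline{\mathcal G}\setminus E$ (the integral does not depend on the choice of $\phi$). Let $\Omega,E_1,E_2$ be nonempty clopen subsets of $\partial\overline{\mathcal G}$ with $\Omega\neq\partial\overline{\mathcal G}$, $E_1\subset\Omega$ and $E_2\subset\partial\overline{\mathcal G}\setminus\Omega$, and let $1_\Omega:\partial\overline{\mathcal G}\to\mathbb R$ be the characteristic function of $\Omega$. Then $$\Lambda_q(1_\Omega,E_1)>0,\qquad \Lambda_q(1_\Omega,E_2)\le 0 .$$ If moreover $q(x)=0$ for all $x\in\mathcal G$ in some neighborhood of $\partial\overline{\mathcal G}$, then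 $\Lambda_q(1_\Omega,E_2)<0$. -/

import Mathlib

open Set Filter Topology MeasureTheory

/-- A connected, locally finite metric graph with vertex type `V`, without loops and multiple
edges. Each edge `e` is identified with the real interval `[0, len e]`; the coordinate `0`
corresponds to the endpoint `src e`, and the coordinate `len e` to the endpoint `tgt e`. -/
structure MetricGraph (V : Type*) where
  /-- the underlying combinatorial graph -/
  graph : SimpleGraph V
  connected : graph.Connected
  locallyFinite : ∀ v : V, (graph.neighborSet v).Finite
  /-- the endpoint of `e` with coordinate `0` -/
  src : graph.edgeSet → V
  /-- the endpoint of `e` with coordinate `len e` -/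
  tgt : graph.edgeSet → V
  endpoints : ∀ e : graph.edgeSet, s(src e, tgt e) = (e : Sym2 V)
  /-- the (finite, positive) length of an edge -/
  len : graph.edgeSet → ℝ
  len_pos : ∀ e : graph.edgeSet, 0 < len e

namespace MetricGraph

variable {V : Type*}

/-- The edges of a metric graph. -/
abbrev Edge (G : MetricGraph V) : Type _ := G.graph.edgeSet

/-- The points of a metric graph: vertices, and interior points of edges. -/
inductive Point (G : MetricGraph V) : Type _
  | vertex (v : V) : Point G
  | inner (e : G.Edge) (t : ℝ) (h0 : 0 < t) (h1 : t < G.len e) : Point G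

open Classical in
/-- The point of the edge `e` with coordinate `t ∈ [0, len e]`
(coordinates outside of this interval are moved to the nearest endpoint). -/
noncomputable def pt (G : MetricGraph V) (e : G.Edge) (t : ℝ) : G.Point :=
  if h0 : 0 < t then
    if h1 : t < G.len e then Point.inner e t h0 h1 else Point.vertex (G.tgt e)
  else Point.vertex (G.src e)

/-- `PathLength x y L`: there is a path from `x` to `y`, composed of finitely many intervals
contained in edges, with total length `L`. -/
inductive PathLength (G : MetricGraph V) : G.Point → G.Point → ℝ → Prop
  | nil (x : G.Point) : PathLength G x x 0
  | cons (e : G.Edge) (s t : ℝ) (hs : s ∈ Icc 0 (G.len e)) (ht : t ∈ Icc 0 (G.len e))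
      {y : G.Point} {L : ℝ} (h : PathLength G (G.pt e t) y L) :
      PathLength G (G.pt e s) y (|s - t| + L)

section Distance

variable {G : MetricGraph V}

theorem PathLength.nonneg {x y : G.Point} {L : ℝ} (h : G.PathLength x y L) : 0 ≤ L := by
  induction h with
  | nil x => exact le_rfl
  | cons e s t hs ht h ih => positivity

theorem PathLength.append {x y z : G.Point} {L M : ℝ} (h : G.PathLength x y L)
    (h' : G.PathLength y z M) : G.PathLength x z (L + M) := by
  induction h with
  | nil x => simpa using h'
  | cons e s t hs ht h ih => rw [add_assoc]; exact PathLength.cons e s t hs ht (ih h')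

theorem PathLength.single (e : G.Edge) {s t : ℝ} (hs : s ∈ Icc 0 (G.len e))
    (ht : t ∈ Icc 0 (G.len e)) : G.PathLength (G.pt e s) (G.pt e t) |s - t| := by
  simpa using PathLength.cons e s t hs ht (PathLength.nil (G.pt e t))

theorem PathLength.reverse {x y : G.Point} {L : ℝ} (h : G.PathLength x y L) :
    G.PathLength y x L := by
  induction h with
  | nil x => exact PathLength.nil x
  | cons e s t hs ht h ih =>
    rw [add_comm, abs_sub_comm]
    exact ih.append (PathLength.single e ht hs)

theorem pt_zero (e : G.Edge) : G.pt e 0 = Point.vertex (G.src e) := by simp [pt]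

theorem pt_len (e : G.Edge) : G.pt e (G.len e) = Point.vertex (G.tgt e) := by
  simp [pt, G.len_pos e]

theorem pt_inner (e : G.Edge) (t : ℝ) (h0 : 0 < t) (h1 : t < G.len e) :
    G.pt e t = Point.inner e t h0 h1 := by simp [pt, h0, h1]

theorem exists_path_edge (e : G.Edge) :
    ∃ L, G.PathLength (Point.vertex (G.src e)) (Point.vertex (G.tgt e)) L := by
  have h := PathLength.single e (left_mem_Icc.2 (G.len_pos e).le)
    (right_mem_Icc.2 (G.len_pos e).le)
  rw [pt_zero, pt_len] at h
  exact ⟨_, h⟩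

theorem exists_path_vertex (v w : V) :
    ∃ L, G.PathLength (Point.vertex v) (Point.vertex w) L := by
  obtain ⟨p⟩ := G.connected.preconnected v w
  induction p with
  | nil => exact ⟨0, PathLength.nil _⟩
  | @cons a b c hab p ih =>
    obtain ⟨L, hL⟩ := ih
    have he := G.endpoints ⟨s(a, b), hab⟩
    obtain ⟨M, hM⟩ := exists_path_edge (G := G) ⟨s(a, b), hab⟩
    rcases Sym2.eq_iff.1 he with ⟨h1, h2⟩ | ⟨h1, h2⟩
    · rw [h1, h2] at hM
      exact ⟨_, hM.append hL⟩
    · rw [h1, h2] at hM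
      exact ⟨_, hM.reverse.append hL⟩

theorem exists_path_to_vertex (x : G.Point) :
    ∃ v L, G.PathLength x (Point.vertex v) L := by
  cases x with
  | vertex v => exact ⟨v, 0, PathLength.nil _⟩
  | inner e t h0 h1 =>
    have h := PathLength.single e ⟨h0.le, h1.le⟩ (left_mem_Icc.2 (G.len_pos e).le)
    rw [pt_zero, pt_inner e t h0 h1] at h
    exact ⟨_, _, h⟩

theorem exists_path (x y : G.Point) : ∃ L, G.PathLength x y L := by
  obtain ⟨v, L, hL⟩ := exists_path_to_vertex x
  obtain ⟨w, M, hM⟩ := exists_path_to_vertex y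
  obtain ⟨K, hK⟩ := exists_path_vertex (G := G) v w
  exact ⟨_, (hL.append hK).append hM.reverse⟩

end Distance

/-- The geodesic distance: the infimum of the lengths of the paths joining two points. -/
noncomputable instance (G : MetricGraph V) : PseudoMetricSpace G.Point where
  dist x y := sInf {L : ℝ | G.PathLength x y L}
  dist_self x :=
    le_antisymm (csInf_le ⟨0, fun _ h => PathLength.nonneg h⟩ (PathLength.nil x))
      (Real.sInf_nonneg fun _ h => PathLength.nonneg h)
  dist_comm x y := by
    congr 1
    ext L
    exact ⟨fun h => PathLength.reverse h, fun h => PathLength.reverse h⟩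
  dist_triangle x y z := by
    refine le_of_forall_pos_le_add fun ε hε => ?_
    obtain ⟨L, hL, hL'⟩ := exists_lt_of_csInf_lt (exists_path x y)
      (lt_add_of_pos_right _ (half_pos hε))
    obtain ⟨M, hM, hM'⟩ := exists_lt_of_csInf_lt (exists_path y z)
      (lt_add_of_pos_right _ (half_pos hε))
    have h : sInf {L : ℝ | G.PathLength x z L} ≤ L + M :=
      csInf_le ⟨0, fun _ h => PathLength.nonneg h⟩ (PathLength.append hL hM)
    change L < sInf {L : ℝ | G.PathLength x y L} + ε / 2 at hL'
    change M < sInf {L : ℝ | G.PathLength y z L} + ε / 2 at hM'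
    linarith

/-- The metric completion of the metric graph. -/
abbrev Completion (G : MetricGraph V) : Type _ := UniformSpace.Completion G.Point

/-- The inclusion of the metric graph in its completion. -/
noncomputable def toCompletion (G : MetricGraph V) (x : G.Point) : G.Completion :=
  (x : UniformSpace.Completion G.Point)

/-- The set of edges incident on the vertex `v`. -/
def incident (G : MetricGraph V) (v : V) : Set G.Edge := {e | v ∈ (e : Sym2 V)}

/-- The number of edges incident on the vertex `v`. -/
noncomputable def degree (G : MetricGraph V) (v : V) : ℕ := (G.incident v).ncard

/-- The boundary of the completion: the vertices of degree one, together with the points of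
the completion that are not points of the graph. -/
def boundary (G : MetricGraph V) : Set G.Completion :=
  {x | ∃ v : V, G.degree v = 1 ∧ x = G.toCompletion (Point.vertex v)} ∪
    (range G.toCompletion)ᶜ

/-- Any two distinct points of the completion are separated by a finite set of points of the
graph. -/
def WeaklyConnected (G : MetricGraph V) : Prop :=
  ∀ x y : G.Completion, x ≠ y →
    ∃ W : Set G.Point, W.Finite ∧ ∃ A B : Set G.Completion, IsOpen A ∧ IsOpen B ∧
      Disjoint A B ∧ (G.toCompletion '' W)ᶜ = A ∪ B ∧ x ∈ A ∧ y ∈ B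

/-- The restriction of a function on the graph to the edge `e`, in the coordinate of `e`. -/
noncomputable def onEdge (G : MetricGraph V) (f : G.Point → ℝ) (e : G.Edge) : ℝ → ℝ :=
  fun t => f (G.pt e t)

/-- The algebra of eventually flat functions: continuous functions on the completion which are
infinitely differentiable on the open edges, with derivative zero outside of finitely many edges
and near each vertex (as the graph is locally finite, the latter means that the derivative is zero
near both endpoints of each edge). -/
structure EventuallyFlat (G : MetricGraph V) (φ : G.Completion → ℝ) : Prop where
  continuous : Continuous φ
  smooth : ∀ e : G.Edge,
    ContDiffOn ℝ (⊤ : ℕ∞) (G.onEdge (φ ∘ G.toCompletion) e) (Ioo 0 (G.len e))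
  flat_cofinite : ∃ S : Set G.Edge, S.Finite ∧ ∀ e : G.Edge, e ∉ S →
    ∀ t ∈ Ioo 0 (G.len e), deriv (G.onEdge (φ ∘ G.toCompletion) e) t = 0
  flat_src : ∀ e : G.Edge,
    ∀ᶠ t in 𝓝[>] (0 : ℝ), deriv (G.onEdge (φ ∘ G.toCompletion) e) t = 0
  flat_tgt : ∀ e : G.Edge,
    ∀ᶠ t in 𝓝[<] (G.len e), deriv (G.onEdge (φ ∘ G.toCompletion) e) t = 0

/-- The derivative of `u` along the closed edge `e` (one-sided at the endpoints), in the
coordinate of `e`. -/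
noncomputable def edgeDeriv (G : MetricGraph V) (u : G.Point → ℝ) (e : G.Edge) : ℝ → ℝ :=
  derivWithin (G.onEdge u e) (Icc 0 (G.len e))

open Classical in
/-- For a vertex `v` of the edge `e`, the derivative at `v` of the restriction of `u` to `e`,
in the local coordinate of `e` which starts at `v`. -/
noncomputable def vertexDeriv (G : MetricGraph V) (u : G.Point → ℝ) (e : G.Edge) (v : V) : ℝ :=
  if G.src e = v then G.edgeDeriv u e 0 else -G.edgeDeriv u e (G.len e)

/-- Solutions of `u'' = q u` on the edges with the standard vertex conditions. The continuity
condition at the vertices holds as `u` is a function on the graph whose restrictions to the closed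
edges are differentiable, hence continuous. -/
structure IsQHarmonic (G : MetricGraph V) (q u : G.Point → ℝ) : Prop where
  differentiable : ∀ e : G.Edge, DifferentiableOn ℝ (G.onEdge u e) (Icc 0 (G.len e))
  absolutelyContinuous : ∀ e : G.Edge,
    AbsolutelyContinuousOnInterval (G.edgeDeriv u e) 0 (G.len e)
  equation : ∀ e : G.Edge, ∀ᵐ t ∂(volume.restrict (Ioo 0 (G.len e))),
    HasDerivAt (G.edgeDeriv u e) (G.onEdge q e t * G.onEdge u e t) t
  vertex_condition : ∀ v : V, 2 ≤ G.degree v → ∑ᶠ e ∈ G.incident v, G.vertexDeriv u e v = 0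

/-- `q` is nonnegative, integrable on each edge (that is, locally integrable) and integrable over
the whole graph, and there is a weight `ω > 0`, constant on each edge, with `∑ₑ ω(e) < ∞` and
`∫ (ω⁻¹ q)² ω < ∞`. -/
structure IsAdmissible (G : MetricGraph V) (q : G.Point → ℝ) : Prop where
  nonneg : ∀ x, 0 ≤ q x
  locallyIntegrable : ∀ e : G.Edge, IntegrableOn (G.onEdge q e) (Ioo 0 (G.len e))
  integrable : Summable fun e : G.Edge => ∫ t in (0 : ℝ)..(G.len e), G.onEdge q e t
  weight : ∃ ω : G.Edge → ℝ, (∀ e, 0 < ω e) ∧ Summable ω ∧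
    ∑' e : G.Edge, ∫⁻ t in Ioo 0 (G.len e),
      ENNReal.ofReal (((ω e)⁻¹ * G.onEdge q e t) ^ 2 * ω e) < ⊤

/-- `u` is a continuous function on the completion which is `q`-harmonic on the graph, with
boundary values `U`. -/
structure IsQHarmonicExtension (G : MetricGraph V) (q : G.Point → ℝ) (U : G.boundary → ℝ)
    (u : G.Completion → ℝ) : Prop where
  continuous : Continuous u
  qHarmonic : G.IsQHarmonic q (u ∘ G.toCompletion)
  eq_boundary : ∀ x : G.boundary, u x = U x

/-- `φ` is an eventually flat function which is `1` on `E` and `0` on the rest of the boundary. -/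
structure IsTestFunction (G : MetricGraph V) (E : Set G.boundary) (φ : G.Completion → ℝ) :
    Prop where
  eventuallyFlat : G.EventuallyFlat φ
  eq_one : ∀ x ∈ E, φ (x : G.Completion) = 1
  eq_zero : ∀ x ∉ E, φ (x : G.Completion) = 0

open Classical in
/-- The `q`-harmonic extension of a function on the boundary. -/
noncomputable def qHarmonicExtension (G : MetricGraph V) (q : G.Point → ℝ)
    (U : G.boundary → ℝ) : G.Completion → ℝ :=
  if h : ∃ u, G.IsQHarmonicExtension q U u then h.choose else 0

open Classical in
/-- A test function for the boundary set `E`. -/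
noncomputable def testFunction (G : MetricGraph V) (E : Set G.boundary) : G.Completion → ℝ :=
  if h : ∃ φ, G.IsTestFunction E φ then h.choose else 0

/-- The restriction of `L φ = -φ'' + q φ` to the edge `e`. -/
noncomputable def edgeL (G : MetricGraph V) (q φ : G.Point → ℝ) (e : G.Edge) : ℝ → ℝ :=
  fun t => -deriv (deriv (G.onEdge φ e)) t + G.onEdge q e t * G.onEdge φ e t

/-- The integral of `u L φ` over the metric graph. -/
noncomputable def integralL (G : MetricGraph V) (q : G.Point → ℝ) (u φ : G.Completion → ℝ) : ℝ :=
  ∑' e : G.Edge, ∫ t in (0 : ℝ)..(G.len e),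
    G.onEdge (u ∘ G.toCompletion) e t * G.edgeL q (φ ∘ G.toCompletion) e t

/-- The Dirichlet-Neumann function `Λ_q(U, E) = ∫ u L φ`, where `u` is the `q`-harmonic
extension of `U`, and `φ` is an eventually flat function equal to `1` on `E` and to `0` on the
rest of the boundary. -/
noncomputable def dirichletNeumann (G : MetricGraph V) (q : G.Point → ℝ) (U : G.boundary → ℝ)
    (E : Set G.boundary) : ℝ :=
  G.integralL q (G.qHarmonicExtension q U) (G.testFunction E)

end MetricGraph

/-! Why the signs hold. Let `u` be the extension of $1_\Omega$. The maximum principle gives $0<u<1$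
away from the boundary. Integrating by parts on each edge turns $\int u\,L\phi$ into the sum over
edges of the flux of $u'$ weighted by the vertex values of $\phi$. By the vertex conditions this sum
does not change when the weight changes at finitely many edges and not at the vertices of degree one
(`IsSolution.hasSum_edgeFlux_zero`). Hence $\phi$ may be replaced by $\phi\,\chi(u)$, where $\chi$
is $1$ near the boundary value of $u$ on $E$ and $\chi(u)=0$ wherever $\phi'\ne0$. Then
$(\phi\chi(u))'=\phi\chi'(u)u'$, and `hasSum_flux` gives
$$\Lambda_q(1_\Omega,E)=\sum_e\int_e\phi\,\chi'(u)\,(u')^2+\sum_e\int_e q\,u\,\phi\,\chi(u).$$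

For $E_1$ the cutoff increases with `u`, so both sums are nonnegative. The first is positive, since
otherwise $\phi\chi(u)$ would be constant although it is $1$ on $E_1$ and $0$ elsewhere on the
boundary. For $E_2$ the cutoff decreases and vanishes from a small level $c$ on. The first sum is
then negative, and the second is at most $c\int q$; letting $c\to0$ gives the weak inequality. If
$q=0$ near the boundary, the second sum vanishes for small $c$ and the inequality is strict.

What must exist. Weak connectedness and compactness separate a clopen set from the rest of the
boundary by finitely many points, and the edges avoiding these points lie on one side; this yields
step functions (`WeaklyConnected.exists_isStepFunction`). The extension comes from Dirichlet's
principle: the energy is minimized over a step function plus functions of finite support. Since the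
diameter is finite, energy controls the supremum norm (`exists_sq_le_energy`), so minimizing
sequences converge uniformly. Testing the limit with the Green functions of the edges gives the
differential equation, and testing with the star functions of the vertices gives the vertex
conditions (`isQHarmonic_of_limit`).

The maximum principle. Where `u` has a maximum $M\ge0$, the function $v=M-u\ge0$ satisfies $v''\le
qv$ with $v=v'=0$ at one point, so it vanishes on the edge (`eq_zero_of_deriv_sub_le`). At a vertex
of degree at least two the outgoing derivatives are nonpositive with sum zero, so constancy passes
to all incident edges. -/

/-! ### Calculus of absolutely continuous functions on an interval -/

/-- `F` is a primitive on `[a, b]` of the integrable function `p`. -/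
structure IsPrimOn (F p : ℝ → ℝ) (a b : ℝ) : Prop where
  integrable : IntervalIntegrable p volume a b
  sub_eq : ∀ s ∈ Icc a b, ∀ t ∈ Icc a b, F t - F s = ∫ x in s..t, p x

namespace IsPrimOn

variable {F p H h : ℝ → ℝ} {a b : ℝ}

theorem integrable_of_mem (hF : IsPrimOn F p a b) {s t : ℝ} (hs : s ∈ Icc a b)
    (ht : t ∈ Icc a b) : IntervalIntegrable p volume s t :=
  hF.integrable.mono_set (by
    rw [uIcc_of_le (hs.1.trans hs.2)]; exact uIcc_subset_Icc hs ht)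

theorem mono (hF : IsPrimOn F p a b) {c d : ℝ} (hc : c ∈ Icc a b) (hd : d ∈ Icc a b) :
    IsPrimOn F p c d := by
  have hsub : Icc c d ⊆ Icc a b := Icc_subset_Icc hc.1 hd.2
  exact ⟨hF.integrable_of_mem hc hd, fun s hs t ht => hF.sub_eq s (hsub hs) t (hsub ht)⟩

theorem of_eq_add (hp : IntervalIntegrable p volume a b)
    (hF : ∀ t ∈ Icc a b, F t = F a + ∫ x in a..t, p x) : IsPrimOn F p a b := by
  refine ⟨hp, fun s hs t ht => ?_⟩
  have hi : ∀ r ∈ Icc a b, IntervalIntegrable p volume a r := fun r hr =>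
    hp.mono_set (by
      rw [uIcc_of_le (hr.1.trans hr.2), uIcc_of_le hr.1]; exact Icc_subset_Icc le_rfl hr.2)
  rw [hF s hs, hF t ht, ← intervalIntegral.integral_interval_sub_left (hi t ht) (hi s hs)]
  ring

theorem eq_add (hF : IsPrimOn F p a b) {t : ℝ} (ht : t ∈ Icc a b) :
    F t = F a + ∫ x in a..t, p x := by
  rw [← hF.sub_eq a ⟨le_rfl, ht.1.trans ht.2⟩ t ht]; ring

theorem congr (hF : IsPrimOn F p a b) (hab : a ≤ b) {F' p' : ℝ → ℝ} (hFF : EqOn F F' (Icc a b))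
    (hpp : EqOn p p' (Ioo a b)) : IsPrimOn F' p' a b := by
  have hpp' : ∀ᵐ x, x ∈ uIoc a b → p x = p' x := by
    have h₂ : ∀ᵐ x : ℝ, x ≠ b := by simp [ae_iff, measure_singleton]
    filter_upwards [h₂] with x hx hxm
    rw [uIoc_of_le hab] at hxm
    exact hpp ⟨hxm.1, lt_of_le_of_ne hxm.2 hx⟩
  refine ⟨hF.integrable.congr_ae ((ae_restrict_iff' measurableSet_uIoc).2 hpp'),
    fun s hs t ht => ?_⟩
  rw [← hFF hs, ← hFF ht, hF.sub_eq s hs t ht]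
  refine intervalIntegral.integral_congr_ae ?_
  filter_upwards [hpp'] with x hx hxm
  refine hx ?_
  rw [uIoc_of_le hab]
  exact ⟨(le_min hs.1 ht.1).trans_lt hxm.1, hxm.2.trans (max_le hs.2 ht.2)⟩

theorem ac (hF : IsPrimOn F p a b) (hab : a ≤ b) : AbsolutelyContinuousOnInterval F a b := by
  have h1 := hF.integrable.absolutelyContinuousOnInterval_intervalIntegral
    (c := a) left_mem_uIcc
  have h2 : AbsolutelyContinuousOnInterval (fun _ : ℝ => F a) a b :=
    (LipschitzWith.const (F a)).lipschitzOnWith.absolutelyContinuousOnInterval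
  have h3 := h2.add h1
  rw [absolutelyContinuousOnInterval_iff] at h3 ⊢
  intro ε hε
  obtain ⟨δ, hδ, h⟩ := h3 ε hε
  refine ⟨δ, hδ, fun E hE hE' => ?_⟩
  refine lt_of_eq_of_lt (Finset.sum_congr rfl fun i hi => ?_) (h E hE hE')
  have hm := hE.1 i hi
  rw [uIcc_of_le hab] at hm
  rw [hF.eq_add hm.1, hF.eq_add hm.2]
  rfl

theorem continuousOn (hF : IsPrimOn F p a b) : ContinuousOn F (Icc a b) := by
  rcases le_or_gt a b with hab | hab
  · simpa [uIcc_of_le hab] using (hF.ac hab).continuousOn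
  · simp [Icc_eq_empty (not_le.2 hab)]

theorem ae_hasDerivAt (hF : IsPrimOn F p a b) :
    ∀ᵐ x, x ∈ Ioo a b → HasDerivAt F (p x) x := by
  filter_upwards [hF.integrable.ae_hasDerivAt_integral] with x hx hxm
  have hab : a ≤ b := (hxm.1.trans hxm.2).le
  have h := (hx (by rw [uIcc_of_le hab]; exact Ioo_subset_Icc_self hxm) a left_mem_uIcc).const_add
    (F a)
  refine h.congr_of_eventuallyEq ?_
  filter_upwards [Ioo_mem_nhds hxm.1 hxm.2] with y hy
  exact hF.eq_add (Ioo_subset_Icc_self hy)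

theorem of_ac (hab : a ≤ b) (hF : AbsolutelyContinuousOnInterval F a b)
    (hp : ∀ᵐ x ∂(volume.restrict (Ioo a b)), HasDerivAt F (p x) x) : IsPrimOn F p a b := by
  have hp' : ∀ᵐ x ∂(volume.restrict (uIoc a b)), deriv F x = p x := by
    rw [uIoc_of_le hab, ← Measure.restrict_congr_set Ioo_ae_eq_Ioc]
    filter_upwards [hp] with x hx using hx.deriv
  refine ⟨hF.intervalIntegrable_deriv.congr_ae hp', fun s hs t ht => ?_⟩
  have hsub : uIcc s t ⊆ uIcc a b := by
    rw [uIcc_of_le hab]; exact uIcc_subset_Icc hs ht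
  rw [← (hF.mono hsub).integral_deriv_eq_sub]
  refine intervalIntegral.integral_congr_ae ?_
  have hp'' := (ae_restrict_iff' measurableSet_uIoc).1 hp'
  filter_upwards [hp''] with x hx hxm
  refine hx ?_
  rw [uIoc_of_le hab]
  exact ⟨(le_min hs.1 ht.1).trans_lt hxm.1, hxm.2.trans (max_le hs.2 ht.2)⟩

theorem of_hasDerivWithinAt (hF : ∀ t ∈ Icc a b, HasDerivWithinAt F (p t) (Icc a b) t)
    (hp : ContinuousOn p (Icc a b)) (hab : a ≤ b) : IsPrimOn F p a b := by
  have hpi : IntervalIntegrable p volume a b :=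
    ContinuousOn.intervalIntegrable (by rwa [uIcc_of_le hab])
  refine of_eq_add hpi fun t ht => ?_
  rw [intervalIntegral.integral_eq_sub_of_hasDerivAt_of_le ht.1]
  · ring
  · exact fun x hx => ((hF x ⟨hx.1, hx.2.trans ht.2⟩).continuousWithinAt).mono
      (Icc_subset_Icc le_rfl ht.2)
  · exact fun x hx => (hF x ⟨hx.1.le, (hx.2.trans_le ht.2).le⟩).hasDerivAt
      (Icc_mem_nhds hx.1 (hx.2.trans_le ht.2))
  · exact hpi.mono_set (by
      rw [uIcc_of_le hab, uIcc_of_le ht.1]; exact Icc_subset_Icc le_rfl ht.2)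

theorem hasDerivWithinAt (hF : IsPrimOn F p a b) (hp : ContinuousOn p (Icc a b)) {t : ℝ}
    (ht : t ∈ Icc a b) (hab : a < b) : HasDerivWithinAt F (p t) (Icc a b) t := by
  -- The instance is what makes `Icc a b` an admissible filter for the fundamental theorem, so that
  -- endpoints are covered too.
  have : Fact (t ∈ Icc a b) := ⟨ht⟩
  have h := intervalIntegral.integral_hasDerivWithinAt_of_tendsto_ae_right
    (f := p) (a := a) (b := t) (c := p t) (s := Icc a b) (t := Icc a b)
    (hF.integrable_of_mem ⟨le_rfl, hab.le⟩ ht)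
    (hp.stronglyMeasurableAtFilter_nhdsWithin measurableSet_Icc t)
    ((hp t ht).mono_left inf_le_left)
  exact (h.const_add (F a)).congr (fun x hx => hF.eq_add hx) (hF.eq_add ht)

/-- Integration by parts for merely integrable derivatives, as `q` is only integrable. -/
theorem integral_mul (hF : IsPrimOn F p a b) (hH : IsPrimOn H h a b) (hab : a ≤ b) :
    ∫ x in a..b, (p x * H x + F x * h x) = F b * H b - F a * H a := by
  rw [← (hF.ac hab).integral_deriv_mul_eq_sub (hH.ac hab)]
  refine intervalIntegral.integral_congr_ae ?_
  have h₂ : ∀ᵐ x : ℝ, x ≠ b := by simp [ae_iff, measure_singleton]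
  filter_upwards [hF.ae_hasDerivAt, hH.ae_hasDerivAt, h₂] with x h1 h2 hb hx
  rw [uIoc_of_le hab] at hx
  have hx' : x ∈ Ioo a b := ⟨hx.1, lt_of_le_of_ne hx.2 hb⟩
  rw [(h1 hx').deriv, (h2 hx').deriv]

theorem integrable_mul_continuousOn (hF : IsPrimOn F p a b) (hab : a ≤ b)
    (hH : ContinuousOn H (Icc a b)) : IntervalIntegrable (fun x => p x * H x) volume a b :=
  hF.integrable.mul_continuousOn (by rwa [uIcc_of_le hab])

theorem mul (hF : IsPrimOn F p a b) (hH : IsPrimOn H h a b) (hab : a ≤ b) :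
    IsPrimOn (fun x => F x * H x) (fun x => p x * H x + F x * h x) a b := by
  refine of_eq_add ?_ fun t ht => ?_
  · refine (hF.integrable_mul_continuousOn hab hH.continuousOn).add ?_
    simpa only [mul_comm] using hH.integrable_mul_continuousOn hab hF.continuousOn
  · have ha : a ∈ Icc a b := ⟨le_rfl, hab⟩
    rw [(hF.mono ha ht).integral_mul (hH.mono ha ht) ht.1]; ring

theorem neg (hF : IsPrimOn F p a b) : IsPrimOn (fun x => -F x) (fun x => -p x) a b :=
  ⟨hF.integrable.neg, fun s hs t ht => by
    rw [intervalIntegral.integral_neg, ← hF.sub_eq s hs t ht]; ring⟩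

end IsPrimOn

/-! ### Unique continuation on an interval -/

/-- Unique continuation to the right from a zero which is a minimum. -/
theorem eq_zero_of_deriv_sub_le_right {v d k : ℝ → ℝ} {a b : ℝ} (hab : a < b)
    (hv : ∀ t ∈ Icc a b, HasDerivWithinAt v (d t) (Icc a b) t) (hd : ContinuousOn d (Icc a b))
    (hk : IntervalIntegrable k volume a b) (hk0 : ∀ t ∈ Icc a b, 0 ≤ k t)
    (hv0 : ∀ t ∈ Icc a b, 0 ≤ v t) (hva : v a = 0) (hda : d a = 0)
    (hdk : ∀ s ∈ Icc a b, ∀ t ∈ Icc a b, s ≤ t → d t - d s ≤ ∫ x in s..t, k x * v x) :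
    ∀ t ∈ Icc a b, v t = 0 := by
  have hP : IsPrimOn v d a b := IsPrimOn.of_hasDerivWithinAt hv hd hab.le
  have hvc := hP.continuousOn
  set I := ∫ x in a..b, k x with hI
  have hI0 : 0 ≤ I := intervalIntegral.integral_nonneg hab.le hk0
  have hclosed : IsClosed ({t | v t = 0} ∩ Icc a b) := by
    rw [inter_comm]
    exact hvc.preimage_isClosed_of_isClosed isClosed_Icc (isClosed_singleton (x := (0 : ℝ)))
  refine fun t ht => hclosed.Icc_subset_of_forall_mem_nhdsWithin hva ?_ ht
  rintro x ⟨hx0, hx⟩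
  have hx0 : v x = 0 := hx0
  have hxI : x ∈ Icc a b := Ico_subset_Icc_self hx
  have hdx : d x = 0 := by
    rcases hx.1.eq_or_lt with rfl | hlt
    · exact hda
    · have hn := Icc_mem_nhds hlt hx.2
      refine IsLocalMin.hasDerivAt_eq_zero ?_ ((hv x hxI).hasDerivAt hn)
      filter_upwards [hn] with y hy
      rw [hx0]; exact hv0 y hy
  -- The step is short enough that integrating twice gives $\max v\le\tfrac12\max v$ on `[x, c]`.
  -- The `+ 1` covers `I = 0`.
  set c := min b (x + 1 / (2 * (I + 1))) with hc
  have hxc : x < c := lt_min hx.2 (by have : 0 < 1 / (2 * (I + 1)) := by positivity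
                                      linarith)
  have hcI : c ∈ Icc a b := ⟨hx.1.trans hxc.le, min_le_left _ _⟩
  have hsub : Icc x c ⊆ Icc a b := Icc_subset_Icc hx.1 hcI.2
  obtain ⟨m, hm, hmax⟩ := isCompact_Icc.exists_isMaxOn (nonempty_Icc.2 hxc.le) (hvc.mono hsub)
  have hmax' : ∀ y ∈ Icc x c, v y ≤ v m := fun y hy => hmax hy
  have hki : ∀ s ∈ Icc a b, ∀ t ∈ Icc a b, IntervalIntegrable k volume s t := fun s hs t ht =>
    hk.mono_set (by rw [uIcc_of_le hab.le]; exact uIcc_subset_Icc hs ht)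
  have hdr : ∀ r ∈ Icc x c, d r ≤ v m * I := by
    intro r hr
    have h1 := hdk x hxI r (hsub hr) hr.1
    rw [hdx, sub_zero] at h1
    refine h1.trans ?_
    calc ∫ y in x..r, k y * v y ≤ ∫ y in x..r, v m * k y := by
          refine intervalIntegral.integral_mono_on hr.1 ?_ ?_ ?_
          · refine (hki x hxI r (hsub hr)).mul_continuousOn ?_
            rw [uIcc_of_le hr.1]
            exact hvc.mono (Icc_subset_Icc hx.1 (hsub hr).2)
          · exact (hki x hxI r (hsub hr)).const_mul _
          · intro y hy
            have hy' : y ∈ Icc x c := ⟨hy.1, hy.2.trans hr.2⟩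
            rw [mul_comm]
            exact mul_le_mul_of_nonneg_right (hmax' y hy') (hk0 y (hsub hy'))
      _ = v m * ∫ y in x..r, k y := intervalIntegral.integral_const_mul _ _
      _ ≤ v m * I := by
          refine mul_le_mul_of_nonneg_left ?_ (hv0 m (hsub hm))
          refine intervalIntegral.integral_mono_interval hx.1 hr.1 (hsub hr).2 ?_ hk
          filter_upwards [ae_restrict_mem measurableSet_Ioc] with y hy
          exact hk0 y (Ioc_subset_Icc_self hy)
  have hvm : v m ≤ 0 := by
    have h1 := hP.sub_eq x hxI m (hsub hm)
    rw [hx0, sub_zero] at h1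
    have h2 : v m ≤ (m - x) * (v m * I) := by
      have h3 : ∫ y in x..m, d y ≤ ∫ y in x..m, v m * I :=
        intervalIntegral.integral_mono_on hm.1 (hP.integrable_of_mem hxI (hsub hm))
          intervalIntegrable_const fun y hy => hdr y ⟨hy.1, hy.2.trans hm.2⟩
      rw [intervalIntegral.integral_const, smul_eq_mul] at h3
      linarith
    have h4 : m - x ≤ 1 / (2 * (I + 1)) := by
      have := hm.2.trans (min_le_right _ _); linarith
    have hvm0 := hv0 m (hsub hm)
    have h5 : (m - x) * (v m * I) ≤ 1 / (2 * (I + 1)) * (v m * I) :=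
      mul_le_mul_of_nonneg_right h4 (by positivity)
    have h6 : 1 / (2 * (I + 1)) * (v m * I) ≤ v m / 2 := by
      rw [div_mul_eq_mul_div, div_le_div_iff₀ (by positivity) (by positivity)]
      nlinarith
    linarith
  filter_upwards [Ioo_mem_nhdsGT hxc] with y hy
  have hy' : y ∈ Icc x c := Ioo_subset_Icc_self hy
  exact le_antisymm ((hmax' y hy').trans hvm) (hv0 y (hsub hy'))

/-- Unique continuation from a zero which is a minimum. -/
theorem eq_zero_of_deriv_sub_le {v d k : ℝ → ℝ} {a b c : ℝ} (hab : a < b) (hc : c ∈ Icc a b)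
    (hv : ∀ t ∈ Icc a b, HasDerivWithinAt v (d t) (Icc a b) t) (hd : ContinuousOn d (Icc a b))
    (hk : IntervalIntegrable k volume a b) (hk0 : ∀ t ∈ Icc a b, 0 ≤ k t)
    (hv0 : ∀ t ∈ Icc a b, 0 ≤ v t) (hvc : v c = 0) (hdc : d c = 0)
    (hdk : ∀ s ∈ Icc a b, ∀ t ∈ Icc a b, s ≤ t → d t - d s ≤ ∫ x in s..t, k x * v x) :
    ∀ t ∈ Icc a b, v t = 0 := by
  intro t ht
  have hki : ∀ s ∈ Icc a b, ∀ t ∈ Icc a b, IntervalIntegrable k volume s t := fun s hs t ht =>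
    hk.mono_set (by rw [uIcc_of_le hab.le]; exact uIcc_subset_Icc hs ht)
  rcases le_or_gt c t with hct | htc
  · rcases hc.2.eq_or_lt with rfl | hcb
    · rwa [le_antisymm ht.2 hct]
    have hsub : Icc c b ⊆ Icc a b := Icc_subset_Icc hc.1 le_rfl
    exact eq_zero_of_deriv_sub_le_right hcb (fun s hs => (hv s (hsub hs)).mono hsub)
      (hd.mono hsub) (hki _ hc _ ⟨hab.le, le_rfl⟩) (fun s hs => hk0 s (hsub hs))
      (fun s hs => hv0 s (hsub hs)) hvc hdc
      (fun s hs r hr => hdk s (hsub hs) r (hsub hr)) t ⟨hct, ht.2⟩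
  · have hac : -c < -a := neg_lt_neg (ht.1.trans_lt htc)
    have hmem : ∀ s ∈ Icc (-c) (-a), -s ∈ Icc a b := fun s hs =>
      ⟨by linarith [hs.2], by linarith [hs.1, hc.2]⟩
    have hmaps : MapsTo (fun s : ℝ => -s) (Icc (-c) (-a)) (Icc a b) := hmem
    -- Reflection reduces continuation to the left to continuation to the right; the derivative
    -- changes sign.
    have h := eq_zero_of_deriv_sub_le_right (v := fun s => v (-s)) (d := fun s => -d (-s))
      (k := fun s => k (-s)) hac
      (fun s hs => by
        have h := (hv (-s) (hmem s hs)).comp s ((hasDerivAt_neg s).hasDerivWithinAt) hmaps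
        simpa using! h)
      (hd.comp continuous_neg.continuousOn hmaps).neg
      (by
        have h := (hki _ ⟨le_rfl, hab.le⟩ _ hc).comp_mul_left (c := (-1 : ℝ))
        simp only [div_neg, div_one, neg_mul, one_mul] at h
        exact h.symm)
      (fun s hs => hk0 _ (hmem s hs)) (fun s hs => hv0 _ (hmem s hs))
      (by simpa using hvc) (by simpa using hdc)
      (fun s hs r hr hsr => by
        have h := hdk (-r) (hmem r hr) (-s) (hmem s hs) (by linarith)
        rw [intervalIntegral.integral_comp_neg (fun x => k x * v x)]
        linarith)
      (-t) ⟨by linarith, by linarith [ht.1]⟩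
    simpa using h

/-! ### Abstract minimization of a quadratic functional -/

/-- Approximate minimizers of a quadratic functional which is bounded below. -/
theorem exists_energy_cauchySeq {K : Type*} [AddCommGroup K] [Module ℝ K]
    (B : LinearMap.BilinForm ℝ K) (hB : B.IsSymm) (hpos : ∀ x, 0 ≤ B x x) (l : K →ₗ[ℝ] ℝ) (C : ℝ)
    (hC : ∀ x, C ≤ B x x - 2 * l x) :
    ∃ w : ℕ → K, (∀ n m, B (w n - w m) (w n - w m) ≤ 2 / ((n : ℝ) + 1) + 2 / ((m : ℝ) + 1)) ∧
      ∀ x, Tendsto (fun n => B (w n) x) atTop (𝓝 (l x)) := by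
  set J : K → ℝ := fun x => B x x - 2 * l x with hJ
  have hbdd : BddBelow (range J) := ⟨C, by rintro _ ⟨x, rfl⟩; exact hC x⟩
  set m := ⨅ x, J x with hm
  have hmle : ∀ x, m ≤ J x := fun x => ciInf_le hbdd x
  have hex : ∀ n : ℕ, ∃ x, J x < m + 1 / ((n : ℝ) + 1) := fun n =>
    exists_lt_of_ciInf_lt (lt_add_of_pos_right _ (by positivity))
  choose w hw using hex
  have hsymm : ∀ x y, B x y = B y x := fun x y => by simpa using (hB.eq y x).symm
  refine ⟨w, fun n k => ?_, fun x => ?_⟩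
  -- Parallelogram identity: comparing with the midpoint makes a minimizing sequence Cauchy in
  -- energy.
  · have h := hmle ((1 / 2 : ℝ) • (w n + w k))
    have h1 := hw n
    have h2 := hw k
    simp only [hJ, map_smul, map_add, LinearMap.smul_apply, LinearMap.add_apply, smul_eq_mul,
      map_sub, LinearMap.sub_apply] at h h1 h2 ⊢
    rw [hsymm (w k) (w n)] at h ⊢
    have e1 : 2 / ((n : ℝ) + 1) = 2 * (1 / ((n : ℝ) + 1)) := by ring
    have e2 : 2 / ((k : ℝ) + 1) = 2 * (1 / ((k : ℝ) + 1)) := by ring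
    rw [e1, e2]
    linarith
  · set b := B x x with hb
    have hb0 : 0 ≤ b := hpos x
    have key : ∀ n, (B (w n) x - l x) ^ 2 ≤ (b + 1) * (1 / ((n : ℝ) + 1)) := by
      intro n
      set a := B (w n) x - l x with ha
      -- A variation in the direction `x` with a nearly optimal step; dividing by `b + 1` and not by
      -- `b` allows `b = 0`.
      have h := hmle (w n + (-a / (b + 1)) • x)
      have h1 := hw n
      simp only [hJ, map_smul, map_add, LinearMap.smul_apply, LinearMap.add_apply,
        smul_eq_mul] at h h1
      rw [hsymm x (w n), ← hb] at h
      have e : B (w n) x = a + l x := by rw [ha]; ring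
      rw [e] at h
      set s := -a / (b + 1) with hs
      have hsb : s * (b + 1) = -a := by rw [hs]; field_simp
      have h3 : 0 ≤ 2 * s * a + s ^ 2 * b + 1 / ((n : ℝ) + 1) := by nlinarith
      have h4 : 2 * s * a + s ^ 2 * b = -a * s * 1 + 2 * s * a - s ^ 2 := by
        have : s ^ 2 * b = s * (s * (b + 1)) - s ^ 2 := by ring
        rw [this, hsb]; ring
      have h5 : a = -(s * (b + 1)) := by rw [hsb]; ring
      have h6 : s * a ≥ -(1 / ((n : ℝ) + 1)) := by nlinarith [sq_nonneg s]
      have h7 : a ^ 2 = -(s * a) * (b + 1) := by nlinarith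
      rw [h7, mul_comm]
      exact mul_le_mul_of_nonneg_left (by linarith) (by linarith)
    have ht : Tendsto (fun n : ℕ => (b + 1) * (1 / ((n : ℝ) + 1))) atTop (𝓝 0) := by
      simpa using tendsto_one_div_add_atTop_nhds_zero_nat.const_mul (b + 1)
    have hsq : Tendsto (fun n => (B (w n) x - l x) ^ 2) atTop (𝓝 0) :=
      squeeze_zero (fun n => sq_nonneg _) key ht
    have habs : Tendsto (fun n => |B (w n) x - l x|) atTop (𝓝 0) := by
      have := (Real.continuous_sqrt.tendsto 0).comp hsq
      simpa [Function.comp_def, Real.sqrt_sq_eq_abs] using this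
    have := (tendsto_zero_iff_abs_tendsto_zero _).2 habs
    simpa using this.add_const (l x)

namespace MetricGraph

variable {V : Type*} {G : MetricGraph V}

/-! ### Edges and points -/

theorem zero_mem (e : G.Edge) : (0 : ℝ) ∈ Icc 0 (G.len e) := ⟨le_rfl, (G.len_pos e).le⟩

theorem len_mem (e : G.Edge) : G.len e ∈ Icc 0 (G.len e) := ⟨(G.len_pos e).le, le_rfl⟩

theorem mem_incident_iff {e : G.Edge} {v : V} :
    e ∈ G.incident v ↔ v = G.src e ∨ v = G.tgt e := by
  rw [incident, mem_ofPred_eq, ← G.endpoints e, Sym2.mem_iff]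

theorem src_mem_incident (e : G.Edge) : e ∈ G.incident (G.src e) := mem_incident_iff.2 (.inl rfl)

theorem tgt_mem_incident (e : G.Edge) : e ∈ G.incident (G.tgt e) := mem_incident_iff.2 (.inr rfl)

theorem src_ne_tgt (e : G.Edge) : G.src e ≠ G.tgt e := by
  have h : s(G.src e, G.tgt e) ∈ G.graph.edgeSet := by rw [G.endpoints e]; exact e.2
  exact ((SimpleGraph.mem_edgeSet _).1 h).ne

theorem incident_finite (v : V) : (G.incident v).Finite := by
  refine Finite.subset (((G.locallyFinite v).image fun w => s(v, w)).preimage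
    (Subtype.val_injective.injOn)) fun e he => ?_
  obtain ⟨w, hw⟩ := Sym2.mem_iff_exists.1 (show v ∈ (e : Sym2 V) from he)
  exact ⟨w, by have := e.2; rwa [hw] at this, hw.symm⟩

theorem exists_edge_of_adj {a b : V} (h : G.graph.Adj a b) :
    ∃ e : G.Edge, (G.src e = a ∧ G.tgt e = b) ∨ (G.src e = b ∧ G.tgt e = a) := by
  refine ⟨⟨s(a, b), h⟩, ?_⟩
  exact Sym2.eq_iff.1 (G.endpoints ⟨s(a, b), h⟩)

theorem exists_incident [Nonempty G.Edge] (v : V) : ∃ e, e ∈ G.incident v := by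
  obtain ⟨e₀⟩ := ‹Nonempty G.Edge›
  obtain ⟨p⟩ := G.connected.preconnected v (G.src e₀)
  cases p with
  | nil => exact ⟨e₀, src_mem_incident e₀⟩
  | cons h p =>
    obtain ⟨e, he | he⟩ := exists_edge_of_adj h
    · exact ⟨e, mem_incident_iff.2 (.inl he.1.symm)⟩
    · exact ⟨e, mem_incident_iff.2 (.inr he.2.symm)⟩

theorem exists_eq_pt [Nonempty G.Edge] (p : G.Point) :
    ∃ e, ∃ t ∈ Icc 0 (G.len e), p = G.pt e t := by
  cases p with
  | vertex v =>
    obtain ⟨e, he⟩ := exists_incident (G := G) v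
    rcases mem_incident_iff.1 he with rfl | rfl
    · exact ⟨e, 0, zero_mem e, (pt_zero e).symm⟩
    · exact ⟨e, _, len_mem e, (pt_len e).symm⟩
  | inner e t h0 h1 => exact ⟨e, t, ⟨h0.le, h1.le⟩, (pt_inner e t h0 h1).symm⟩

/-- A property of vertices which passes along edges holds everywhere. -/
theorem vertex_induction {P : V → Prop} (v : V) (hv : P v)
    (h : ∀ e : G.Edge, P (G.src e) ↔ P (G.tgt e)) (w : V) : P w := by
  obtain ⟨p⟩ := G.connected.preconnected v w
  induction p with
  | nil => exact hv
  | @cons a b c hab p ih =>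
    obtain ⟨e, he | he⟩ := exists_edge_of_adj hab
    · exact ih (he.2 ▸ (h e).1 (he.1.symm ▸ hv))
    · exact ih (he.1 ▸ (h e).2 (he.2.symm ▸ hv))

/-! ### Lipschitz functions and the completion -/

theorem PathLength.abs_sub_le {f : G.Point → ℝ} {K : ℝ}
    (hf : ∀ e, ∀ s ∈ Icc 0 (G.len e), ∀ t ∈ Icc 0 (G.len e),
      |f (G.pt e s) - f (G.pt e t)| ≤ K * |s - t|)
    {x y : G.Point} {L : ℝ} (h : G.PathLength x y L) : |f x - f y| ≤ K * L := by
  induction h with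
  | nil x => simp
  | @cons e s t hs ht y L h ih =>
    calc |f (G.pt e s) - f y| ≤ |f (G.pt e s) - f (G.pt e t)| + |f (G.pt e t) - f y| :=
          _root_.abs_sub_le _ _ _
      _ ≤ K * |s - t| + K * L := add_le_add (hf e s hs t ht) ih
      _ = K * (|s - t| + L) := by ring

/-- The distance is an infimum over paths, and along a path the edgewise bounds add up. Lower bounds
for the distance below come from suitable choices of `f`. -/
theorem abs_sub_le_mul_dist {f : G.Point → ℝ} {K : ℝ} (hK : 0 < K)
    (hf : ∀ e, ∀ s ∈ Icc 0 (G.len e), ∀ t ∈ Icc 0 (G.len e),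
      |f (G.pt e s) - f (G.pt e t)| ≤ K * |s - t|) (x y : G.Point) :
    |f x - f y| ≤ K * dist x y := by
  rw [← div_le_iff₀' hK]
  exact le_csInf (exists_path x y) fun L hL => (div_le_iff₀' hK).2 (PathLength.abs_sub_le hf hL)

theorem uniformContinuous_of_edge {f : G.Point → ℝ} {K : ℝ} (hK : 0 < K)
    (hf : ∀ e, ∀ s ∈ Icc 0 (G.len e), ∀ t ∈ Icc 0 (G.len e),
      |f (G.pt e s) - f (G.pt e t)| ≤ K * |s - t|) : UniformContinuous f :=
  (LipschitzWith.of_dist_le_mul (K := ⟨K, hK.le⟩) fun x y => by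
    rw [Real.dist_eq]; exact abs_sub_le_mul_dist hK hf x y).uniformContinuous

theorem dist_pt_le (e : G.Edge) {s t : ℝ} (hs : s ∈ Icc 0 (G.len e)) (ht : t ∈ Icc 0 (G.len e)) :
    dist (G.pt e s) (G.pt e t) ≤ |s - t| :=
  csInf_le ⟨0, fun _ h => PathLength.nonneg h⟩ (PathLength.single e hs ht)

theorem continuousOn_pt (e : G.Edge) : ContinuousOn (G.pt e) (Icc 0 (G.len e)) :=
  (LipschitzOnWith.of_dist_le_mul (K := 1) fun s hs t ht => by
    simpa [Real.dist_eq] using dist_pt_le e hs ht).continuousOn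

theorem continuous_toCompletion : Continuous G.toCompletion :=
  UniformSpace.Completion.continuous_coe _

theorem denseRange_toCompletion : DenseRange G.toCompletion :=
  UniformSpace.Completion.denseRange_coe

theorem continuousOn_toCompletion_pt (e : G.Edge) :
    ContinuousOn (fun t => G.toCompletion (G.pt e t)) (Icc 0 (G.len e)) :=
  continuous_toCompletion.comp_continuousOn (continuousOn_pt e)

theorem continuousOn_onEdge {u : G.Completion → ℝ} (hu : Continuous u) (e : G.Edge) :
    ContinuousOn (G.onEdge (u ∘ G.toCompletion) e) (Icc 0 (G.len e)) :=
  hu.comp_continuousOn (continuousOn_toCompletion_pt e)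

/-- The closed edge as a subset of the completion. -/
def closedEdge (G : MetricGraph V) (e : G.Edge) : Set G.Completion :=
  (fun t => G.toCompletion (G.pt e t)) '' Icc 0 (G.len e)

theorem isClosed_closedEdge (e : G.Edge) : IsClosed (G.closedEdge e) :=
  (isCompact_Icc.image_of_continuousOn (continuousOn_toCompletion_pt e)).isClosed

theorem isPreconnected_closedEdge (e : G.Edge) : IsPreconnected (G.closedEdge e) :=
  isPreconnected_Icc.image _ (continuousOn_toCompletion_pt e)

theorem exists_extension {f : G.Point → ℝ} (hf : UniformContinuous f) :
    ∃ F : G.Completion → ℝ, Continuous F ∧ ∀ p, F (G.toCompletion p) = f p :=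
  ⟨UniformSpace.Completion.extension f, UniformSpace.Completion.continuous_extension,
    UniformSpace.Completion.extension_coe hf⟩

theorem eq_const_of_forall_point {u : G.Completion → ℝ} (hu : Continuous u) {M : ℝ}
    (h : ∀ p, u (G.toCompletion p) = M) (x : G.Completion) : u x = M :=
  congrFun (denseRange_toCompletion.equalizer hu continuous_const (funext h)) x

/-- Without edges, the connected graph is a single vertex of degree zero, which is its own
completion and has no boundary. -/
theorem nonempty_edge_of_boundary {x : G.Completion} (hx : x ∈ G.boundary) :
    Nonempty G.Edge := by
  rcases hx with ⟨v, hv, -⟩ | hx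
  · obtain ⟨e, -⟩ := nonempty_of_ncard_ne_zero (s := G.incident v)
      (by rw [degree] at hv; rw [hv]; exact one_ne_zero)
    exact ⟨e⟩
  · by_contra hne
    rw [not_nonempty_iff] at hne
    have hsub : ∀ p q : G.Point, p = q := by
      intro p q
      cases p with
      | inner e => exact (hne.false e).elim
      | vertex v =>
        cases q with
        | inner e => exact (hne.false e).elim
        | vertex w =>
          rw [vertex_induction (G := G) (P := fun w => v = w) v rfl (fun e => hne.elim e) w]
    apply hx
    have : Subsingleton G.Point := ⟨hsub⟩
    have hc : IsClosed (range G.toCompletion) := (subsingleton_range _).isClosed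
    rw [← hc.closure_eq, denseRange_toCompletion.closure_range]
    trivial

/-- A finite union of closed edges is closed and consists of points of the graph, so a point at
infinity has a neighbourhood avoiding it; density of the graph does the rest. -/
theorem exists_notMem_closedEdge [Nonempty G.Edge] {S : Set G.Edge} (hS : S.Finite)
    {x : G.Completion} (hx : x ∉ range G.toCompletion) {O : Set G.Completion} (hO : IsOpen O)
    (hxO : x ∈ O) : ∃ e ∉ S, ∃ t ∈ Icc 0 (G.len e), G.toCompletion (G.pt e t) ∈ O := by
  have hcl : IsClosed (⋃ e ∈ S, G.closedEdge e) :=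
    hS.isClosed_biUnion fun e _ => isClosed_closedEdge e
  have hx' : x ∈ O ∩ (⋃ e ∈ S, G.closedEdge e)ᶜ := by
    refine ⟨hxO, fun h => hx ?_⟩
    simp only [mem_iUnion] at h
    obtain ⟨e, -, t, -, rfl⟩ := h
    exact mem_range_self _
  obtain ⟨p, hp⟩ := denseRange_toCompletion.exists_mem_open (hO.inter hcl.isOpen_compl) ⟨x, hx'⟩
  obtain ⟨e, t, ht, rfl⟩ := exists_eq_pt p
  refine ⟨e, fun heS => hp.2 ?_, t, ht, hp.1⟩
  exact mem_biUnion heS ⟨t, ht, rfl⟩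

theorem eq_zero_of_notMem_range [Nonempty G.Edge] {H : G.Completion → ℝ} (hH : Continuous H)
    {S : Set G.Edge} (hS : S.Finite)
    (h : ∀ e ∉ S, ∀ t ∈ Icc 0 (G.len e), H (G.toCompletion (G.pt e t)) = 0)
    {x : G.Completion} (hx : x ∉ range G.toCompletion) : H x = 0 := by
  by_contra hne
  obtain ⟨e, he, t, ht, h'⟩ := exists_notMem_closedEdge hS hx
    (isOpen_ne_fun hH continuous_const) hne
  exact h' (h e he t ht)

/-! ### Functions given by their derivatives -/

/-- The function on the graph with the given values at the vertices and the given derivatives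
along the edges. -/
noncomputable def ofGrad (G : MetricGraph V) (c : V → ℝ) (g : G.Edge → ℝ → ℝ) : G.Point → ℝ
  | .vertex v => c v
  | .inner e t _ _ => c (G.src e) + ∫ x in (0 : ℝ)..t, g e x

/-- `f` is a primitive of the bounded function `g`, which vanishes outside of finitely many
edges. -/
structure IsPrimitive (f : G.Point → ℝ) (g : G.Edge → ℝ → ℝ) : Prop where
  measurable : ∀ e, Measurable (g e)
  bounded : ∃ M, ∀ e, ∀ t ∈ Icc 0 (G.len e), |g e t| ≤ M
  finite : {e | ∃ t ∈ Icc 0 (G.len e), g e t ≠ 0}.Finite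
  eq_add : ∀ e, ∀ t ∈ Icc 0 (G.len e),
    f (G.pt e t) = f (.vertex (G.src e)) + ∫ x in (0 : ℝ)..t, g e x

theorem intervalIntegrable_of_bounded {g : ℝ → ℝ} (hg : Measurable g) {a b M : ℝ} (hab : a ≤ b)
    (hM : ∀ t ∈ Icc a b, |g t| ≤ M) : IntervalIntegrable g volume a b := by
  rw [intervalIntegrable_iff_integrableOn_Ioc_of_le hab]
  refine Measure.integrableOn_of_bounded (M := M) measure_Ioc_lt_top.ne hg.aestronglyMeasurable ?_
  filter_upwards [ae_restrict_mem measurableSet_Ioc] with t ht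
  exact hM t (Ioc_subset_Icc_self ht)

namespace IsPrimitive

variable {f : G.Point → ℝ} {g : G.Edge → ℝ → ℝ}

theorem isPrimOn (h : IsPrimitive f g) (e : G.Edge) :
    IsPrimOn (G.onEdge f e) (g e) 0 (G.len e) := by
  obtain ⟨M, hM⟩ := h.bounded
  refine IsPrimOn.of_eq_add
    (intervalIntegrable_of_bounded (h.measurable e) (G.len_pos e).le (hM e)) fun t ht => ?_
  simp only [onEdge]
  rw [h.eq_add e t ht, pt_zero]

theorem exists_lipschitz (h : IsPrimitive f g) : ∃ K, 0 < K ∧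
    ∀ e, ∀ s ∈ Icc 0 (G.len e), ∀ t ∈ Icc 0 (G.len e),
      |f (G.pt e s) - f (G.pt e t)| ≤ K * |s - t| := by
  obtain ⟨M, hM⟩ := h.bounded
  refine ⟨max M 1, by positivity, fun e s hs t ht => ?_⟩
  have h1 := (h.isPrimOn e).sub_eq t ht s hs
  simp only [onEdge] at h1
  rw [h1, ← Real.norm_eq_abs]
  refine intervalIntegral.norm_integral_le_of_norm_le_const fun x hx => ?_
  have hx' : x ∈ Icc 0 (G.len e) :=
    ⟨(le_min ht.1 hs.1).trans hx.1.le, hx.2.trans (max_le ht.2 hs.2)⟩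
  exact (hM e x hx').trans (le_max_left _ _)

theorem uniformContinuous (h : IsPrimitive f g) : UniformContinuous f := by
  obtain ⟨K, hK, hf⟩ := h.exists_lipschitz
  exact uniformContinuous_of_edge hK hf

/-- The condition `hc` says that integrating from the source arrives at the prescribed value at the
target, so the values fit together at the vertices. -/
theorem of_grad {c : V → ℝ} {S : Set G.Edge} (hS : S.Finite) (hg : ∀ e, Measurable (g e))
    (hgS : ∀ e ∉ S, ∀ t ∈ Icc 0 (G.len e), g e t = 0)
    (hM : ∀ e, ∃ M, ∀ t ∈ Icc 0 (G.len e), |g e t| ≤ M)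
    (hc : ∀ e, ∫ x in (0 : ℝ)..G.len e, g e x = c (G.tgt e) - c (G.src e)) :
    IsPrimitive (G.ofGrad c g) g := by
  choose M hM using hM
  refine ⟨hg, ?_, hS.subset fun e ⟨t, ht, h⟩ => by_contra fun he => h (hgS e he t ht),
    fun e t ht => ?_⟩
  · obtain ⟨C, hC⟩ := (hS.image M).bddAbove
    refine ⟨max C 0, fun e t ht => ?_⟩
    by_cases he : e ∈ S
    · exact (hM e t ht).trans ((hC ⟨e, he, rfl⟩).trans (le_max_left _ _))
    · rw [hgS e he t ht, abs_zero]; exact le_max_right _ _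
  · rcases ht.1.eq_or_lt with rfl | h0
    · rw [pt_zero]; simp
    · rcases ht.2.eq_or_lt with rfl | h1
      · rw [pt_len, hc]; simp [ofGrad]
      · rw [pt_inner e t h0 h1]; rfl

end IsPrimitive

open Classical in
/-- The derivative of the star function at `v`. -/
noncomputable def starGrad (G : MetricGraph V) (v : V) (e : G.Edge) : ℝ → ℝ :=
  fun _ => ((Pi.single v 1 : V → ℝ) (G.tgt e) - (Pi.single v 1 : V → ℝ) (G.src e)) / G.len e

open Classical in
/-- The star function at `v`: the function which is `1` at `v`, `0` at the other vertices, and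
linear on the edges. -/
noncomputable def star (G : MetricGraph V) (v : V) : G.Point → ℝ :=
  G.ofGrad (Pi.single v 1) (G.starGrad v)

open Classical in
theorem star_vertex (v w : V) : G.star v (.vertex w) = if w = v then 1 else 0 := by
  simp [star, ofGrad, Pi.single_apply]

theorem starGrad_eq_zero {v : V} {e : G.Edge} (he : e ∉ G.incident v) (t : ℝ) :
    G.starGrad v e t = 0 := by
  rw [mem_incident_iff, not_or] at he
  simp [starGrad, Ne.symm he.1, Ne.symm he.2]

theorem isPrimitive_star (v : V) : IsPrimitive (G.star v) (G.starGrad v) := by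
  refine IsPrimitive.of_grad (incident_finite v) (fun e => measurable_const)
    (fun e he t _ => starGrad_eq_zero he t) (fun e => ⟨|G.starGrad v e 0|, fun t _ => le_rfl⟩) fun e => ?_
  have := (G.len_pos e).ne'
  simp [starGrad]
  field_simp

theorem star_pt_eq_zero {v : V} {e : G.Edge} (he : e ∉ G.incident v) {t : ℝ}
    (ht : t ∈ Icc 0 (G.len e)) : G.star v (G.pt e t) = 0 := by
  rw [(isPrimitive_star v).eq_add e t ht, star_vertex]
  rw [mem_incident_iff, not_or] at he
  simp [starGrad, Ne.symm he.1, Ne.symm he.2]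

theorem star_src_pt (e : G.Edge) {t : ℝ} (ht : t ∈ Icc 0 (G.len e)) :
    G.star (G.src e) (G.pt e t) = 1 - t / G.len e := by
  rw [(isPrimitive_star _).eq_add e t ht, star_vertex]
  simp [starGrad, (src_ne_tgt e).symm]
  ring

/-- The positivity sets of the star functions cover the graph, and each of them meets finitely many
edges only. This combines local finiteness with compactness. -/
theorem exists_star_pos (p : G.Point) : ∃ v, 0 < G.star v p := by
  cases p with
  | vertex v => exact ⟨v, by rw [star_vertex]; simp⟩
  | inner e t h0 h1 =>
    refine ⟨G.src e, ?_⟩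
    rw [← pt_inner e t h0 h1, star_src_pt e ⟨h0.le, h1.le⟩, sub_pos, div_lt_one (G.len_pos e)]
    exact h1

theorem exists_star_extension (v : V) : ∃ F : G.Completion → ℝ, Continuous F ∧
    ∀ p, F (G.toCompletion p) = G.star v p := exists_extension (isPrimitive_star v).uniformContinuous

/-- All but finitely many closed edges are contained in a given neighbourhood of the points at
infinity. -/
theorem finite_setOf_edge_notMem [CompactSpace G.Completion] {N : Set G.Completion}
    (hN : IsOpen N) (hsub : (range G.toCompletion)ᶜ ⊆ N) :
    {e : G.Edge | ∃ t ∈ Icc 0 (G.len e), G.toCompletion (G.pt e t) ∉ N}.Finite := by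
  choose F hF hFs using fun v : V => exists_star_extension (G := G) v
  have hcov : Nᶜ ⊆ ⋃ v, {x | 0 < F v x} := by
    intro x hx
    obtain ⟨p, rfl⟩ : x ∈ range G.toCompletion := by
      by_contra h; exact hx (hsub h)
    obtain ⟨v, hv⟩ := exists_star_pos p
    exact mem_iUnion.2 ⟨v, by rw [mem_ofPred_eq, hFs]; exact hv⟩
  -- Finitely many stars cover the complement of `N`, so an edge leaving `N` is incident on one of
  -- finitely many vertices.
  obtain ⟨T, hT⟩ := hN.isClosed_compl.isCompact.elim_finite_subcover _
    (fun v => isOpen_lt continuous_const (hF v)) hcov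
  refine (T.finite_toSet.biUnion fun v _ => incident_finite (G := G) v).subset ?_
  rintro e ⟨t, ht, he⟩
  obtain ⟨v, hv, hpos⟩ := mem_iUnion₂.1 (hT he)
  rw [mem_ofPred_eq, hFs] at hpos
  refine mem_biUnion (Finset.mem_coe.2 hv) (by_contra fun hn => ?_)
  rw [star_pt_eq_zero hn ht] at hpos
  exact lt_irrefl _ hpos

/-- A point of the graph belongs to finitely many closed edges of the completion. -/
theorem finite_setOf_mem_closedEdge (p : G.Point) :
    {e : G.Edge | G.toCompletion p ∈ G.closedEdge e}.Finite := by
  -- The star function extends to the completion, so its value depends only on the image of `p`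
  -- there; injectivity of the inclusion is not needed.
  obtain ⟨v, hv⟩ := exists_star_pos p
  obtain ⟨F, -, hFs⟩ := exists_star_extension (G := G) v
  refine (incident_finite (G := G) v).subset ?_
  rintro e ⟨t, ht, he⟩
  by_contra hn
  have h1 := hFs (G.pt e t)
  dsimp only at he
  rw [he, hFs, star_pt_eq_zero hn ht] at h1
  exact hv.ne' h1

/-! ### Green functions of single edges -/

open Classical in
/-- The derivative of the Green function of the edge `e` with pole `s`. -/
noncomputable def greenGrad (G : MetricGraph V) (e : G.Edge) (s : ℝ) (e' : G.Edge) (t : ℝ) : ℝ :=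
  if e' = e then (if t ≤ s then 1 - s / G.len e else -(s / G.len e)) else 0

/-- The Green function of `-d²/dx²` on the edge `e` with pole `s`. -/
noncomputable def green (G : MetricGraph V) (e : G.Edge) (s : ℝ) : G.Point → ℝ :=
  G.ofGrad 0 (G.greenGrad e s)

theorem greenGrad_self_le (e : G.Edge) {s t : ℝ} (h : t ≤ s) :
    G.greenGrad e s e t = 1 - s / G.len e := by simp [greenGrad, h]

theorem greenGrad_self_gt (e : G.Edge) {s t : ℝ} (h : s < t) :
    G.greenGrad e s e t = -(s / G.len e) := by simp [greenGrad, not_le.2 h]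

theorem greenGrad_ne {e e' : G.Edge} (h : e' ≠ e) (s t : ℝ) : G.greenGrad e s e' t = 0 := by
  simp [greenGrad, h]

theorem measurable_greenGrad (e : G.Edge) (s : ℝ) (e' : G.Edge) :
    Measurable (G.greenGrad e s e') := by
  unfold greenGrad
  split_ifs
  · exact Measurable.ite measurableSet_Iic measurable_const measurable_const
  · exact measurable_const

theorem abs_greenGrad_le (e : G.Edge) {s : ℝ} (hs : s ∈ Icc 0 (G.len e)) (e' : G.Edge) (t : ℝ) :
    |G.greenGrad e s e' t| ≤ 1 := by
  have h0 : 0 ≤ s / G.len e := div_nonneg hs.1 (G.len_pos e).le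
  have h1 : s / G.len e ≤ 1 := (div_le_one (G.len_pos e)).2 hs.2
  unfold greenGrad
  split_ifs
  · rw [abs_le]; constructor <;> linarith
  · rw [abs_le]; constructor <;> linarith
  · simp

/-- The integral of a function against the derivative of the Green function. -/
theorem integral_mul_greenGrad (e : G.Edge) {s : ℝ} (hs : s ∈ Icc 0 (G.len e)) {F p : ℝ → ℝ}
    (hF : IsPrimOn F p 0 (G.len e)) :
    ∫ t in (0 : ℝ)..G.len e, p t * G.greenGrad e s e t =
      F s - (1 - s / G.len e) * F 0 - s / G.len e * F (G.len e) := by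
  have h1 : ∫ t in (0 : ℝ)..s, p t * G.greenGrad e s e t = (F s - F 0) * (1 - s / G.len e) := by
    rw [hF.sub_eq 0 (zero_mem e) s hs, ← intervalIntegral.integral_mul_const]
    refine intervalIntegral.integral_congr_ae (.of_forall fun t ht => ?_)
    rw [uIoc_of_le hs.1] at ht
    simp only [greenGrad_self_le e ht.2]
  have h2 : ∫ t in s..G.len e, p t * G.greenGrad e s e t =
      (F (G.len e) - F s) * -(s / G.len e) := by
    rw [hF.sub_eq s hs _ (len_mem e), ← intervalIntegral.integral_mul_const]
    refine intervalIntegral.integral_congr_ae (.of_forall fun t ht => ?_)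
    rw [uIoc_of_le hs.2] at ht
    simp only [greenGrad_self_gt e ht.1]
  have hi : IntervalIntegrable (fun t => p t * G.greenGrad e s e t) volume 0 (G.len e) := by
    rw [intervalIntegrable_iff_integrableOn_Ioc_of_le (G.len_pos e).le]
    refine Integrable.mul_bdd (c := 1) ?_ (measurable_greenGrad e s e).aestronglyMeasurable
      (.of_forall fun t => abs_greenGrad_le e hs e t)
    exact (intervalIntegrable_iff_integrableOn_Ioc_of_le (G.len_pos e).le).1 hF.integrable
  rw [← intervalIntegral.integral_add_adjacent_intervals (b := s) (hi.mono_set ?_)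
    (hi.mono_set ?_), h1, h2]
  · ring
  · rw [uIcc_of_le hs.1, uIcc_of_le (G.len_pos e).le]; exact Icc_subset_Icc le_rfl hs.2
  · rw [uIcc_of_le hs.2, uIcc_of_le (G.len_pos e).le]; exact Icc_subset_Icc hs.1 le_rfl

theorem isPrimitive_green (e : G.Edge) {s : ℝ} (hs : s ∈ Icc 0 (G.len e)) :
    IsPrimitive (G.green e s) (G.greenGrad e s) := by
  refine IsPrimitive.of_grad (finite_singleton e) (measurable_greenGrad e s)
    (fun e' he t _ => greenGrad_ne he s t) (fun e' => ⟨1, fun t _ => abs_greenGrad_le e hs e' t⟩)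
    fun e' => ?_
  rcases eq_or_ne e' e with rfl | h
  · have hF : IsPrimOn (fun t => t) (fun _ => 1) 0 (G.len e') :=
      ⟨intervalIntegrable_const, fun s _ t _ => by simp⟩
    have h := integral_mul_greenGrad e' hs hF
    have := (G.len_pos e').ne'
    simp only [one_mul] at h
    rw [h]
    simp
    field_simp
    simp
  · simp [greenGrad_ne h]

theorem green_vertex (e : G.Edge) (s : ℝ) (v : V) : G.green e s (.vertex v) = 0 := rfl

theorem green_pt_of_ne {e e' : G.Edge} (h : e' ≠ e) {s : ℝ} (hs : s ∈ Icc 0 (G.len e)) {t : ℝ}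
    (ht : t ∈ Icc 0 (G.len e')) : G.green e s (G.pt e' t) = 0 := by
  rw [(isPrimitive_green e hs).eq_add e' t ht, green_vertex]
  simp [greenGrad_ne h]

theorem green_pt_self (e : G.Edge) {s : ℝ} (hs : s ∈ Icc 0 (G.len e)) :
    G.green e s (G.pt e s) = s * (1 - s / G.len e) := by
  rw [(isPrimitive_green e hs).eq_add e s hs, green_vertex, zero_add]
  rw [intervalIntegral.integral_congr_ae (g := fun _ => 1 - s / G.len e)]
  · simp
    ring
  · refine .of_forall fun t ht => ?_
    rw [uIoc_of_le hs.1] at ht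
    exact greenGrad_self_le e ht.2

theorem green_pt_self_pos (e : G.Edge) {s : ℝ} (h0 : 0 < s) (h1 : s < G.len e) :
    0 < G.green e s (G.pt e s) := by
  rw [green_pt_self e ⟨h0.le, h1.le⟩]
  refine mul_pos h0 ?_
  rw [sub_pos, div_lt_one (G.len_pos e)]
  exact h1

/-- Around each other point there is a star or Green function, positive there and zero at the
vertices of degree one. Having finite support, it also vanishes at infinity, so its positivity set
is a neighbourhood missing the boundary. -/
theorem isClosed_boundary : IsClosed G.boundary := by
  rw [← isOpen_compl_iff, isOpen_iff_mem_nhds]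
  intro x hx
  obtain ⟨hx1, hx2⟩ := not_or.1 hx
  obtain ⟨p, rfl⟩ : x ∈ range G.toCompletion := by_contra hx2
  have key : ∀ (f : G.Point → ℝ) (g : G.Edge → ℝ → ℝ) (S : Set G.Edge), S.Finite →
      IsPrimitive f g → (∀ e ∉ S, ∀ t ∈ Icc 0 (G.len e), f (G.pt e t) = 0) → 0 < f p →
      (∀ v, G.degree v = 1 → f (.vertex v) = 0) → G.boundaryᶜ ∈ 𝓝 (G.toCompletion p) := by
    intro f g S hS hf hfS hp hv
    obtain ⟨F, hF, hFf⟩ := exists_extension hf.uniformContinuous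
    have hO : IsOpen {y | 0 < F y} := isOpen_lt continuous_const hF
    refine mem_of_superset (hO.mem_nhds (show 0 < F _ by rw [hFf]; exact hp)) fun y hy hyb => ?_
    have hyne := nonempty_edge_of_boundary hyb
    rcases hyb with ⟨v, hdv, rfl⟩ | hy'
    · rw [mem_ofPred_eq, hFf, hv v hdv] at hy
      exact lt_irrefl _ hy
    · rw [mem_ofPred_eq, eq_zero_of_notMem_range hF hS (fun e he t ht => by
        rw [hFf]; exact hfS e he t ht) hy'] at hy
      exact lt_irrefl _ hy
  cases p with
  | vertex v =>
    refine key _ _ _ (incident_finite v) (isPrimitive_star v) (fun e he t ht =>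
      star_pt_eq_zero he ht) (by rw [star_vertex]; simp) fun w hw => ?_
    rw [star_vertex, if_neg]
    rintro rfl
    exact hx1 ⟨w, hw, rfl⟩
  | inner e t h0 h1 =>
    have ht : t ∈ Icc 0 (G.len e) := ⟨h0.le, h1.le⟩
    refine key _ _ _ (finite_singleton e) (isPrimitive_green e ht) (fun e' he s hs =>
      green_pt_of_ne he ht hs) ?_ fun v _ => rfl
    rw [← pt_inner e t h0 h1]
    exact green_pt_self_pos e h0 h1

end MetricGraph

namespace MetricGraph

variable {V : Type*} {G : MetricGraph V}

/-! ### Separation by finite sets -/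

/-- `X` and `Y` are separated by a finite set of points of the graph. -/
def FinitelySeparated (G : MetricGraph V) (X Y : Set G.Completion) : Prop :=
  ∃ W : Set G.Point, W.Finite ∧ ∃ A B : Set G.Completion, IsOpen A ∧ IsOpen B ∧
    Disjoint A B ∧ (G.toCompletion '' W)ᶜ ⊆ A ∪ B ∧ X ⊆ A ∧ Y ⊆ B

/-- Separability from `X` passes to subsets and to unions of two sets: the cutting sets are united
and the sides containing `X` are intersected. Compact induction applies. -/
theorem FinitelySeparated.of_isCompact {X Y : Set G.Completion} (hY : IsCompact Y)
    (h : ∀ y ∈ Y, ∃ O, IsOpen O ∧ y ∈ O ∧ G.FinitelySeparated X O) :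
    G.FinitelySeparated X Y := by
  refine hY.induction_on (p := fun Y => G.FinitelySeparated X Y) ?_ ?_ ?_ ?_
  · exact ⟨∅, finite_empty, univ, ∅, isOpen_univ, isOpen_empty, disjoint_empty _, by simp,
      subset_univ _, le_rfl⟩
  · rintro s t hst ⟨W, hW, A, B, hA, hB, hAB, hc, hX, ht⟩
    exact ⟨W, hW, A, B, hA, hB, hAB, hc, hX, hst.trans ht⟩
  · rintro s t ⟨W, hW, A, B, hA, hB, hAB, hc, hX, hs⟩ ⟨W', hW', A', B', hA', hB', hAB', hc', hX', ht⟩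
    refine ⟨W ∪ W', hW.union hW', A ∩ A', B ∪ B', hA.inter hA', hB.union hB', ?_, ?_,
      subset_inter hX hX', union_subset_union hs ht⟩
    · rw [disjoint_union_right]
      exact ⟨hAB.mono_left inter_subset_left, hAB'.mono_left inter_subset_right⟩
    · intro x hx
      rw [image_union, compl_union] at hx
      rcases hc hx.1 with h1 | h1
      · rcases hc' hx.2 with h2 | h2
        · exact .inl ⟨h1, h2⟩
        · exact .inr (.inr h2)
      · exact .inr (.inl h1)
  · intro y hy
    obtain ⟨O, hO, hyO, hs⟩ := h y hy
    exact ⟨O, mem_nhdsWithin_of_mem_nhds (hO.mem_nhds hyO), hs⟩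

/-- The passage from points to compact sets is made twice, once for each of the two sets, with the
roles of the sides exchanged in between. -/
theorem WeaklyConnected.finitelySeparated (hG : G.WeaklyConnected) {X Y : Set G.Completion}
    (hX : IsCompact X) (hY : IsCompact Y) (hXY : Disjoint X Y) : G.FinitelySeparated X Y := by
  refine FinitelySeparated.of_isCompact hY fun y hy => ?_
  have h : G.FinitelySeparated {y} X := by
    refine FinitelySeparated.of_isCompact hX fun x hx => ?_
    obtain ⟨W, hW, A, B, hA, hB, hAB, hc, hxA, hyB⟩ := hG x y fun h => hXY.le_bot ⟨hx, h ▸ hy⟩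
    exact ⟨A, hA, hxA, W, hW, B, A, hB, hA, hAB.symm, by rw [hc, union_comm],
      singleton_subset_iff.2 hyB, le_rfl⟩
  obtain ⟨W, hW, A, B, hA, hB, hAB, hc, hyA, hXB⟩ := h
  exact ⟨A, hA, hyA rfl, W, hW, B, A, hB, hA, hAB.symm, by rwa [union_comm], hXB, le_rfl⟩

/-! ### Step functions -/

/-- A smooth step from `0` to `1` on the interval `[0, l]`, constant on the outer thirds. -/
noncomputable def edgeStep (l t : ℝ) : ℝ := Real.smoothTransition (3 * t / l - 1)

theorem contDiff_edgeStep (l : ℝ) : ContDiff ℝ (⊤ : ℕ∞) (edgeStep l) :=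
  Real.smoothTransition.contDiff.comp (by fun_prop)

theorem edgeStep_of_le {l t : ℝ} (hl : 0 < l) (ht : t ≤ l / 3) : edgeStep l t = 0 := by
  refine Real.smoothTransition.zero_of_nonpos ?_
  rw [sub_nonpos, div_le_one hl]; linarith

theorem edgeStep_of_ge {l t : ℝ} (hl : 0 < l) (ht : 2 * l / 3 ≤ t) : edgeStep l t = 1 := by
  refine Real.smoothTransition.one_of_one_le ?_
  rw [le_sub_iff_add_le, le_div_iff₀ hl]; linarith

theorem hasDerivAt_edgeStep (l t : ℝ) : HasDerivAt (edgeStep l) (deriv (edgeStep l) t) t :=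
  (((contDiff_edgeStep l).differentiable (by simp)) t).hasDerivAt

theorem continuous_deriv_edgeStep (l : ℝ) : Continuous (deriv (edgeStep l)) :=
  (contDiff_edgeStep l).continuous_deriv (by simp)

theorem mem_of_deriv_edgeStep_ne_zero {l t : ℝ} (hl : 0 < l) (h : deriv (edgeStep l) t ≠ 0) :
    t ∈ Icc (l / 3) (2 * l / 3) := by
  refine ⟨not_lt.1 fun hlt => h ?_, not_lt.1 fun hlt => h ?_⟩
  · have : edgeStep l =ᶠ[𝓝 t] fun _ => 0 := by
      filter_upwards [Iio_mem_nhds hlt] with x hx using edgeStep_of_le hl (le_of_lt hx)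
    rw [this.deriv_eq, deriv_const]
  · have : edgeStep l =ᶠ[𝓝 t] fun _ => 1 := by
      filter_upwards [Ioi_mem_nhds hlt] with x hx using edgeStep_of_ge hl (le_of_lt hx)
    rw [this.deriv_eq, deriv_const]

theorem integral_deriv_edgeStep {l : ℝ} (hl : 0 < l) (t : ℝ) :
    ∫ x in (0 : ℝ)..t, deriv (edgeStep l) x = edgeStep l t := by
  rw [intervalIntegral.integral_eq_sub_of_hasDerivAt (fun x _ => hasDerivAt_edgeStep l x)
    ((continuous_deriv_edgeStep l).intervalIntegrable _ _),
    edgeStep_of_le hl (t := 0) (by positivity), sub_zero]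

/-- The derivative of the step function with values `c` at the vertices. -/
noncomputable def stepGrad (G : MetricGraph V) (c : V → ℝ) (e : G.Edge) (t : ℝ) : ℝ :=
  (c (G.tgt e) - c (G.src e)) * deriv (edgeStep (G.len e)) t

theorem continuous_stepGrad (c : V → ℝ) (e : G.Edge) : Continuous (G.stepGrad c e) :=
  continuous_const.mul (continuous_deriv_edgeStep _)

theorem isPrimitive_step {c : V → ℝ} (hc : {e : G.Edge | c (G.src e) ≠ c (G.tgt e)}.Finite) :
    IsPrimitive (G.ofGrad c (G.stepGrad c)) (G.stepGrad c) := by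
  refine IsPrimitive.of_grad hc (fun e => (continuous_stepGrad c e).measurable)
    (fun e he t _ => ?_) (fun e => ?_) (fun e => ?_)
  · rw [mem_ofPred_eq, not_not] at he
    rw [stepGrad, he, sub_self, zero_mul]
  · obtain ⟨M, hM⟩ := isCompact_Icc.exists_bound_of_continuousOn
      (continuous_stepGrad c e).continuousOn (s := Icc 0 (G.len e))
    exact ⟨M, hM⟩
  · simp only [stepGrad]
    have hl := G.len_pos e
    rw [intervalIntegral.integral_const_mul, integral_deriv_edgeStep hl,
      edgeStep_of_ge hl (by linarith), mul_one]

theorem ofGrad_step_pt {c : V → ℝ} (hc : {e : G.Edge | c (G.src e) ≠ c (G.tgt e)}.Finite)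
    (e : G.Edge) {t : ℝ} (ht : t ∈ Icc 0 (G.len e)) :
    G.ofGrad c (G.stepGrad c) (G.pt e t) =
      c (G.src e) + (c (G.tgt e) - c (G.src e)) * edgeStep (G.len e) t := by
  rw [(isPrimitive_step hc).eq_add e t ht]
  simp only [stepGrad]
  rw [intervalIntegral.integral_const_mul, integral_deriv_edgeStep (G.len_pos e)]
  rfl

/-- A step function: a test function for `E` with values in `[0, 1]`, equal to `0` or `1` at the
vertices, with derivative `g` supported in the middle thirds of finitely many edges. -/
structure IsStepFunction (E : Set G.boundary) (φ : G.Completion → ℝ) (g : G.Edge → ℝ → ℝ) :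
    Prop where
  isTestFunction : G.IsTestFunction E φ
  isPrimitive : IsPrimitive (φ ∘ G.toCompletion) g
  mem_Icc : ∀ x, φ x ∈ Icc 0 1
  vertex : ∀ v, φ (G.toCompletion (.vertex v)) = 0 ∨ φ (G.toCompletion (.vertex v)) = 1
  support : ∀ e t, g e t ≠ 0 → t ∈ Icc (G.len e / 3) (2 * G.len e / 3)

-- Separate `E` from the rest of the boundary by a finite set of points. Vertices get the value `1`
-- on the side of `E` and `0` elsewhere; only the finitely many edges through the separating points
-- can join different values, and there a smooth step interpolates.
open Classical in
theorem WeaklyConnected.exists_isStepFunction [CompactSpace G.Completion] [Nonempty G.Edge]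
    (hG : G.WeaklyConnected) {E : Set G.boundary} (hE : IsClopen E) :
    ∃ φ g, IsStepFunction E φ g := by
  have hcpt : ∀ F : Set G.boundary, IsClosed F → IsCompact (Subtype.val '' F) := fun F hF =>
    (isClosed_boundary.isClosedEmbedding_subtypeVal.isClosedMap _ hF).isCompact
  obtain ⟨W, hW, A, B, hA, hB, hAB, hc, hXA, hYB⟩ := hG.finitelySeparated (hcpt E hE.1)
    (hcpt Eᶜ hE.compl.1) ((disjoint_image_iff Subtype.val_injective).2 disjoint_compl_right)
  set c : V → ℝ := fun v => if G.toCompletion (.vertex v) ∈ A then 1 else 0 with hcdef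
  have hcA : ∀ v, G.toCompletion (.vertex v) ∈ A → c v = 1 := fun v hv => if_pos hv
  have hcB : ∀ v, G.toCompletion (.vertex v) ∈ B → c v = 0 := fun v hv =>
    if_neg fun h => hAB.le_bot ⟨h, hv⟩
  have hc01 : ∀ v, c v = 0 ∨ c v = 1 := fun v => by
    simp only [hcdef]; split_ifs <;> simp
  set S : Set G.Edge := ⋃ w ∈ W, {e | G.toCompletion w ∈ G.closedEdge e} with hS
  have hSfin : S.Finite := hW.biUnion fun w _ => finite_setOf_mem_closedEdge w
  have hsrc : ∀ e : G.Edge, G.toCompletion (.vertex (G.src e)) ∈ G.closedEdge e := fun e =>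
    ⟨0, zero_mem e, by simp only [pt_zero]⟩
  have htgt : ∀ e : G.Edge, G.toCompletion (.vertex (G.tgt e)) ∈ G.closedEdge e := fun e =>
    ⟨_, len_mem e, by simp only [pt_len]⟩
  -- A closed edge is connected, so if it avoids the cutting points it lies on one side.
  have hedge : ∀ e ∉ S, G.closedEdge e ⊆ A ∨ G.closedEdge e ⊆ B := by
    intro e he
    have hsub : G.closedEdge e ⊆ A ∪ B := by
      refine Subset.trans (fun x hx => ?_) hc
      rintro ⟨w, hw, rfl⟩
      exact he (mem_biUnion hw hx)
    have hnot : G.toCompletion (.vertex (G.src e)) ∉ G.toCompletion '' W := by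
      rintro ⟨w, hw, hwe⟩
      exact he (mem_biUnion hw (by rw [mem_ofPred_eq, hwe]; exact hsrc e))
    rcases hc hnot with h | h
    · exact .inl ((isPreconnected_closedEdge e).subset_left_of_subset_union hA hB hAB hsub
        ⟨_, hsrc e, h⟩)
    · exact .inr ((isPreconnected_closedEdge e).subset_right_of_subset_union hA hB hAB hsub
        ⟨_, hsrc e, h⟩)
  have hcfin : {e : G.Edge | c (G.src e) ≠ c (G.tgt e)}.Finite := by
    refine hSfin.subset fun e he => by_contra fun heS => he ?_
    rcases hedge e heS with h | h
    · rw [hcA _ (h (hsrc e)), hcA _ (h (htgt e))]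
    · rw [hcB _ (h (hsrc e)), hcB _ (h (htgt e))]
  have hprim := isPrimitive_step hcfin
  obtain ⟨φ, hφ, hφf⟩ := exists_extension hprim.uniformContinuous
  have hφpt : ∀ e, ∀ t ∈ Icc 0 (G.len e), φ (G.toCompletion (G.pt e t)) =
      c (G.src e) + (c (G.tgt e) - c (G.src e)) * edgeStep (G.len e) t := fun e t ht => by
    rw [hφf, ofGrad_step_pt hcfin e ht]
  have hφv : ∀ v, φ (G.toCompletion (.vertex v)) = c v := fun v => by rw [hφf]; rfl
  have hderiv : ∀ e, ∀ t ∈ Ioo 0 (G.len e),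
      deriv (G.onEdge (φ ∘ G.toCompletion) e) t = G.stepGrad c e t := by
    intro e t ht
    have h := ((hasDerivAt_edgeStep (G.len e) t).const_mul (c (G.tgt e) - c (G.src e))).const_add
      (c (G.src e))
    refine (h.congr_of_eventuallyEq ?_).deriv
    filter_upwards [Ioo_mem_nhds ht.1 ht.2] with x hx using hφpt e x (Ioo_subset_Icc_self hx)
  have hsupp : ∀ e t, G.stepGrad c e t ≠ 0 → t ∈ Icc (G.len e / 3) (2 * G.len e / 3) :=
    fun e t h => mem_of_deriv_edgeStep_ne_zero (G.len_pos e) (right_ne_zero_of_mul h)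
  -- Treats both sides at once, with `(O, a)` equal to `(A, 1)` or `(B, 0)`. If the value at a point
  -- at infinity were not `a`, it would differ from `a` also at some point of an edge outside `S`
  -- contained in `O`, where the function is constantly `a`.
  have hval : ∀ (O : Set G.Completion) (a : ℝ), IsOpen O →
      (∀ v, G.toCompletion (.vertex v) ∈ O → c v = a) →
      (∀ e ∉ S, (G.closedEdge e ∩ O).Nonempty → G.closedEdge e ⊆ O) →
      ∀ x ∈ G.boundary, x ∈ O → φ x = a := by
    intro O a hO hOc hOe x hx hxO
    rcases hx with ⟨v, -, rfl⟩ | hx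
    · rw [hφv, hOc v hxO]
    · by_contra hne
      obtain ⟨e, he, t, ht, h1, h2⟩ := exists_notMem_closedEdge hSfin hx
        (hO.inter (isOpen_ne_fun hφ (continuous_const (y := a)))) ⟨hxO, hne⟩
      have hsub := hOe e he ⟨_, ⟨t, ht, rfl⟩, h1⟩
      refine h2 ?_
      rw [hφpt e t ht, hOc _ (hsub (hsrc e)), hOc _ (hsub (htgt e))]
      simp
  refine ⟨φ, G.stepGrad c, ⟨⟨hφ, ?_, ?_, ?_, ?_⟩, ?_, ?_⟩, ?_, ?_, ?_, hsupp⟩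
  · intro e
    refine ContDiffOn.congr (f := fun t => c (G.src e) +
      (c (G.tgt e) - c (G.src e)) * edgeStep (G.len e) t) ?_
      fun t ht => hφpt e t (Ioo_subset_Icc_self ht)
    exact (contDiff_const.add (contDiff_const.mul (contDiff_edgeStep _))).contDiffOn
  · refine ⟨_, hcfin, fun e he t ht => ?_⟩
    rw [mem_ofPred_eq, not_not] at he
    rw [hderiv e t ht, stepGrad, he, sub_self, zero_mul]
  · intro e
    have hl := G.len_pos e
    filter_upwards [Ioo_mem_nhdsGT (show (0 : ℝ) < G.len e / 3 by positivity)] with t ht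
    rw [hderiv e t ⟨ht.1, by linarith [ht.2]⟩]
    by_contra h
    exact not_lt.2 (hsupp e t h).1 ht.2
  · intro e
    have hl := G.len_pos e
    filter_upwards [Ioo_mem_nhdsLT (show 2 * G.len e / 3 < G.len e by linarith)] with t ht
    rw [hderiv e t ⟨by linarith [ht.1], ht.2⟩]
    by_contra h
    exact not_lt.2 (hsupp e t h).2 ht.1
  · intro x hx
    refine hval A 1 hA hcA (fun e he hne => (hedge e he).resolve_right fun h => ?_) x x.2
      (hXA ⟨x, hx, rfl⟩)
    obtain ⟨y, hy, hyA⟩ := hne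
    exact hAB.le_bot ⟨hyA, h hy⟩
  · intro x hx
    refine hval B 0 hB hcB (fun e he hne => (hedge e he).resolve_left fun h => ?_) x x.2
      (hYB ⟨x, hx, rfl⟩)
    obtain ⟨y, hy, hyB⟩ := hne
    exact hAB.le_bot ⟨h hy, hyB⟩
  · rwa [show φ ∘ G.toCompletion = G.ofGrad c (G.stepGrad c) from funext hφf]
  · intro x
    refine denseRange_toCompletion.induction_on x (isClosed_Icc.preimage hφ) fun p => ?_
    obtain ⟨e, t, ht, rfl⟩ := exists_eq_pt p
    rw [hφpt e t ht]
    have h0 := Real.smoothTransition.nonneg (3 * t / G.len e - 1)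
    have h1 := Real.smoothTransition.le_one (3 * t / G.len e - 1)
    rw [← edgeStep] at h0 h1
    rcases hc01 (G.src e) with h | h <;> rcases hc01 (G.tgt e) with h' | h' <;>
      rw [h, h'] <;> constructor <;> linarith
  · intro v
    rw [hφv]
    exact hc01 v

end MetricGraph

namespace MetricGraph

variable {V : Type*} {G : MetricGraph V}

/-! ### Bounds on lengths -/

/-- The vertices `v` and `w` are joined by the edges in `T`. -/
def Joins (G : MetricGraph V) (T : Finset G.Edge) (v w : V) : Prop :=
  ∀ P : V → Prop, (∀ e ∈ T, (P (G.src e) ↔ P (G.tgt e))) → (P v ↔ P w)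

theorem Joins.symm {T : Finset G.Edge} {v w : V} (h : G.Joins T v w) : G.Joins T w v :=
  fun P hP => (h P hP).symm

/-- Every level between `f v` and `f w` is crossed by an edge of `T`, since otherwise the sublevel
set would be invariant along `T` and contain only one of the two vertices. So the intervals spanned
by the edges cover `[f v, f w)`, and lengths are compared. Each edge is counted once, with no simple
path extracted. -/
theorem Joins.abs_sub_le {T : Finset G.Edge} {v w : V} (h : G.Joins T v w) (f : V → ℝ) :
    |f v - f w| ≤ ∑ e ∈ T, |f (G.src e) - f (G.tgt e)| := by
  wlog hvw : f v ≤ f w generalizing v w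
  · rw [abs_sub_comm]; exact this h.symm (le_of_not_ge hvw)
  have hsub : Ico (f v) (f w) ⊆ ⋃ e ∈ T, uIcc (f (G.src e)) (f (G.tgt e)) := by
    intro c hc
    by_contra hn
    simp only [mem_iUnion, not_exists] at hn
    have := h (fun u => f u ≤ c) fun e he => by
      have h1 := hn e he
      rw [mem_uIcc] at h1
      push Not at h1
      constructor
      · intro h2; exact (h1.1 h2).le
      · intro h2; exact (h1.2 h2).le
    exact not_le.2 hc.2 (this.1 hc.1)
  have hvol := (measure_mono (μ := volume) hsub).trans (measure_biUnion_finset_le _ _)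
  simp only [Real.volume_Ico, Real.volume_interval] at hvol
  rw [← ENNReal.ofReal_sum_of_nonneg (fun _ _ => abs_nonneg _),
    ENNReal.ofReal_le_ofReal_iff (Finset.sum_nonneg fun _ _ => abs_nonneg _)] at hvol
  rw [abs_sub_comm, abs_of_nonneg (sub_nonneg.2 hvw)]
  simpa only [abs_sub_comm] using hvol

open Classical in
theorem Joins.insert_tgt {T : Finset G.Edge} {v : V} {e : G.Edge} (h : G.Joins T v (G.src e)) :
    G.Joins (insert e T) v (G.tgt e) := fun P hP =>
  (h P fun e' he' => hP e' (Finset.mem_insert_of_mem he')).trans (hP e (Finset.mem_insert_self _ _))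

open Classical in
theorem Joins.insert_src {T : Finset G.Edge} {v : V} {e : G.Edge} (h : G.Joins T v (G.tgt e)) :
    G.Joins (insert e T) v (G.src e) := fun P hP =>
  (h P fun e' he' => hP e' (Finset.mem_insert_of_mem he')).trans
    (hP e (Finset.mem_insert_self _ _)).symm

theorem exists_joins (v w : V) : ∃ T, G.Joins T v w := by
  classical
  exact vertex_induction (G := G) (P := fun w => ∃ T, G.Joins T v w) v ⟨∅, fun P _ => Iff.rfl⟩
    (fun e => ⟨fun ⟨T, hT⟩ => ⟨_, hT.insert_tgt⟩, fun ⟨T, hT⟩ => ⟨_, hT.insert_src⟩⟩) w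

/-- The infimum of the total lengths of the sets of edges which join two vertices. -/
noncomputable def joinDist (G : MetricGraph V) (v w : V) : ℝ :=
  sInf {r | ∃ T, G.Joins T v w ∧ r = ∑ e ∈ T, G.len e}

theorem joinDist_le {v w : V} {T : Finset G.Edge} (h : G.Joins T v w) :
    G.joinDist v w ≤ ∑ e ∈ T, G.len e :=
  csInf_le ⟨0, by rintro _ ⟨T, -, rfl⟩; exact Finset.sum_nonneg fun e _ => (G.len_pos e).le⟩
    ⟨T, h, rfl⟩

theorem exists_joins_lt {v w : V} {r : ℝ} (h : G.joinDist v w < r) :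
    ∃ T, G.Joins T v w ∧ ∑ e ∈ T, G.len e < r := by
  obtain ⟨T₀, hT₀⟩ := exists_joins (G := G) v w
  obtain ⟨_, ⟨T, hT, rfl⟩, hr⟩ := exists_lt_of_csInf_lt
    (s := {r | ∃ T, G.Joins T v w ∧ r = ∑ e ∈ T, G.len e}) ⟨_, T₀, hT₀, rfl⟩ h
  exact ⟨T, hT, hr⟩

theorem joinDist_self_le (v : V) : G.joinDist v v ≤ 0 :=
  (joinDist_le (T := ∅) fun P _ => Iff.rfl).trans (by simp)

theorem sum_insert_len_le [DecidableEq G.Edge] (T : Finset G.Edge) (e : G.Edge) :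
    ∑ e ∈ insert e T, G.len e ≤ ∑ e ∈ T, G.len e + G.len e := by
  by_cases he : e ∈ T
  · rw [Finset.insert_eq_of_mem he]; linarith [G.len_pos e]
  · rw [Finset.sum_insert he, add_comm]

theorem joinDist_tgt_le (v : V) (e : G.Edge) :
    G.joinDist v (G.tgt e) ≤ G.joinDist v (G.src e) + G.len e := by
  classical
  refine le_of_forall_pos_le_add fun ε hε => ?_
  obtain ⟨T, hT, hlt⟩ := exists_joins_lt (lt_add_of_pos_right (G.joinDist v (G.src e)) hε)
  linarith [joinDist_le hT.insert_tgt, sum_insert_len_le T e]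

theorem joinDist_src_le (v : V) (e : G.Edge) :
    G.joinDist v (G.src e) ≤ G.joinDist v (G.tgt e) + G.len e := by
  classical
  refine le_of_forall_pos_le_add fun ε hε => ?_
  obtain ⟨T, hT, hlt⟩ := exists_joins_lt (lt_add_of_pos_right (G.joinDist v (G.tgt e)) hε)
  linarith [joinDist_le hT.insert_src, sum_insert_len_le T e]

/-- The function `joinDist v`, extended into an edge by the shorter way through one of its
endpoints, is `1`-Lipschitz on each edge, hence for the geodesic distance. -/
theorem joinDist_le_dist (v w : V) :
    G.joinDist v w ≤ dist (Point.vertex v : G.Point) (.vertex w) := by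
  set f : G.Point → ℝ := fun p => match p with
    | .vertex w => G.joinDist v w
    | .inner e t _ _ => min (G.joinDist v (G.src e) + t)
        (G.joinDist v (G.tgt e) + (G.len e - t)) with hf
  have hfpt : ∀ e, ∀ t ∈ Icc 0 (G.len e), f (G.pt e t) =
      min (G.joinDist v (G.src e) + t) (G.joinDist v (G.tgt e) + (G.len e - t)) := by
    intro e t ht
    rcases ht.1.eq_or_lt with rfl | h0
    · rw [pt_zero, min_eq_left (by linarith [joinDist_src_le v e])]
      simp [hf]
    · rcases ht.2.eq_or_lt with rfl | h1
      · rw [pt_len, min_eq_right (by linarith [joinDist_tgt_le v e])]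
        simp [hf]
      · rw [pt_inner e t h0 h1]
  have h := abs_sub_le_mul_dist (f := f) one_pos (fun e s hs t ht => by
    rw [hfpt e s hs, hfpt e t ht, one_mul]
    refine (abs_min_sub_min_le_max _ _ _ _).trans (max_le ?_ ?_)
    · exact le_of_eq (by congr 1; ring)
    · rw [abs_sub_comm s t]
      exact le_of_eq (by congr 1; ring)) (.vertex v) (.vertex w)
  rw [one_mul, abs_sub_comm] at h
  have h1 : G.joinDist v w - G.joinDist v v ≤ _ := (le_abs_self _).trans h
  linarith [joinDist_self_le (G := G) v]

theorem exists_dist_le [CompactSpace G.Completion] : ∃ C, ∀ x y : G.Point, dist x y ≤ C := by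
  obtain ⟨C, hC⟩ := Metric.isBounded_iff.1 (isCompact_univ (X := G.Completion)).isBounded
  refine ⟨C, fun x y => ?_⟩
  rw [← UniformSpace.Completion.dist_eq]
  exact hC (mem_univ _) (mem_univ _)

theorem exists_joins_le [CompactSpace G.Completion] :
    ∃ C, ∀ v w, ∃ T, G.Joins T v w ∧ ∑ e ∈ T, G.len e ≤ C := by
  obtain ⟨C, hC⟩ := exists_dist_le (G := G)
  refine ⟨C + 1, fun v w => ?_⟩
  obtain ⟨T, hT, hlt⟩ := exists_joins_lt (G := G) (v := v) (w := w) (r := C + 1)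
    (by linarith [joinDist_le_dist (G := G) v w, hC (.vertex v) (.vertex w)])
  exact ⟨T, hT, hlt.le⟩

theorem IsPrimitive.abs_sub_le {f : G.Point → ℝ} {g : G.Edge → ℝ → ℝ} (h : IsPrimitive f g)
    {M : ℝ} (hM : ∀ e, ∀ t ∈ Icc 0 (G.len e), |g e t| ≤ M) (e : G.Edge) {s t : ℝ}
    (hs : s ∈ Icc 0 (G.len e)) (ht : t ∈ Icc 0 (G.len e)) :
    |f (G.pt e s) - f (G.pt e t)| ≤ M * |s - t| := by
  have h1 := (h.isPrimOn e).sub_eq t ht s hs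
  simp only [onEdge] at h1
  rw [h1, ← Real.norm_eq_abs]
  refine intervalIntegral.norm_integral_le_of_norm_le_const fun x hx => ?_
  exact hM e x ⟨(le_min ht.1 hs.1).trans hx.1.le, hx.2.trans (max_le ht.2 hs.2)⟩

/-- The endpoints of a long edge may be close through other edges, but its midpoint is far from
them: the Green function with pole there is `1`-Lipschitz, rises to a quarter of the length and
vanishes at the vertices. -/
theorem exists_len_le [CompactSpace G.Completion] : ∃ C, ∀ e, G.len e ≤ C := by
  obtain ⟨C, hC⟩ := exists_dist_le (G := G)
  refine ⟨4 * C, fun e => ?_⟩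
  have hl := G.len_pos e
  have hs : G.len e / 2 ∈ Icc 0 (G.len e) := ⟨by linarith, by linarith⟩
  have h := abs_sub_le_mul_dist one_pos (fun e' s' hs' t ht => (isPrimitive_green e hs).abs_sub_le
    (fun e' t _ => abs_greenGrad_le e hs e' t) e' hs' ht) (G.pt e (G.len e / 2))
    (.vertex (G.src e))
  rw [green_pt_self e hs, green_vertex, sub_zero, one_mul] at h
  have h1 := ((le_abs_self _).trans h).trans (hC _ _)
  have h2 : G.len e / 2 / G.len e = 1 / 2 := by field_simp
  rw [h2] at h1
  linarith

/-! ### The energy form -/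

/-- Cauchy–Schwarz against the constant function, from the square of the deviation of `g` from its
mean, scaled by `t - s`. -/
theorem sq_integral_le {g : ℝ → ℝ} {s t : ℝ} (hst : s ≤ t) (hg : IntervalIntegrable g volume s t)
    (hg2 : IntervalIntegrable (fun x => g x * g x) volume s t) :
    (∫ x in s..t, g x) ^ 2 ≤ (t - s) * ∫ x in s..t, g x * g x := by
  rcases hst.eq_or_lt with rfl | hlt
  · simp
  set I := ∫ x in s..t, g x with hI
  have h : 0 ≤ ∫ x in s..t, (g x * (t - s) - I) * (g x * (t - s) - I) :=
    intervalIntegral.integral_nonneg hst fun x _ => mul_self_nonneg _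
  have e : (fun x => (g x * (t - s) - I) * (g x * (t - s) - I)) = fun x =>
      (t - s) ^ 2 * (g x * g x) - 2 * (t - s) * I * g x + I ^ 2 := by ext x; ring
  rw [e, intervalIntegral.integral_add ((hg2.const_mul _).sub (hg.const_mul _))
    intervalIntegrable_const, intervalIntegral.integral_sub (hg2.const_mul _) (hg.const_mul _),
    intervalIntegral.integral_const_mul, intervalIntegral.integral_const_mul,
    intervalIntegral.integral_const, ← hI, smul_eq_mul] at h
  have h' : 0 ≤ (t - s) * ((t - s) * (∫ x in s..t, g x * g x) - I ^ 2) := by linarith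
  have := nonneg_of_mul_nonneg_right h' (sub_pos.2 hlt)
  linarith

/-- The contribution of the edge `e` to the energy form. -/
noncomputable def edgeEnergy (G : MetricGraph V) (q : G.Point → ℝ) (e : G.Edge)
    (x y : (G.Point → ℝ) × (G.Edge → ℝ → ℝ)) : ℝ :=
  ∫ t in (0 : ℝ)..G.len e, (x.2 e t * y.2 e t + G.onEdge q e t * (G.onEdge x.1 e t * G.onEdge y.1 e t))

variable {q : G.Point → ℝ} {x y z : (G.Point → ℝ) × (G.Edge → ℝ → ℝ)}

namespace IsPrimitive

variable {f f' : G.Point → ℝ} {g g' : G.Edge → ℝ → ℝ}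

theorem add (h : IsPrimitive f g) (h' : IsPrimitive f' g') : IsPrimitive (f + f') (g + g') := by
  refine ⟨fun e => (h.measurable e).add (h'.measurable e), ?_, ?_, fun e t ht => ?_⟩
  · obtain ⟨M, hM⟩ := h.bounded
    obtain ⟨M', hM'⟩ := h'.bounded
    exact ⟨M + M', fun e t ht => (abs_add_le _ _).trans (add_le_add (hM e t ht) (hM' e t ht))⟩
  · refine (h.finite.union h'.finite).subset ?_
    rintro e ⟨t, ht, hne⟩
    by_contra hn
    rw [mem_union, not_or] at hn
    have h1 : g e t = 0 := by_contra fun h => hn.1 ⟨t, ht, h⟩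
    have h2 : g' e t = 0 := by_contra fun h => hn.2 ⟨t, ht, h⟩
    exact hne (by simp [h1, h2])
  · have hi := (h.isPrimOn e).integrable_of_mem (zero_mem e) ht
    have hi' := (h'.isPrimOn e).integrable_of_mem (zero_mem e) ht
    simp only [Pi.add_apply]
    rw [h.eq_add e t ht, h'.eq_add e t ht, intervalIntegral.integral_add hi hi']
    ring

theorem smul (h : IsPrimitive f g) (c : ℝ) : IsPrimitive (c • f) (c • g) := by
  refine ⟨fun e => (h.measurable e).const_smul c, ?_, ?_, fun e t ht => ?_⟩
  · obtain ⟨M, hM⟩ := h.bounded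
    refine ⟨|c| * M, fun e t ht => ?_⟩
    simp only [Pi.smul_apply, smul_eq_mul, abs_mul]
    exact mul_le_mul_of_nonneg_left (hM e t ht) (abs_nonneg c)
  · refine h.finite.subset ?_
    rintro e ⟨t, ht, hne⟩
    exact ⟨t, ht, fun h => hne (by simp [h])⟩
  · simp only [Pi.smul_apply, smul_eq_mul]
    rw [h.eq_add e t ht, intervalIntegral.integral_const_mul, mul_add]

theorem zero : IsPrimitive (0 : G.Point → ℝ) (0 : G.Edge → ℝ → ℝ) :=
  ⟨fun _ => measurable_const, ⟨0, by simp⟩, by simp, by simp⟩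

theorem continuousOn (h : IsPrimitive f g) (e : G.Edge) :
    ContinuousOn (G.onEdge f e) (Icc 0 (G.len e)) := (h.isPrimOn e).continuousOn

theorem integrable_grad_mul (h : IsPrimitive f g) (h' : IsPrimitive f' g') (e : G.Edge) {s t : ℝ}
    (hs : s ∈ Icc 0 (G.len e)) (ht : t ∈ Icc 0 (G.len e)) (hst : s ≤ t) :
    IntervalIntegrable (fun t => g e t * g' e t) volume s t := by
  obtain ⟨M, hM⟩ := h.bounded
  obtain ⟨M', hM'⟩ := h'.bounded
  refine intervalIntegrable_of_bounded (M := M * M') ((h.measurable e).mul (h'.measurable e)) hst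
    fun r hr => ?_
  have hr' : r ∈ Icc 0 (G.len e) := ⟨hs.1.trans hr.1, hr.2.trans ht.2⟩
  rw [Pi.mul_apply, abs_mul]
  exact mul_le_mul (hM e r hr') (hM' e r hr') (abs_nonneg _) ((abs_nonneg _).trans (hM e r hr'))

end IsPrimitive

/-- `q` is nonnegative and integrable over the edges. -/
structure IsPotential (G : MetricGraph V) (q : G.Point → ℝ) : Prop where
  nonneg : ∀ x, 0 ≤ q x
  integrable : ∀ e : G.Edge, IntervalIntegrable (G.onEdge q e) volume 0 (G.len e)
  summable : Summable fun e : G.Edge => ∫ t in (0 : ℝ)..(G.len e), G.onEdge q e t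

theorem IsAdmissible.isPotential (hq : G.IsAdmissible q) : G.IsPotential q :=
  ⟨hq.nonneg, fun e => (intervalIntegrable_iff_integrableOn_Ioo_of_le (G.len_pos e).le).2
    (hq.locallyIntegrable e), hq.integrable⟩

theorem IsPotential.integrable_mul (hq : G.IsPotential q) (e : G.Edge) {f : ℝ → ℝ}
    (hf : ContinuousOn f (Icc 0 (G.len e))) :
    IntervalIntegrable (fun t => G.onEdge q e t * f t) volume 0 (G.len e) :=
  (hq.integrable e).mul_continuousOn (by rwa [uIcc_of_le (G.len_pos e).le])

theorem integrable_edgeEnergy (hq : G.IsPotential q) (hx : IsPrimitive x.1 x.2)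
    (hy : IsPrimitive y.1 y.2) (e : G.Edge) : IntervalIntegrable (fun t =>
      x.2 e t * y.2 e t + G.onEdge q e t * (G.onEdge x.1 e t * G.onEdge y.1 e t))
      volume 0 (G.len e) :=
  (hx.integrable_grad_mul hy e (zero_mem e) (len_mem e) (G.len_pos e).le).add
    (hq.integrable_mul e ((hx.continuousOn e).mul (hy.continuousOn e)))

theorem edgeEnergy_comm (e : G.Edge) : G.edgeEnergy q e x y = G.edgeEnergy q e y x := by
  unfold edgeEnergy
  congr 1
  ext t
  ring

theorem edgeEnergy_add_right (hq : G.IsPotential q) (hx : IsPrimitive x.1 x.2)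
    (hy : IsPrimitive y.1 y.2) (hz : IsPrimitive z.1 z.2) (e : G.Edge) :
    G.edgeEnergy q e x (y + z) = G.edgeEnergy q e x y + G.edgeEnergy q e x z := by
  unfold edgeEnergy
  rw [← intervalIntegral.integral_add (integrable_edgeEnergy hq hx hy e)
    (integrable_edgeEnergy hq hx hz e)]
  congr 1
  ext t
  simp only [onEdge, Prod.fst_add, Prod.snd_add, Pi.add_apply]
  ring

theorem edgeEnergy_smul_right (c : ℝ) (e : G.Edge) :
    G.edgeEnergy q e x (c • y) = c * G.edgeEnergy q e x y := by
  unfold edgeEnergy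
  rw [← intervalIntegral.integral_const_mul]
  congr 1
  ext t
  simp only [onEdge, Prod.smul_fst, Prod.smul_snd, Pi.smul_apply, smul_eq_mul]
  ring

theorem edgeEnergy_self_nonneg (hq : G.IsPotential q) (e : G.Edge) : 0 ≤ G.edgeEnergy q e x x :=
  intervalIntegral.integral_nonneg (G.len_pos e).le fun _ _ =>
    add_nonneg (mul_self_nonneg _) (mul_nonneg (hq.nonneg _) (mul_self_nonneg _))

/-- The edges where the pair `x` does not vanish. -/
def edgeSupport (G : MetricGraph V) (x : (G.Point → ℝ) × (G.Edge → ℝ → ℝ)) : Set G.Edge :=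
  {e | ∃ t ∈ Icc 0 (G.len e), x.1 (G.pt e t) ≠ 0} ∪ {e | ∃ t ∈ Icc 0 (G.len e), x.2 e t ≠ 0}

theorem eq_zero_of_notMem_edgeSupport {e : G.Edge} (he : e ∉ G.edgeSupport x) {t : ℝ}
    (ht : t ∈ Icc 0 (G.len e)) : x.1 (G.pt e t) = 0 ∧ x.2 e t = 0 := by
  obtain ⟨h1, h2⟩ := not_or.1 he
  exact ⟨by_contra fun h => h1 ⟨t, ht, h⟩, by_contra fun h => h2 ⟨t, ht, h⟩⟩

theorem edgeEnergy_eq_zero {e : G.Edge} (he : e ∉ G.edgeSupport y) : G.edgeEnergy q e x y = 0 := by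
  unfold edgeEnergy
  rw [intervalIntegral.integral_congr (g := fun _ => 0)]
  · simp
  · intro t ht
    rw [uIcc_of_le (G.len_pos e).le] at ht
    obtain ⟨h1, h2⟩ := eq_zero_of_notMem_edgeSupport he ht
    simp [onEdge, h1, h2]

/-- The space of functions of finite support which vanish at the vertices of degree one, together
with their derivatives. -/
def testSpace (G : MetricGraph V) : Submodule ℝ ((G.Point → ℝ) × (G.Edge → ℝ → ℝ)) where
  carrier := {x | IsPrimitive x.1 x.2 ∧ {e | ∃ t ∈ Icc 0 (G.len e), x.1 (G.pt e t) ≠ 0}.Finite ∧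
    ∀ v, G.degree v = 1 → x.1 (.vertex v) = 0}
  add_mem' := by
    rintro x y ⟨hx, hxf, hxv⟩ ⟨hy, hyf, hyv⟩
    refine ⟨hx.add hy, (hxf.union hyf).subset ?_, fun v hv => ?_⟩
    · rintro e ⟨t, ht, hne⟩
      by_contra hn
      rw [mem_union, not_or] at hn
      have h1 : x.1 (G.pt e t) = 0 := by_contra fun h => hn.1 ⟨t, ht, h⟩
      have h2 : y.1 (G.pt e t) = 0 := by_contra fun h => hn.2 ⟨t, ht, h⟩
      exact hne (by simp [h1, h2])
    · simp [hxv v hv, hyv v hv]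
  zero_mem' := ⟨IsPrimitive.zero, by simp, by simp⟩
  smul_mem' := by
    rintro c x ⟨hx, hxf, hxv⟩
    refine ⟨hx.smul c, hxf.subset ?_, fun v hv => ?_⟩
    · rintro e ⟨t, ht, hne⟩
      exact ⟨t, ht, fun h => hne (by simp [h])⟩
    · simp [hxv v hv]

theorem isPrimitive_of_mem (hx : x ∈ G.testSpace) : IsPrimitive x.1 x.2 := hx.1

theorem finite_edgeSupport (hx : x ∈ G.testSpace) : (G.edgeSupport x).Finite :=
  hx.2.1.union hx.1.finite

theorem support_edgeEnergy_subset :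
    (Function.support fun e => G.edgeEnergy q e x y) ⊆ G.edgeSupport y := fun _ he =>
  by_contra fun hn => he (edgeEnergy_eq_zero hn)

/-- The energy of a pair of functions, one of them in the test space. -/
noncomputable def energyFunctional (hq : G.IsPotential q) (hx : IsPrimitive x.1 x.2) :
    G.testSpace →ₗ[ℝ] ℝ where
  -- The finite support of `y` makes this a finite sum; `x` itself may live on infinitely many
  -- edges, as a step function does.
  toFun y := ∑ᶠ e, G.edgeEnergy q e x y
  map_add' y z := by
    rw [← finsum_add_distrib ((finite_edgeSupport y.2).subset support_edgeEnergy_subset)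
      ((finite_edgeSupport z.2).subset support_edgeEnergy_subset)]
    exact finsum_congr fun e => edgeEnergy_add_right hq hx (isPrimitive_of_mem y.2)
      (isPrimitive_of_mem z.2) e
  map_smul' c y := by
    rw [RingHom.id_apply, smul_eq_mul, mul_finsum]
    exact finsum_congr fun e => edgeEnergy_smul_right c e

theorem energyFunctional_apply (hq : G.IsPotential q) (hx : IsPrimitive x.1 x.2)
    (y : G.testSpace) : energyFunctional hq hx y = ∑ᶠ e, G.edgeEnergy q e x y := rfl

theorem edgeEnergy_sum_comm : ∑ᶠ e, G.edgeEnergy q e x y = ∑ᶠ e, G.edgeEnergy q e y x :=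
  finsum_congr fun e => edgeEnergy_comm e

/-- The energy form on the test space. -/
noncomputable def energyForm (hq : G.IsPotential q) : LinearMap.BilinForm ℝ G.testSpace where
  toFun x := energyFunctional hq (isPrimitive_of_mem x.2)
  map_add' x y := LinearMap.ext fun z =>
    (edgeEnergy_sum_comm.trans (map_add (energyFunctional hq (isPrimitive_of_mem z.2)) x y)).trans
      (congrArg₂ (· + ·) edgeEnergy_sum_comm edgeEnergy_sum_comm)
  map_smul' c x := LinearMap.ext fun z =>
    (edgeEnergy_sum_comm.trans (map_smul (energyFunctional hq (isPrimitive_of_mem z.2)) c x)).trans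
      (congrArg (c * ·) edgeEnergy_sum_comm)

theorem energyForm_apply (hq : G.IsPotential q) (x y : G.testSpace) :
    energyForm hq x y = ∑ᶠ e, G.edgeEnergy q e x y := rfl

theorem energyForm_isSymm (hq : G.IsPotential q) : (energyForm hq).IsSymm :=
  ⟨fun _ _ => edgeEnergy_sum_comm⟩

theorem energyForm_self_nonneg (hq : G.IsPotential q) (x : G.testSpace) :
    0 ≤ energyForm hq x x := finsum_nonneg fun e => edgeEnergy_self_nonneg hq e

theorem sum_edgeEnergy_le (hq : G.IsPotential q) (x : G.testSpace) (T : Finset G.Edge) :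
    ∑ e ∈ T, G.edgeEnergy q e x x ≤ energyForm hq x x := by
  classical
  have hfin := finite_edgeSupport x.2
  rw [energyForm_apply, finsum_eq_sum_of_support_subset (s := hfin.toFinset ∪ T)]
  · exact Finset.sum_le_sum_of_subset_of_nonneg Finset.subset_union_right
      fun e _ _ => edgeEnergy_self_nonneg hq e
  · refine support_edgeEnergy_subset.trans ?_
    simp

theorem sq_sub_le_len_mul_edgeEnergy (hq : G.IsPotential q) (hx : IsPrimitive x.1 x.2)
    (e : G.Edge) {t : ℝ} (ht : t ∈ Icc 0 (G.len e)) :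
    (x.1 (.vertex (G.src e)) - x.1 (G.pt e t)) ^ 2 ≤ G.len e * G.edgeEnergy q e x x := by
  have h1 := sq_integral_le ht.1 ((hx.isPrimOn e).integrable_of_mem (zero_mem e) ht)
    (hx.integrable_grad_mul hx e (zero_mem e) ht ht.1)
  have h2 : ∫ r in (0 : ℝ)..t, x.2 e r * x.2 e r ≤ G.edgeEnergy q e x x := by
    have hi := hx.integrable_grad_mul hx e (zero_mem e) (len_mem e) (G.len_pos e).le
    calc ∫ r in (0 : ℝ)..t, x.2 e r * x.2 e r ≤ ∫ r in (0 : ℝ)..G.len e, x.2 e r * x.2 e r :=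
          intervalIntegral.integral_mono_interval le_rfl ht.1 ht.2
            (.of_forall fun r => mul_self_nonneg _) hi
      _ ≤ G.edgeEnergy q e x x :=
          intervalIntegral.integral_mono_on (G.len_pos e).le hi (integrable_edgeEnergy hq hx hx e)
            fun r _ => le_add_of_nonneg_right (mul_nonneg (hq.nonneg _) (mul_self_nonneg _))
  have h3 : 0 ≤ ∫ r in (0 : ℝ)..t, x.2 e r * x.2 e r :=
    intervalIntegral.integral_nonneg ht.1 fun r _ => mul_self_nonneg _
  rw [hx.eq_add e t ht]
  calc (x.1 (.vertex (G.src e)) - (x.1 (.vertex (G.src e)) + ∫ r in (0 : ℝ)..t, x.2 e r)) ^ 2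
      = (∫ r in (0 : ℝ)..t, x.2 e r) ^ 2 := by ring
    _ ≤ (t - 0) * ∫ r in (0 : ℝ)..t, x.2 e r * x.2 e r := h1
    _ ≤ G.len e * G.edgeEnergy q e x x := by
        rw [sub_zero]
        exact mul_le_mul ht.2 h2 h3 (G.len_pos e).le

/-- A nonempty boundary anchors the test functions: they vanish at vertices of degree one, and near
a point at infinity there are edges outside the finite support. -/
theorem exists_vertex_eq_zero [Nonempty G.boundary] (hx : x ∈ G.testSpace) :
    ∃ v, x.1 (.vertex v) = 0 := by
  obtain ⟨⟨b, hb⟩⟩ := ‹Nonempty G.boundary›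
  have := nonempty_edge_of_boundary hb
  rcases hb with ⟨v, hv, -⟩ | hb
  · exact ⟨v, hx.2.2 v hv⟩
  · obtain ⟨e, he, -⟩ := exists_notMem_closedEdge (finite_edgeSupport hx) hb isOpen_univ trivial
    refine ⟨G.src e, ?_⟩
    have h := (eq_zero_of_notMem_edgeSupport he (zero_mem e)).1
    rwa [pt_zero] at h

/-- The supremum norm is controlled by the energy. -/
theorem exists_sq_le_energy [CompactSpace G.Completion] [Nonempty G.boundary]
    (hq : G.IsPotential q) :
    ∃ C, 0 ≤ C ∧ ∀ (x : G.testSpace) (p : G.Point), x.1.1 p ^ 2 ≤ C * energyForm hq x x := by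
  obtain ⟨⟨b, hb⟩⟩ := id ‹Nonempty G.boundary›
  have := nonempty_edge_of_boundary hb
  obtain ⟨C, hC⟩ := exists_joins_le (G := G)
  obtain ⟨C', hC'⟩ := exists_len_le (G := G)
  have hE := energyForm_self_nonneg hq
  have hC0 : 0 ≤ C' := by
    obtain ⟨e⟩ := ‹Nonempty G.Edge›
    exact (G.len_pos e).le.trans (hC' e)
  refine ⟨2 * |C| + 2 * C', by positivity, fun x p => ?_⟩
  obtain ⟨e, t, ht, rfl⟩ := exists_eq_pt p
  obtain ⟨v, hv⟩ := exists_vertex_eq_zero x.2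
  obtain ⟨T, hT, hTC⟩ := hC (G.src e) v
  have hx := isPrimitive_of_mem x.2
  have h1 := hT.abs_sub_le fun v => x.1.1 (.vertex v)
  simp only [hv, sub_zero] at h1
  -- Cauchy–Schwarz over the edges of `T`, whose total length is bounded uniformly.
  have h2 : (∑ e ∈ T, |x.1.1 (.vertex (G.src e)) - x.1.1 (.vertex (G.tgt e))|) ^ 2 ≤
      (∑ e ∈ T, G.len e) * ∑ e ∈ T, G.edgeEnergy q e x x := by
    refine Finset.sum_sq_le_sum_mul_sum_of_sq_le_mul _ (fun e _ => (G.len_pos e).le)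
      (fun e _ => edgeEnergy_self_nonneg hq e) fun e _ => ?_
    rw [sq_abs, ← pt_len]
    exact sq_sub_le_len_mul_edgeEnergy hq hx e (len_mem e)
  have h3 : x.1.1 (.vertex (G.src e)) ^ 2 ≤ |C| * energyForm hq x x := by
    rw [← sq_abs]
    refine (pow_le_pow_left₀ (abs_nonneg _) h1 2).trans (h2.trans ?_)
    exact mul_le_mul (hTC.trans (le_abs_self C)) (sum_edgeEnergy_le hq x T)
      (Finset.sum_nonneg fun e _ => edgeEnergy_self_nonneg hq e) (abs_nonneg C)
  have h4 : (x.1.1 (.vertex (G.src e)) - x.1.1 (G.pt e t)) ^ 2 ≤ C' * energyForm hq x x := by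
    refine (sq_sub_le_len_mul_edgeEnergy hq hx e ht).trans ?_
    refine mul_le_mul (hC' e) ?_ (edgeEnergy_self_nonneg hq e) hC0
    simpa using sum_edgeEnergy_le hq x {e}
  -- With $a$ the value at the source and $b$ that at the point, $2a^2+2(a-b)^2-b^2=(2a-b)^2$.
  nlinarith [sq_nonneg (2 * x.1.1 (.vertex (G.src e)) - x.1.1 (G.pt e t))]

end MetricGraph

namespace MetricGraph

variable {V : Type*} {G : MetricGraph V} {q : G.Point → ℝ}

/-! ### Weak limits of functions with small residual -/

theorem tendsto_integral_potential_mul (hq : G.IsPotential q) (e : G.Edge) {f : ℕ → ℝ → ℝ}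
    {u k : ℝ → ℝ} (hf : ∀ n, ContinuousOn (f n) (Icc 0 (G.len e)))
    (hu : ContinuousOn u (Icc 0 (G.len e))) (hk : ContinuousOn k (Icc 0 (G.len e)))
    (hfu : TendstoUniformlyOn f u atTop (Icc 0 (G.len e))) :
    Tendsto (fun n => ∫ t in (0 : ℝ)..G.len e, G.onEdge q e t * (f n t * k t)) atTop
      (𝓝 (∫ t in (0 : ℝ)..G.len e, G.onEdge q e t * (u t * k t))) := by
  have hsub : uIoc 0 (G.len e) ⊆ Icc 0 (G.len e) := by
    rw [uIoc_of_le (G.len_pos e).le]; exact Ioc_subset_Icc_self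
  refine intervalIntegral.tendsto_integral_filter_of_dominated_convergence
    (fun t => G.onEdge q e t * ((|u t| + 1) * |k t|)) ?_ ?_ ?_ ?_
  · exact .of_forall fun n =>
      (hq.integrable_mul e ((hf n).mul hk)).aestronglyMeasurable_restrict_uIoc
  · filter_upwards [Metric.tendstoUniformlyOn_iff.1 hfu 1 one_pos] with n hn
    refine .of_forall fun t ht => ?_
    have h1 := hn t (hsub ht)
    rw [Real.dist_eq, abs_sub_comm] at h1
    have h2 : |f n t| ≤ |u t| + 1 := by
      have := abs_sub_abs_le_abs_sub (f n t) (u t)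
      linarith
    have hq0 : 0 ≤ G.onEdge q e t := hq.nonneg _
    rw [Real.norm_eq_abs, abs_mul, abs_mul, abs_of_nonneg hq0]
    exact mul_le_mul_of_nonneg_left (mul_le_mul_of_nonneg_right h2 (abs_nonneg _)) hq0
  · exact hq.integrable_mul e ((hu.abs.add continuousOn_const).mul hk.abs)
  · exact .of_forall fun t ht =>
      ((hfu.tendsto_at (hsub ht)).mul_const _).const_mul _

/-- The integral of `q u` over an initial part of an edge. -/
noncomputable def potentialIntegral (G : MetricGraph V) (q u : G.Point → ℝ) (e : G.Edge) (t : ℝ) :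
    ℝ := ∫ r in (0 : ℝ)..t, G.onEdge q e r * G.onEdge u e r

theorem isPrimOn_potentialIntegral (hq : G.IsPotential q) {u : G.Point → ℝ} (e : G.Edge)
    (hu : ContinuousOn (G.onEdge u e) (Icc 0 (G.len e))) :
    IsPrimOn (G.potentialIntegral q u e) (fun r => G.onEdge q e r * G.onEdge u e r) 0 (G.len e) :=
  IsPrimOn.of_eq_add (hq.integrable_mul e hu) fun t _ => by simp [potentialIntegral]

/-- The initial slope on the edge `e` of a solution of `u'' = q u`. -/
noncomputable def initialSlope (G : MetricGraph V) (q u : G.Point → ℝ) (e : G.Edge) : ℝ :=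
  (u (.vertex (G.tgt e)) - u (.vertex (G.src e)) -
    ∫ t in (0 : ℝ)..G.len e, G.potentialIntegral q u e t) / G.len e

section Limit

variable {z : ℕ → (G.Point → ℝ) × (G.Edge → ℝ → ℝ)} {u : G.Point → ℝ}

theorem isPrimOn_integral {Q : ℝ → ℝ} {l : ℝ} (hl : 0 ≤ l) (hQ : ContinuousOn Q (Icc 0 l)) :
    IsPrimOn (fun s => ∫ t in (0 : ℝ)..s, Q t) Q 0 l :=
  IsPrimOn.of_eq_add (ContinuousOn.intervalIntegrable (by rwa [uIcc_of_le hl])) fun t _ => by simp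

theorem continuousOn_of_limit (hz : ∀ n, IsPrimitive (z n).1 (z n).2)
    (hu : TendstoUniformly (fun n => (z n).1) u atTop) (e : G.Edge) :
    ContinuousOn (G.onEdge u e) (Icc 0 (G.len e)) :=
  (hu.comp (G.pt e)).tendstoUniformlyOn.continuousOn
    (Frequently.of_forall fun n => (hz n).continuousOn e)

/-- The limit of the energies of `z n` and a test function along an edge. -/
theorem tendsto_edgeEnergy (hq : G.IsPotential q) (hz : ∀ n, IsPrimitive (z n).1 (z n).2)
    (hu : TendstoUniformly (fun n => (z n).1) u atTop) (e : G.Edge)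
    {y : (G.Point → ℝ) × (G.Edge → ℝ → ℝ)} (hy : IsPrimitive y.1 y.2) {A : ℝ}
    (hA : Tendsto (fun n => ∫ t in (0 : ℝ)..G.len e, (z n).2 e t * y.2 e t) atTop (𝓝 A)) :
    Tendsto (fun n => G.edgeEnergy q e (z n) y) atTop
      (𝓝 (A + ∫ t in (0 : ℝ)..G.len e, G.onEdge q e t * (G.onEdge u e t * G.onEdge y.1 e t))) := by
  have h := hA.add (tendsto_integral_potential_mul hq e (fun n => (hz n).continuousOn e)
    (continuousOn_of_limit hz hu e) (hy.continuousOn e) (hu.comp (G.pt e)).tendstoUniformlyOn)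
  refine h.congr fun n => ?_
  rw [← intervalIntegral.integral_add]
  · rfl
  · exact (hz n).integrable_grad_mul hy e (zero_mem e) (len_mem e) (G.len_pos e).le
  · exact hq.integrable_mul e (((hz n).continuousOn e).mul (hy.continuousOn e))

theorem green_mem_testSpace (e : G.Edge) {s : ℝ} (hs : s ∈ Icc 0 (G.len e)) :
    (G.green e s, G.greenGrad e s) ∈ G.testSpace := by
  refine ⟨isPrimitive_green e hs, (finite_singleton e).subset ?_, fun v _ => rfl⟩
  rintro e' ⟨t, ht, hne⟩
  by_contra h
  exact hne (green_pt_of_ne h hs ht)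

theorem star_mem_testSpace {v : V} (hv : G.degree v ≠ 1) : (G.star v, G.starGrad v) ∈ G.testSpace := by
  refine ⟨isPrimitive_star v, (incident_finite v).subset ?_, fun w hw => ?_⟩
  · rintro e ⟨t, ht, hne⟩
    by_contra h
    exact hne (star_pt_eq_zero h ht)
  · simp only [star_vertex]
    rw [if_neg]
    rintro rfl
    exact hv hw

/-- The limit solves the integrated equation. -/
theorem onEdge_eq_of_limit (hq : G.IsPotential q) (hz : ∀ n, IsPrimitive (z n).1 (z n).2)
    (hu : TendstoUniformly (fun n => (z n).1) u atTop)
    (h : ∀ y ∈ G.testSpace, Tendsto (fun n => ∑ᶠ e, G.edgeEnergy q e (z n) y) atTop (𝓝 0))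
    (e : G.Edge) {s : ℝ} (hs : s ∈ Icc 0 (G.len e)) :
    G.onEdge u e s = u (.vertex (G.src e)) + G.initialSlope q u e * s +
      ∫ t in (0 : ℝ)..s, G.potentialIntegral q u e t := by
  have hl := G.len_pos e
  have hgr := isPrimitive_green e hs
  have huc := continuousOn_of_limit hz hu e
  have hQ := isPrimOn_potentialIntegral hq e huc
  have hR := isPrimOn_integral hl.le hQ.continuousOn
  have hpt : ∀ p, Tendsto (fun n => (z n).1 p) atTop (𝓝 (u p)) := fun p => hu.tendsto_at p
  -- Nothing is known about convergence of the derivatives, but paired with the piecewise constant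
  -- derivative of the Green function they involve only values of `z n`, which converge.
  have hA : Tendsto (fun n => ∫ t in (0 : ℝ)..G.len e, (z n).2 e t * G.greenGrad e s e t) atTop
      (𝓝 (G.onEdge u e s - (1 - s / G.len e) * G.onEdge u e 0 -
        s / G.len e * G.onEdge u e (G.len e))) := by
    simp only [integral_mul_greenGrad e hs ((hz _).isPrimOn e)]
    exact ((hpt _).sub ((hpt _).const_mul _)).sub ((hpt _).const_mul _)
  have h1 := tendsto_edgeEnergy hq hz hu e (y := (G.green e s, G.greenGrad e s)) hgr hA
  have h2 := h _ (green_mem_testSpace e hs)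
  have h3 : ∀ n, ∑ᶠ e', G.edgeEnergy q e' (z n) (G.green e s, G.greenGrad e s) =
      G.edgeEnergy q e (z n) (G.green e s, G.greenGrad e s) := fun n =>
    finsum_eq_single _ e fun e' he' => edgeEnergy_eq_zero (by
      rintro (⟨t, ht, hne⟩ | ⟨t, ht, hne⟩)
      · exact hne (green_pt_of_ne he' hs ht)
      · exact hne (greenGrad_ne he' s t))
  simp only [h3] at h2
  have h4 := tendsto_nhds_unique h1 h2
  -- Moves the derivative onto the Green function, which vanishes at both ends. The potential term
  -- becomes a double integral of `q u`, evaluated by `integral_mul_greenGrad`.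
  have h5 := hQ.integral_mul (hgr.isPrimOn e) hl.le
  rw [intervalIntegral.integral_add] at h5
  · rw [integral_mul_greenGrad e hs hR] at h5
    simp only [onEdge, pt_zero, pt_len, green_vertex, intervalIntegral.integral_same] at h4 h5 ⊢
    simp only [mul_assoc] at h4 h5
    rw [initialSlope]
    have e1 : s / G.len e * u (.vertex (G.tgt e)) = s * u (.vertex (G.tgt e)) / G.len e := by ring
    field_simp at h4 h5 ⊢
    linear_combination h4 - h5
  · exact hQ.integrable_mul_continuousOn hl.le (hgr.continuousOn e)
  · have := (isPrimOn_integral hl.le hQ.continuousOn).integrable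
    rw [intervalIntegrable_iff_integrableOn_Ioc_of_le hl.le] at this ⊢
    exact Integrable.mul_bdd (c := 1) this (measurable_greenGrad e s e).aestronglyMeasurable
      (.of_forall fun t => abs_greenGrad_le e hs e t)

theorem hasDerivWithinAt_of_limit (hq : G.IsPotential q) (hz : ∀ n, IsPrimitive (z n).1 (z n).2)
    (hu : TendstoUniformly (fun n => (z n).1) u atTop)
    (h : ∀ y ∈ G.testSpace, Tendsto (fun n => ∑ᶠ e, G.edgeEnergy q e (z n) y) atTop (𝓝 0))
    (e : G.Edge) {s : ℝ} (hs : s ∈ Icc 0 (G.len e)) :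
    HasDerivWithinAt (G.onEdge u e) (G.initialSlope q u e + G.potentialIntegral q u e s)
      (Icc 0 (G.len e)) s := by
  have hl := G.len_pos e
  have hQ := (isPrimOn_potentialIntegral hq e (continuousOn_of_limit hz hu e)).continuousOn
  have h1 := (isPrimOn_integral hl.le hQ).hasDerivWithinAt hQ hs hl
  have h2 := (((hasDerivWithinAt_id s (Icc 0 (G.len e))).const_mul
    (G.initialSlope q u e)).const_add (u (.vertex (G.src e)))).add h1
  rw [mul_one] at h2
  exact h2.congr (fun t ht => onEdge_eq_of_limit hq hz hu h e ht)
    (onEdge_eq_of_limit hq hz hu h e hs)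

theorem edgeDeriv_of_limit (hq : G.IsPotential q) (hz : ∀ n, IsPrimitive (z n).1 (z n).2)
    (hu : TendstoUniformly (fun n => (z n).1) u atTop)
    (h : ∀ y ∈ G.testSpace, Tendsto (fun n => ∑ᶠ e, G.edgeEnergy q e (z n) y) atTop (𝓝 0))
    (e : G.Edge) {s : ℝ} (hs : s ∈ Icc 0 (G.len e)) :
    G.edgeDeriv u e s = G.initialSlope q u e + G.potentialIntegral q u e s :=
  (hasDerivWithinAt_of_limit hq hz hu h e hs).derivWithin (uniqueDiffOn_Icc (G.len_pos e) s hs)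

theorem isPrimOn_edgeDeriv_of_limit (hq : G.IsPotential q)
    (hz : ∀ n, IsPrimitive (z n).1 (z n).2)
    (hu : TendstoUniformly (fun n => (z n).1) u atTop)
    (h : ∀ y ∈ G.testSpace, Tendsto (fun n => ∑ᶠ e, G.edgeEnergy q e (z n) y) atTop (𝓝 0))
    (e : G.Edge) :
    IsPrimOn (G.edgeDeriv u e) (fun r => G.onEdge q e r * G.onEdge u e r) 0 (G.len e) := by
  have hQ := isPrimOn_potentialIntegral hq e (continuousOn_of_limit hz hu e)
  refine ⟨hQ.integrable, fun s hs t ht => ?_⟩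
  rw [edgeDeriv_of_limit hq hz hu h e hs, edgeDeriv_of_limit hq hz hu h e ht,
    ← hQ.sub_eq s hs t ht]
  ring

/-- The star function has constant slope on the edge, so its pairing with the derivatives again
involves endpoint values only. Integration by parts leaves the derivative of the limit at `v`, as
the star function vanishes at the other end. -/
theorem tendsto_edgeEnergy_star (hq : G.IsPotential q) (hz : ∀ n, IsPrimitive (z n).1 (z n).2)
    (hu : TendstoUniformly (fun n => (z n).1) u atTop)
    (h : ∀ y ∈ G.testSpace, Tendsto (fun n => ∑ᶠ e, G.edgeEnergy q e (z n) y) atTop (𝓝 0))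
    {v : V} {e : G.Edge} (he : e ∈ G.incident v) :
    Tendsto (fun n => G.edgeEnergy q e (z n) (G.star v, G.starGrad v)) atTop
      (𝓝 (-G.vertexDeriv u e v)) := by
  have hl := G.len_pos e
  have huc := continuousOn_of_limit hz hu e
  have hQ := isPrimOn_potentialIntegral hq e huc
  have hst := isPrimitive_star (G := G) v
  have hpt : ∀ p, Tendsto (fun n => (z n).1 p) atTop (𝓝 (u p)) := fun p => hu.tendsto_at p
  set k := G.starGrad v e 0 with hk
  have hkt : ∀ t, G.starGrad v e t = k := fun t => rfl
  have hA : Tendsto (fun n => ∫ t in (0 : ℝ)..G.len e, (z n).2 e t * G.starGrad v e t) atTop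
      (𝓝 ((u (.vertex (G.tgt e)) - u (.vertex (G.src e))) * k)) := by
    have : ∀ n, ∫ t in (0 : ℝ)..G.len e, (z n).2 e t * G.starGrad v e t =
        ((z n).1 (.vertex (G.tgt e)) - (z n).1 (.vertex (G.src e))) * k := by
      intro n
      simp only [hkt]
      rw [intervalIntegral.integral_mul_const,
        ← ((hz n).isPrimOn e).sub_eq _ (zero_mem e) _ (len_mem e)]
      simp only [onEdge, pt_zero, pt_len]
    simp only [this]
    exact ((hpt _).sub (hpt _)).mul_const k
  have h1 := tendsto_edgeEnergy hq hz hu e (y := (G.star v, G.starGrad v)) hst hA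
  convert h1 using 2
  have h5 := hQ.integral_mul (hst.isPrimOn e) hl.le
  have hQ0 : G.potentialIntegral q u e 0 = 0 := by simp [potentialIntegral]
  rw [intervalIntegral.integral_add (hQ.integrable_mul_continuousOn hl.le (hst.continuousOn e))
    (by simp only [hkt]
        exact ((isPrimOn_integral hl.le hQ.continuousOn).integrable).mul_const k)] at h5
  simp only [hkt, hQ0, zero_mul, sub_zero, mul_assoc] at h5
  rw [intervalIntegral.integral_mul_const] at h5
  -- Here `k * len` is `-1` if `v` is the source and `1` if it is the target, and the value of the
  -- star function at the target is `0` or `1` accordingly.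
  have h6 : (u (.vertex (G.tgt e)) - u (.vertex (G.src e))) * k +
      ∫ t in (0 : ℝ)..G.len e, G.onEdge q e t * (G.onEdge u e t * G.onEdge (G.star v) e t) =
      k * G.len e * G.initialSlope q u e +
        G.potentialIntegral q u e (G.len e) * G.onEdge (G.star v) e (G.len e) := by
    rw [← h5, initialSlope]
    field_simp
    ring
  simp only
  rw [h6]
  rcases mem_incident_iff.1 he with rfl | rfl
  · have hk1 : k = -1 / G.len e := by
      rw [hk]; simp [starGrad, (src_ne_tgt e).symm]
    rw [vertexDeriv, if_pos rfl, edgeDeriv_of_limit hq hz hu h e (zero_mem e), hQ0, hk1]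
    simp only [onEdge, pt_len, star_vertex, if_neg (src_ne_tgt e).symm]
    field_simp
    ring
  · have hk1 : k = 1 / G.len e := by
      rw [hk]; simp [starGrad, (src_ne_tgt e)]
    rw [vertexDeriv, if_neg (src_ne_tgt e), edgeDeriv_of_limit hq hz hu h e (len_mem e), hk1]
    simp only [onEdge, pt_len, star_vertex, if_true]
    field_simp

/-- The Green functions have already produced the equation on each edge; summing the edge limits for
the star function at a vertex gives its vertex condition. -/
theorem isQHarmonic_of_limit (hq : G.IsPotential q) (hz : ∀ n, IsPrimitive (z n).1 (z n).2)
    (hu : TendstoUniformly (fun n => (z n).1) u atTop)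
    (h : ∀ y ∈ G.testSpace, Tendsto (fun n => ∑ᶠ e, G.edgeEnergy q e (z n) y) atTop (𝓝 0)) :
    G.IsQHarmonic q u := by
  refine ⟨fun e t ht => (hasDerivWithinAt_of_limit hq hz hu h e ht).differentiableWithinAt,
    fun e => (isPrimOn_edgeDeriv_of_limit hq hz hu h e).ac (G.len_pos e).le, fun e => ?_,
    fun v hv => ?_⟩
  · exact (ae_restrict_iff' measurableSet_Ioo).2 (isPrimOn_edgeDeriv_of_limit hq hz hu h e).ae_hasDerivAt
  · have hfin := incident_finite (G := G) v
    have h1 := h _ (star_mem_testSpace (G := G) (v := v) (by omega))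
    have h2 : ∀ n, ∑ᶠ e, G.edgeEnergy q e (z n) (G.star v, G.starGrad v) =
        ∑ e ∈ hfin.toFinset, G.edgeEnergy q e (z n) (G.star v, G.starGrad v) := by
      intro n
      refine finsum_eq_sum_of_support_subset _ (support_edgeEnergy_subset.trans ?_)
      rw [hfin.coe_toFinset]
      rintro e (⟨t, ht, hne⟩ | ⟨t, ht, hne⟩)
      · by_contra hn; exact hne (star_pt_eq_zero hn ht)
      · by_contra hn; exact hne (starGrad_eq_zero hn t)
    simp only [h2] at h1
    have h3 := tendsto_finsetSum hfin.toFinset fun e he =>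
      tendsto_edgeEnergy_star hq hz hu h (hfin.mem_toFinset.1 he)
    have h4 := tendsto_nhds_unique h3 h1
    rw [Finset.sum_neg_distrib, neg_eq_zero] at h4
    rw [finsum_mem_eq_finite_toFinset_sum _ hfin, h4]

end Limit

/-! ### Existence of the extension -/

/-- Apart from finitely many edges only the potential term remains, and it is at most the integral
of `q` because the step function lies between `0` and `1`. -/
theorem summable_edgeEnergy_step (hq : G.IsPotential q) {E : Set G.boundary}
    {φ : G.Completion → ℝ} {g : G.Edge → ℝ → ℝ} (hφ : IsStepFunction E φ g) :
    Summable fun e => G.edgeEnergy q e (φ ∘ G.toCompletion, g) (φ ∘ G.toCompletion, g) := by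
  refine Summable.of_norm_bounded_eventually hq.summable ?_
  filter_upwards [hφ.isPrimitive.finite.compl_mem_cofinite] with e he
  rw [Real.norm_eq_abs, abs_of_nonneg (edgeEnergy_self_nonneg hq e)]
  refine intervalIntegral.integral_mono_on (G.len_pos e).le
    (integrable_edgeEnergy hq hφ.isPrimitive hφ.isPrimitive e) (hq.integrable e) fun t ht => ?_
  have h0 : g e t = 0 := by_contra fun h => he ⟨t, ht, h⟩
  have h1 := hφ.mem_Icc (G.toCompletion (G.pt e t))
  have h2 : 0 ≤ G.onEdge q e t := hq.nonneg _
  simp only [h0, mul_zero, zero_add, onEdge, Function.comp_apply] at h2 ⊢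
  have h3 : φ (G.toCompletion (G.pt e t)) * φ (G.toCompletion (G.pt e t)) ≤ 1 :=
    mul_le_one₀ h1.2 h1.1 h1.2
  exact mul_le_of_le_one_right h2 h3

/-- Dirichlet's principle: subtract from the step function the uniform limit of almost optimal test
functions. The limit vanishes on the boundary, so the boundary values stay, and the residual
energies against test functions tend to zero. -/
theorem exists_isQHarmonicExtension [CompactSpace G.Completion] [Nonempty G.boundary]
    (hq : G.IsPotential q) {E : Set G.boundary} {φ : G.Completion → ℝ} {g : G.Edge → ℝ → ℝ}
    (hφ : IsStepFunction E φ g) : ∃ u, G.IsQHarmonicExtension q (E.indicator 1) u := by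
  obtain ⟨⟨b, hb⟩⟩ := id ‹Nonempty G.boundary›
  have := nonempty_edge_of_boundary hb
  obtain ⟨C, hC0, hC⟩ := exists_sq_le_energy hq
  set x : (G.Point → ℝ) × (G.Edge → ℝ → ℝ) := (φ ∘ G.toCompletion, g) with hx
  have hxp : IsPrimitive x.1 x.2 := hφ.isPrimitive
  have hsum := summable_edgeEnergy_step hq hφ
  have hexp : ∀ (y : G.testSpace) (c : ℝ) (e : G.Edge) (η : (G.Point → ℝ) × (G.Edge → ℝ → ℝ)),
      IsPrimitive η.1 η.2 →
      G.edgeEnergy q e (x + c • y.1) η = G.edgeEnergy q e x η + c * G.edgeEnergy q e y.1 η := by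
    intro y c e η hη
    rw [edgeEnergy_comm, edgeEnergy_add_right hq hη hxp ((isPrimitive_of_mem y.2).smul c),
      edgeEnergy_smul_right, edgeEnergy_comm, edgeEnergy_comm (x := η)]
  -- On each edge of the support of `y`, expand the nonnegative energy of `x - y`; then bound the
  -- energy of `x` over those edges by its total energy.
  have hbelow : ∀ y : G.testSpace, -∑' e, G.edgeEnergy q e x x ≤
      energyForm hq y y - 2 * energyFunctional hq hxp y := by
    intro y
    have hfin := finite_edgeSupport y.2
    have hsub : ∀ x' : (G.Point → ℝ) × (G.Edge → ℝ → ℝ),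
        (Function.support fun e => G.edgeEnergy q e x' y.1) ⊆ hfin.toFinset := fun x' =>
      support_edgeEnergy_subset.trans (by rw [hfin.coe_toFinset])
    rw [energyForm_apply, energyFunctional_apply, finsum_eq_sum_of_support_subset _ (hsub _),
      finsum_eq_sum_of_support_subset _ (hsub _), Finset.mul_sum, ← Finset.sum_sub_distrib]
    refine le_trans (neg_le_neg (hsum.sum_le_tsum hfin.toFinset
      fun e _ => edgeEnergy_self_nonneg hq e)) ?_
    rw [← Finset.sum_neg_distrib]
    refine Finset.sum_le_sum fun e _ => ?_
    have h1 := edgeEnergy_self_nonneg hq e (x := x + (-1 : ℝ) • y.1)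
    have hxy : IsPrimitive (x + (-1 : ℝ) • y.1).1 (x + (-1 : ℝ) • y.1).2 :=
      hxp.add ((isPrimitive_of_mem y.2).smul _)
    rw [hexp y _ e _ hxy, edgeEnergy_comm, hexp y _ e _ hxp,
      edgeEnergy_comm (x := y.1) (y := x + (-1 : ℝ) • y.1),
      hexp y _ e _ (isPrimitive_of_mem y.2), edgeEnergy_comm (x := y.1) (y := x)] at h1
    linarith
  obtain ⟨w, hw, hlim⟩ := exists_energy_cauchySeq (energyForm hq) (energyForm_isSymm hq)
    (energyForm_self_nonneg hq) (energyFunctional hq hxp) _ hbelow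
  have hdiff : ∀ n m p, ((w n).1.1 p - (w m).1.1 p) ^ 2 ≤
      C * (2 / ((n : ℝ) + 1) + 2 / ((m : ℝ) + 1)) := fun n m p =>
    (hC (w n - w m) p).trans (mul_le_mul_of_nonneg_left (hw n m) hC0)
  have hlim0 : Tendsto (fun n : ℕ => 2 / ((n : ℝ) + 1)) atTop (𝓝 0) := by
    have := tendsto_one_div_add_atTop_nhds_zero_nat (𝕜 := ℝ) |>.const_mul 2
    simpa [div_eq_mul_inv] using this
  have hlimC : Tendsto (fun n : ℕ => C * (2 / ((n : ℝ) + 1) + 2 / ((n : ℝ) + 1))) atTop (𝓝 0) := by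
    simpa using (hlim0.add hlim0).const_mul C
  have hcauchy : UniformCauchySeqOn (fun n => (w n).1.1) atTop univ := by
    rw [Metric.uniformCauchySeqOn_iff]
    intro ε hε
    obtain ⟨N, hN⟩ := eventually_atTop.1 (hlimC.eventually (gt_mem_nhds (pow_pos hε 2)))
    refine ⟨N, fun m hm n hn p _ => ?_⟩
    rw [Real.dist_eq]
    refine abs_lt_of_sq_lt_sq ((hdiff m n p).trans_lt (lt_of_le_of_lt ?_ (hN N le_rfl))) hε.le
    have hm' : (N : ℝ) ≤ m := by exact_mod_cast hm
    have hn' : (N : ℝ) ≤ n := by exact_mod_cast hn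
    gcongr
  have hptlim : ∀ p, ∃ r, Tendsto (fun n => (w n).1.1 p) atTop (𝓝 r) := fun p =>
    cauchySeq_tendsto_of_complete (hcauchy.cauchySeq (mem_univ p))
  choose f hf using hptlim
  have hunif : TendstoUniformly (fun n => (w n).1.1) f atTop :=
    tendstoUniformlyOn_univ.1 (hcauchy.tendstoUniformlyOn_of_tendsto fun p _ => hf p)
  have hfuc : UniformContinuous f := by
    refine Metric.uniformContinuous_iff.2 fun ε hε => ?_
    obtain ⟨n, hn⟩ := (Metric.tendstoUniformly_iff.1 hunif (ε / 3) (by positivity)).exists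
    obtain ⟨δ, hδ, h⟩ := Metric.uniformContinuous_iff.1
      (isPrimitive_of_mem (w n).2).uniformContinuous (ε / 3) (by positivity)
    refine ⟨δ, hδ, fun {a b} hab => ?_⟩
    have h1 := hn a
    have h2 := hn b
    have h3 := h hab
    rw [dist_comm] at h2
    linarith [dist_triangle4 (f a) ((w n).1.1 a) ((w n).1.1 b) (f b)]
  obtain ⟨F, hF, hFf⟩ := exists_extension hfuc
  have hFb : ∀ y ∈ G.boundary, F y = 0 := by
    rintro y (⟨v, hv, rfl⟩ | hy)
    · rw [hFf]
      refine tendsto_nhds_unique (hf _) ?_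
      simp only [(w _).2.2.2 v hv]
      exact tendsto_const_nhds
    -- Arbitrarily close to a point at infinity there are edges outside the support of `w n`; there
    -- `F` is bounded by its distance to `w n`, which is below `|F y| / 2`.
    · by_contra hne
      have hpos : 0 < |F y| / 2 := by positivity
      obtain ⟨n, hn⟩ := (Metric.tendstoUniformly_iff.1 hunif _ hpos).exists
      obtain ⟨e, he, t, ht, hlt⟩ := exists_notMem_closedEdge (finite_edgeSupport (w n).2) hy
        (isOpen_lt continuous_const hF.abs) (show |F y| / 2 < |F y| by linarith)
      have h1 := hn (G.pt e t)
      rw [(eq_zero_of_notMem_edgeSupport he ht).1, Real.dist_eq, sub_zero, ← hFf] at h1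
      exact lt_asymm hlt h1
  refine ⟨fun y => φ y - F y, hφ.isTestFunction.eventuallyFlat.continuous.sub hF, ?_, fun y => ?_⟩
  · have hz : ∀ n, IsPrimitive (x + (-1 : ℝ) • (w n).1).1 (x + (-1 : ℝ) • (w n).1).2 := fun n =>
      hxp.add ((isPrimitive_of_mem (w n).2).smul _)
    refine isQHarmonic_of_limit hq hz ?_ fun y hy => ?_
    · rw [Metric.tendstoUniformly_iff] at hunif ⊢
      intro ε hε
      filter_upwards [hunif ε hε] with n hn p
      have h1 := hn p
      rw [Real.dist_eq] at h1 ⊢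
      rw [abs_sub_comm] at h1
      refine lt_of_eq_of_lt (congrArg _ ?_) h1
      simp [hx, hFf]
      ring
    · have h1 : ∀ n, ∑ᶠ e, G.edgeEnergy q e (x + (-1 : ℝ) • (w n).1) y =
          energyFunctional hq hxp ⟨y, hy⟩ + -1 * energyForm hq (w n) ⟨y, hy⟩ := by
        intro n
        have hfs : ∀ x', (Function.support fun e => G.edgeEnergy q e x' y).Finite := fun x' =>
          (finite_edgeSupport hy).subset support_edgeEnergy_subset
        rw [energyFunctional_apply, energyForm_apply, mul_finsum, ← finsum_add_distrib (hfs _)]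
        · exact finsum_congr fun e => hexp (w n) _ e y (isPrimitive_of_mem hy)
        · refine (hfs (w n).1).subset fun e he => ?_
          exact right_ne_zero_of_mul he
      simp only [h1]
      simpa using ((hlim ⟨y, hy⟩).const_mul (-1)).const_add (energyFunctional hq hxp ⟨y, hy⟩)
  · rw [hFb y y.2, sub_zero]
    by_cases hy : y ∈ E
    · rw [hφ.isTestFunction.eq_one y hy, indicator_of_mem hy]; rfl
    · rw [hφ.isTestFunction.eq_zero y hy, indicator_of_notMem hy]

end MetricGraph

/-! ### One-sided derivatives at an endpoint maximum -/

/-- The derivative at the left endpoint is nonpositive if the maximum is attained there. -/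
theorem HasDerivWithinAt.nonpos_of_le_left {f : ℝ → ℝ} {f' a b : ℝ} (hab : a < b)
    (h : HasDerivWithinAt f f' (Icc a b) a) (hf : ∀ t ∈ Icc a b, f t ≤ f a) : f' ≤ 0 := by
  have h1 := (hasDerivWithinAt_iff_tendsto_slope' (by simp)).1 (h.mono (Ioo_subset_Icc_self (b := b)))
  have := left_nhdsWithin_Ioo_neBot hab
  refine le_of_tendsto h1 ?_
  filter_upwards [self_mem_nhdsWithin] with t ht
  rw [slope_def_field]
  exact div_nonpos_of_nonpos_of_nonneg (sub_nonpos.2 (hf t (Ioo_subset_Icc_self ht)))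
    (sub_nonneg.2 ht.1.le)

/-- The derivative at the right endpoint is nonnegative if the maximum is attained there. -/
theorem HasDerivWithinAt.nonneg_of_le_right {f : ℝ → ℝ} {f' a b : ℝ} (hab : a < b)
    (h : HasDerivWithinAt f f' (Icc a b) b) (hf : ∀ t ∈ Icc a b, f t ≤ f b) : 0 ≤ f' := by
  have h1 := (hasDerivWithinAt_iff_tendsto_slope' (by simp)).1 (h.mono (Ioo_subset_Icc_self (a := a)))
  have := right_nhdsWithin_Ioo_neBot hab
  refine ge_of_tendsto h1 ?_
  filter_upwards [self_mem_nhdsWithin] with t ht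
  rw [slope_def_field]
  exact div_nonneg_of_nonpos (sub_nonpos.2 (hf t (Ioo_subset_Icc_self ht)))
    (sub_nonpos.2 ht.2.le)

namespace MetricGraph

variable {V : Type*} {G : MetricGraph V} {q : G.Point → ℝ}

/-! ### The maximum principle -/

open Classical in
/-- `w` is a solution of `w'' = q w` satisfying the vertex conditions, with derivatives `d`. -/
structure IsSolution (q w : G.Point → ℝ) (d : G.Edge → ℝ → ℝ) : Prop where
  hasDeriv : ∀ e, ∀ t ∈ Icc 0 (G.len e),
    HasDerivWithinAt (G.onEdge w e) (d e t) (Icc 0 (G.len e)) t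
  isPrimOn : ∀ e, IsPrimOn (d e) (fun t => G.onEdge q e t * G.onEdge w e t) 0 (G.len e)
  vertex : ∀ v, 2 ≤ G.degree v →
    ∑ᶠ e ∈ G.incident v, (if G.src e = v then d e 0 else -d e (G.len e)) = 0

theorem IsQHarmonic.isSolution {u : G.Point → ℝ} (hu : G.IsQHarmonic q u) :
    IsSolution q u (G.edgeDeriv u) :=
  ⟨fun e t ht => (hu.differentiable e t ht).hasDerivWithinAt,
    fun e => IsPrimOn.of_ac (G.len_pos e).le (hu.absolutelyContinuous e) (hu.equation e),
    hu.vertex_condition⟩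

namespace IsSolution

variable {w : G.Point → ℝ} {d : G.Edge → ℝ → ℝ}

/-- Lets the maximum principle serve for minima as well. -/
theorem neg (h : IsSolution q w d) : IsSolution q (-w) (-d) := by
  refine ⟨fun e t ht => (h.hasDeriv e t ht).neg, fun e => ?_, fun v hv => ?_⟩
  · have := (h.isPrimOn e).neg
    simp only [← mul_neg] at this
    exact this
  · have h1 := h.vertex v hv
    rw [finsum_mem_eq_finite_toFinset_sum _ (incident_finite v)] at h1 ⊢
    refine neg_eq_zero.1 (Eq.trans ?_ h1)
    rw [← Finset.sum_neg_distrib]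
    refine Finset.sum_congr rfl fun e _ => ?_
    split_ifs <;> simp

theorem continuousOn_deriv (h : IsSolution q w d) (e : G.Edge) :
    ContinuousOn (d e) (Icc 0 (G.len e)) := (h.isPrimOn e).continuousOn

theorem continuousOn (h : IsSolution q w d) (e : G.Edge) :
    ContinuousOn (G.onEdge w e) (Icc 0 (G.len e)) :=
  fun t ht => (h.hasDeriv e t ht).continuousWithinAt

theorem isPrimOn_self (h : IsSolution q w d) (e : G.Edge) :
    IsPrimOn (G.onEdge w e) (d e) 0 (G.len e) :=
  IsPrimOn.of_hasDerivWithinAt (h.hasDeriv e) (h.continuousOn_deriv e) (G.len_pos e).le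

/-- A solution which attains a nonnegative maximum on an edge with zero derivative is constant on
this edge. -/
theorem eq_on_edge (h : IsSolution q w d) (hq : G.IsPotential q) {M : ℝ} (hM : 0 ≤ M)
    (hw : ∀ p, w p ≤ M) {e : G.Edge} {c : ℝ} (hc : c ∈ Icc 0 (G.len e))
    (hwc : w (G.pt e c) = M) (hdc : d e c = 0) : ∀ t ∈ Icc 0 (G.len e), w (G.pt e t) = M := by
  intro t ht
  -- With $v=M-w$ one has $v''=qv-qM\le qv$; this is where $M\ge0$ enters.
  have h1 := eq_zero_of_deriv_sub_le (v := fun t => M - G.onEdge w e t) (d := fun t => -d e t)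
    (k := G.onEdge q e) (G.len_pos e) hc
    (fun t ht => (h.hasDeriv e t ht).const_sub M) (h.continuousOn_deriv e).neg
    (hq.integrable e) (fun t _ => hq.nonneg _) (fun t _ => sub_nonneg.2 (hw _))
    (sub_eq_zero.2 hwc.symm) (neg_eq_zero.2 hdc) (fun s hs t ht hst => by
      have h2 := (h.isPrimOn e).sub_eq s hs t ht
      have hqi : IntervalIntegrable (G.onEdge q e) volume s t := (hq.integrable e).mono_set (by
        rw [uIcc_of_le (G.len_pos e).le]; exact uIcc_subset_Icc hs ht)
      have h3 : ∫ x in s..t, G.onEdge q e x * (M - G.onEdge w e x) =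
          (∫ x in s..t, G.onEdge q e x) * M - (d e t - d e s) := by
        simp only [mul_sub]
        rw [intervalIntegral.integral_sub (hqi.mul_const M)
          ((h.isPrimOn e).integrable_of_mem hs ht), intervalIntegral.integral_mul_const, h2]
      have h4 : 0 ≤ ∫ x in s..t, G.onEdge q e x :=
        intervalIntegral.integral_nonneg hst fun x _ => hq.nonneg _
      rw [h3]
      have := mul_nonneg h4 hM
      linarith) t ht
  exact (sub_eq_zero.1 h1).symm

/-- At a vertex where the maximum is attained all outgoing derivatives are nonpositive, and their
sum is zero, so each vanishes and unique continuation applies on every incident edge. -/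
theorem eq_on_incident (h : IsSolution q w d) (hq : G.IsPotential q) {M : ℝ} (hM : 0 ≤ M)
    (hw : ∀ p, w p ≤ M) {v : V} (hv : 2 ≤ G.degree v) (hwv : w (.vertex v) = M) :
    ∀ e ∈ G.incident v, ∀ t ∈ Icc 0 (G.len e), w (G.pt e t) = M := by
  have h1 := h.vertex v hv
  rw [finsum_mem_eq_finite_toFinset_sum _ (incident_finite v)] at h1
  have hsrc : ∀ e, G.src e = v → d e 0 ≤ 0 := fun e he =>
    (h.hasDeriv e 0 (zero_mem e)).nonpos_of_le_left (G.len_pos e) fun t _ => by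
      simp only [onEdge, pt_zero, he, hwv]; exact hw _
  have htgt : ∀ e, G.tgt e = v → -d e (G.len e) ≤ 0 := fun e he => neg_nonpos.2 <|
    (h.hasDeriv e _ (len_mem e)).nonneg_of_le_right (G.len_pos e) fun t _ => by
      simp only [onEdge, pt_len, he, hwv]; exact hw _
  rw [Finset.sum_eq_zero_iff_of_nonpos] at h1
  · intro e he
    have h2 := h1 e ((incident_finite v).mem_toFinset.2 he)
    rcases mem_incident_iff.1 he with rfl | rfl
    · rw [if_pos rfl] at h2
      exact h.eq_on_edge hq hM hw (zero_mem e) (by rw [pt_zero, hwv]) h2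
    · rw [if_neg (src_ne_tgt e), neg_eq_zero] at h2
      exact h.eq_on_edge hq hM hw (len_mem e) (by rw [pt_len, hwv]) h2
  · intro e he
    rcases mem_incident_iff.1 ((incident_finite v).mem_toFinset.1 he) with rfl | rfl
    · rw [if_pos rfl]; exact hsrc e rfl
    · rw [if_neg (src_ne_tgt e)]; exact htgt e rfl

end IsSolution

theorem two_le_degree [Nonempty G.Edge] {v : V} (hv : G.degree v ≠ 1) : 2 ≤ G.degree v := by
  obtain ⟨e, he⟩ := exists_incident (G := G) v
  have : G.degree v ≠ 0 := (ncard_ne_zero_of_mem he (incident_finite v))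
  omega

namespace IsSolution

variable {w : G.Point → ℝ} {d : G.Edge → ℝ → ℝ}

/-- A solution which attains a nonnegative maximum at a point which is not a vertex of degree one
is constant. -/
theorem eq_of_max [Nonempty G.Edge] (h : IsSolution q w d) (hq : G.IsPotential q) {M : ℝ}
    (hM : 0 ≤ M) (hw : ∀ p, w p ≤ M) {p : G.Point} (hp : ∀ v, p = .vertex v → G.degree v ≠ 1)
    (hwp : w p = M) (p' : G.Point) : w p' = M := by
  have hA : ∀ v, G.degree v ≠ 1 → w (.vertex v) = M →
      ∀ e ∈ G.incident v, ∀ t ∈ Icc 0 (G.len e), w (G.pt e t) = M := fun v hv hwv =>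
    h.eq_on_incident hq hM hw (two_le_degree hv) hwv
  -- Constancy passes from an edge to its neighbours through a vertex; at a vertex of degree one
  -- there is no other edge to reach.
  have hB : ∀ e, (∀ t ∈ Icc 0 (G.len e), w (G.pt e t) = M) → ∀ v, e ∈ G.incident v →
      ∀ e' ∈ G.incident v, ∀ t ∈ Icc 0 (G.len e'), w (G.pt e' t) = M := by
    intro e he v hev
    by_cases hv : G.degree v = 1
    · obtain ⟨e₀, he₀⟩ := ncard_eq_one.1 hv
      intro e' he'
      rw [he₀] at hev he'
      rw [mem_singleton_iff] at hev he'
      rw [he', ← hev]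
      exact he
    · refine hA v hv ?_
      rcases mem_incident_iff.1 hev with rfl | rfl
      · rw [← pt_zero]; exact he 0 (zero_mem e)
      · rw [← pt_len]; exact he _ (len_mem e)
  have hstart : ∃ v, ∀ e ∈ G.incident v, ∀ t ∈ Icc 0 (G.len e), w (G.pt e t) = M := by
    cases p with
    | vertex v => exact ⟨v, hA v (hp v rfl) hwp⟩
    | inner e t h0 h1 =>
      rw [← pt_inner e t h0 h1] at hwp
      have ht : t ∈ Icc 0 (G.len e) := ⟨h0.le, h1.le⟩
      refine ⟨G.src e, hB e (h.eq_on_edge hq hM hw ht hwp ?_) _ (src_mem_incident e)⟩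
      refine IsLocalMax.hasDerivAt_eq_zero ?_
        ((h.hasDeriv e t ht).hasDerivAt (Icc_mem_nhds h0 h1))
      exact .of_forall fun s => by simp only [onEdge, hwp]; exact hw _
  obtain ⟨v, hv⟩ := hstart
  have hall := vertex_induction (G := G)
    (P := fun v => ∀ e ∈ G.incident v, ∀ t ∈ Icc 0 (G.len e), w (G.pt e t) = M) v hv
    fun e => ⟨fun he => hB e (he e (src_mem_incident e)) _ (tgt_mem_incident e),
      fun he => hB e (he e (tgt_mem_incident e)) _ (src_mem_incident e)⟩
  obtain ⟨e, t, ht, rfl⟩ := exists_eq_pt p'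
  exact hall _ e (src_mem_incident e) t ht

variable {u : G.Completion → ℝ}

/-- By compactness the maximum is attained. If it exceeded `M` it would be attained off the
boundary, making `u` constant on the dense graph and so too large at `b`. -/
theorem le_of_boundary [CompactSpace G.Completion] [Nonempty G.Edge]
    (h : IsSolution q (u ∘ G.toCompletion) d) (hq : G.IsPotential q) (hu : Continuous u) {M : ℝ}
    (hM : 0 ≤ M) (hb : ∀ x ∈ G.boundary, u x ≤ M) {b : G.Completion} (hbb : b ∈ G.boundary)
    (x : G.Completion) : u x ≤ M := by
  obtain ⟨y, -, hy⟩ := isCompact_univ.exists_isMaxOn ⟨x, mem_univ x⟩ hu.continuousOn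
  have hy' : ∀ z, u z ≤ u y := fun z => hy (mem_univ z)
  refine (hy' x).trans (not_lt.1 fun hlt => ?_)
  have hyb : y ∉ G.boundary := fun h => not_lt.2 (hb y h) hlt
  obtain ⟨h1, h2⟩ := not_or.1 hyb
  obtain ⟨p, rfl⟩ := not_not.1 h2
  have hc := h.eq_of_max hq (hM.trans hlt.le) (fun p => hy' _) (p := p)
    (fun v hv hd => h1 ⟨v, hd, by rw [hv]⟩) rfl
  have := eq_const_of_forall_point hu hc b
  exact not_lt.2 (this ▸ hb b hbb) hlt

theorem lt_of_ne [Nonempty G.Edge] (h : IsSolution q (u ∘ G.toCompletion) d)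
    (hq : G.IsPotential q) (hu : Continuous u) {M : ℝ} (hM : 0 ≤ M) (hle : ∀ x, u x ≤ M)
    {b : G.Completion} (hb : u b ≠ M) {p : G.Point} (hp : ∀ v, p = .vertex v → G.degree v ≠ 1) :
    u (G.toCompletion p) < M := by
  refine lt_of_le_of_ne (hle _) fun heq => hb ?_
  exact eq_const_of_forall_point hu (h.eq_of_max hq hM (fun p => hle _) hp heq) b

end IsSolution

/-! ### The flux through the boundary -/

theorem IsPrimOn.of_hasDerivAt {F p : ℝ → ℝ} {a b : ℝ}
    (hF : ContinuousOn F (Icc a b)) (hd : ∀ t ∈ Ioo a b, HasDerivAt F (p t) t)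
    (hp : Continuous p) : IsPrimOn F p a b :=
  IsPrimOn.of_eq_add (hp.intervalIntegrable _ _) fun t ht => by
    rw [intervalIntegral.integral_eq_sub_of_hasDerivAt_of_le ht.1
      (hF.mono (Icc_subset_Icc le_rfl ht.2))
      (fun x hx => hd x ⟨hx.1, hx.2.trans_le ht.2⟩) (hp.intervalIntegrable _ _)]
    ring

/-- The integral of `u L φ` over an edge is a boundary term. -/
theorem integral_mul_edgeL {w : G.Point → ℝ} {d : G.Edge → ℝ → ℝ} (h : IsSolution q w d)
    {φ : G.Completion → ℝ} (hφ : G.EventuallyFlat φ) (e : G.Edge) :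
    ∫ t in (0 : ℝ)..G.len e, G.onEdge w e t * G.edgeL q (φ ∘ G.toCompletion) e t =
      d e (G.len e) * φ (G.toCompletion (.vertex (G.tgt e))) -
        d e 0 * φ (G.toCompletion (.vertex (G.src e))) := by
  classical
  have hl := G.len_pos e
  set f := G.onEdge (φ ∘ G.toCompletion) e with hf
  have hfc : ContinuousOn f (Icc 0 (G.len e)) := continuousOn_onEdge hφ.continuous e
  -- The derivative of the test function extended by zero. Flatness near both ends makes it $C^1$ on
  -- the line, and the boundary terms containing it vanish.
  set ψ : ℝ → ℝ := fun t => if t ∈ Ioo 0 (G.len e) then deriv f t else 0 with hψ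
  have hin : ∀ t ∈ Ioo 0 (G.len e), ψ =ᶠ[𝓝 t] deriv f := fun t ht => by
    filter_upwards [Ioo_mem_nhds ht.1 ht.2] with s hs using if_pos hs
  have hzero : ∀ t, t ∉ Ioo 0 (G.len e) → ψ =ᶠ[𝓝 t] fun _ => 0 := by
    intro t ht
    have h1 : ∀ᶠ s in 𝓝 t, s ∈ Ioo 0 (G.len e) → deriv f s = 0 := by
      rcases lt_trichotomy t 0 with h0 | rfl | h0
      · filter_upwards [Iio_mem_nhds h0] with s hs hs' using absurd hs'.1 (not_lt.2 (le_of_lt hs))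
      · filter_upwards [eventually_nhdsWithin_iff.1 (hφ.flat_src e)] with s hs hs' using hs hs'.1
      · rcases lt_trichotomy t (G.len e) with h1 | rfl | h1
        · exact absurd ⟨h0, h1⟩ ht
        · filter_upwards [eventually_nhdsWithin_iff.1 (hφ.flat_tgt e)] with s hs hs' using hs hs'.2
        · filter_upwards [Ioi_mem_nhds h1] with s hs hs'
            using absurd hs'.2 (not_lt.2 (le_of_lt hs))
    filter_upwards [h1] with s hs
    simp only [hψ]
    split_ifs with hs'
    · exact hs hs'
    · rfl
  have hsm : ContDiff ℝ 1 ψ := by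
    rw [contDiff_iff_contDiffAt]
    intro t
    by_cases ht : t ∈ Ioo 0 (G.len e)
    · have h1 : ContDiffOn ℝ 1 (deriv f) (Ioo 0 (G.len e)) :=
        (hφ.smooth e).deriv_of_isOpen isOpen_Ioo (by norm_cast)
      exact (h1.contDiffAt (Ioo_mem_nhds ht.1 ht.2)).congr_of_eventuallyEq (hin t ht)
    · exact contDiffAt_const.congr_of_eventuallyEq (hzero t ht)
  have hfψ : IsPrimOn f ψ 0 (G.len e) := by
    refine IsPrimOn.of_hasDerivAt hfc (fun t ht => ?_) hsm.continuous
    rw [(hin t ht).eq_of_nhds]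
    exact (((hφ.smooth e).differentiableOn (by simp) t ht).differentiableAt
      (Ioo_mem_nhds ht.1 ht.2)).hasDerivAt
  have hψ' : IsPrimOn ψ (deriv ψ) 0 (G.len e) :=
    IsPrimOn.of_hasDerivAt hsm.continuous.continuousOn
      (fun t _ => (hsm.differentiable (by simp) t).hasDerivAt) (hsm.continuous_deriv le_rfl)
  have h1 := (h.isPrimOn e).integral_mul hfψ hl.le
  have h2 := (h.isPrimOn_self e).integral_mul hψ' hl.le
  have hψ0 : ψ 0 = 0 := by simp [hψ]
  have hψl : ψ (G.len e) = 0 := by simp [hψ]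
  rw [hψ0, hψl, mul_zero, mul_zero, sub_zero] at h2
  have hi1 : IntervalIntegrable (fun t => G.onEdge q e t * G.onEdge w e t * f t + d e t * ψ t)
      volume 0 (G.len e) := ((h.isPrimOn e).mul hfψ hl.le).integrable
  have hi2 : IntervalIntegrable (fun t => d e t * ψ t + G.onEdge w e t * deriv ψ t)
      volume 0 (G.len e) := ((h.isPrimOn_self e).mul hψ' hl.le).integrable
  have h3 := intervalIntegral.integral_sub hi1 hi2
  rw [h1, h2, sub_zero] at h3
  have e1 : f (G.len e) = φ (G.toCompletion (.vertex (G.tgt e))) := by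
    simp only [hf, onEdge, pt_len, Function.comp_apply]
  have e0 : f 0 = φ (G.toCompletion (.vertex (G.src e))) := by
    simp only [hf, onEdge, pt_zero, Function.comp_apply]
  rw [← e1, ← e0, ← h3]
  refine intervalIntegral.integral_congr_ae ?_
  have hne : ∀ᵐ x : ℝ, x ≠ G.len e := by simp [ae_iff, measure_singleton]
  filter_upwards [hne] with t htne ht
  rw [uIoc_of_le hl.le] at ht
  have ht' : t ∈ Ioo 0 (G.len e) := ⟨ht.1, lt_of_le_of_ne ht.2 htne⟩
  simp only [edgeL]
  rw [(hin t ht').deriv_eq, ← hf]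
  ring

end MetricGraph

namespace MetricGraph

variable {V : Type*} {G : MetricGraph V} {q : G.Point → ℝ}

/-- The flux of the solution with derivatives `d`, weighted with the vertex function `η`, out of
the edge `e`. -/
def edgeFlux (G : MetricGraph V) (d : G.Edge → ℝ → ℝ) (η : V → ℝ) (e : G.Edge) : ℝ :=
  d e (G.len e) * η (G.tgt e) - d e 0 * η (G.src e)

/-- There is no net flux for weights which are supported on finitely many edges and vanish at the
vertices of degree one. -/
theorem IsSolution.hasSum_edgeFlux_zero {w : G.Point → ℝ} {d : G.Edge → ℝ → ℝ}
    (h : IsSolution q w d) {η : V → ℝ} {S : Set G.Edge} (hS : S.Finite)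
    (hη : ∀ e ∉ S, η (G.src e) = 0 ∧ η (G.tgt e) = 0) (hη1 : ∀ v, G.degree v = 1 → η v = 0) :
    HasSum (G.edgeFlux d η) 0 := by
  classical
  set T : Finset V := hS.toFinset.image G.src ∪ hS.toFinset.image G.tgt with hT
  set vd : G.Edge → V → ℝ := fun e v => if G.src e = v then d e 0 else -d e (G.len e) with hvd
  have hflux : ∀ e ∈ hS.toFinset, G.edgeFlux d η e =
      -∑ v ∈ T, η v * (if e ∈ G.incident v then vd e v else 0) := by
    intro e he
    have hsub : ({G.src e, G.tgt e} : Finset V) ⊆ T := by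
      intro v hv
      rw [Finset.mem_insert, Finset.mem_singleton] at hv
      rw [hT, Finset.mem_union]
      rcases hv with rfl | rfl
      · exact .inl (Finset.mem_image_of_mem _ he)
      · exact .inr (Finset.mem_image_of_mem _ he)
    rw [← Finset.sum_subset hsub, Finset.sum_pair (src_ne_tgt e), if_pos (src_mem_incident e),
      if_pos (tgt_mem_incident e)]
    · simp only [hvd, if_true, if_neg (src_ne_tgt e), edgeFlux]
      ring
    · intro v _ hv
      rw [Finset.mem_insert, Finset.mem_singleton] at hv
      rw [if_neg (fun hi => hv (mem_incident_iff.1 hi)), mul_zero]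
  have hsum : ∑ e ∈ hS.toFinset, G.edgeFlux d η e = 0 := by
    -- Sum by vertices instead of edges: each vertex contributes its weight times its sum of
    -- outgoing derivatives.
    rw [Finset.sum_congr rfl hflux, Finset.sum_neg_distrib, Finset.sum_comm, neg_eq_zero]
    refine Finset.sum_eq_zero fun v hv => ?_
    rw [← Finset.mul_sum]
    by_cases hηv : η v = 0
    · rw [hηv, zero_mul]
    -- If the weight at `v` is nonzero, then `S` contains all edges at `v`, so the vertex condition
    -- applies to the full sum.
    have hinc : G.incident v ⊆ S := by
      intro e he
      by_contra hn
      rcases mem_incident_iff.1 he with rfl | rfl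
      · exact hηv (hη e hn).1
      · exact hηv (hη e hn).2
    have hne : Nonempty G.Edge := by
      rw [hT, Finset.mem_union, Finset.mem_image, Finset.mem_image] at hv
      rcases hv with ⟨e, -, -⟩ | ⟨e, -, -⟩ <;> exact ⟨e⟩
    have hk := h.vertex v (two_le_degree fun hd => hηv (hη1 v hd))
    rw [finsum_mem_eq_finite_toFinset_sum _ (incident_finite v)] at hk
    rw [← Finset.sum_filter]
    have hfil : hS.toFinset.filter (fun e => e ∈ G.incident v) = (incident_finite v).toFinset := by
      ext e
      simp only [Finset.mem_filter, Finite.mem_toFinset]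
      exact ⟨fun h => h.2, fun h => ⟨hinc h, h⟩⟩
    rw [hfil]
    have hk' : ∑ e ∈ (incident_finite v).toFinset, vd e v = 0 := by
      rw [← hk]
    rw [hk', mul_zero]
  rw [← hsum]
  refine hasSum_sum_of_ne_finset_zero fun e he => ?_
  rw [hS.mem_toFinset] at he
  rw [edgeFlux, (hη e he).1, (hη e he).2]
  ring

/-- An eventually flat function takes finitely many values at the vertices. -/
theorem EventuallyFlat.exists_finite_values {φ : G.Completion → ℝ} (hφ : G.EventuallyFlat φ) :
    ∃ (S : Set G.Edge) (Z : Set ℝ), S.Finite ∧ Z.Finite ∧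
      (∀ v, φ (G.toCompletion (.vertex v)) ∈ Z) ∧
      ∀ e ∉ S, φ (G.toCompletion (.vertex (G.src e))) = φ (G.toCompletion (.vertex (G.tgt e))) := by
  obtain ⟨S, hS, hflat⟩ := hφ.flat_cofinite
  have hconst : ∀ e ∉ S,
      φ (G.toCompletion (.vertex (G.src e))) = φ (G.toCompletion (.vertex (G.tgt e))) := by
    intro e he
    have hl := G.len_pos e
    set f := G.onEdge (φ ∘ G.toCompletion) e with hf
    have h1 : IsPrimOn f (fun _ => 0) 0 (G.len e) := by
      refine IsPrimOn.of_hasDerivAt (continuousOn_onEdge hφ.continuous e) (fun t ht => ?_)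
        continuous_const
      rw [← hflat e he t ht]
      exact (((hφ.smooth e).differentiableOn (by simp) t ht).differentiableAt
        (Ioo_mem_nhds ht.1 ht.2)).hasDerivAt
    have h2 := h1.sub_eq _ (zero_mem e) _ (len_mem e)
    rw [intervalIntegral.integral_zero, sub_eq_zero] at h2
    simp only [hf, onEdge, pt_zero, pt_len, Function.comp_apply] at h2
    exact h2.symm
  obtain ⟨v₀⟩ := G.connected.nonempty
  set ψ : V → ℝ := fun v => φ (G.toCompletion (.vertex v)) with hψ
  -- Walking from `v₀`, the vertex value changes only along edges of `S`, whose endpoint values are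
  -- all included.
  set Z : Set ℝ := {ψ v₀} ∪ ((fun e => ψ (G.src e)) '' S ∪ (fun e => ψ (G.tgt e)) '' S) with hZ
  refine ⟨S, Z, hS,
    (finite_singleton _).union ((hS.image _).union (hS.image _)), fun v => ?_, hconst⟩
  refine vertex_induction (G := G) (P := fun v => ψ v ∈ Z) v₀ (.inl rfl) (fun e => ?_) v
  by_cases he : e ∈ S
  · exact ⟨fun _ => .inr (.inr ⟨e, he, rfl⟩), fun _ => .inr (.inl ⟨e, he, rfl⟩)⟩
  · rw [show ψ (G.src e) = ψ (G.tgt e) from hconst e he]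

/-! ### Localizing the flux by a cutoff of the solution -/

section Flux

variable {u : G.Completion → ℝ} {d : G.Edge → ℝ → ℝ} {E : Set G.boundary}
  {φ : G.Completion → ℝ} {g : G.Edge → ℝ → ℝ} {χ : ℝ → ℝ}

/-- The localized energy density which represents the flux on an edge. -/
noncomputable def fluxEnergy (G : MetricGraph V) (u φ : G.Completion → ℝ) (d : G.Edge → ℝ → ℝ)
    (χ : ℝ → ℝ) (e : G.Edge) : ℝ :=
  ∫ t in (0 : ℝ)..G.len e, φ (G.toCompletion (G.pt e t)) *
    deriv χ (u (G.toCompletion (G.pt e t))) * d e t ^ 2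

/-- The localized potential energy on an edge. -/
noncomputable def fluxPotential (G : MetricGraph V) (q : G.Point → ℝ) (u φ : G.Completion → ℝ)
    (χ : ℝ → ℝ) (e : G.Edge) : ℝ :=
  ∫ t in (0 : ℝ)..G.len e, G.onEdge q e t * (u (G.toCompletion (G.pt e t)) *
    (φ (G.toCompletion (G.pt e t)) * χ (u (G.toCompletion (G.pt e t)))))

theorem continuousOn_fluxEnergy (h : IsSolution q (u ∘ G.toCompletion) d) (hu : Continuous u)
    (hφ : Continuous φ) (hχ : ContDiff ℝ 1 χ) (e : G.Edge) :
    ContinuousOn (fun t => φ (G.toCompletion (G.pt e t)) *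
      deriv χ (u (G.toCompletion (G.pt e t))) * d e t ^ 2) (Icc 0 (G.len e)) :=
  ((continuousOn_onEdge hφ e).mul ((hχ.continuous_deriv le_rfl).comp_continuousOn
    (continuousOn_onEdge hu e))).mul ((h.continuousOn_deriv e).pow 2)

/-- In the product rule the term with the derivative of the step function drops out, because the
cutoff is zero wherever that derivative is not. -/
theorem isPrimOn_cutoff (h : IsSolution q (u ∘ G.toCompletion) d) (hφ : IsStepFunction E φ g)
    (hχ : ContDiff ℝ 1 χ)
    (hχ0 : ∀ e, ∀ t ∈ Icc 0 (G.len e), g e t ≠ 0 → χ (u (G.toCompletion (G.pt e t))) = 0)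
    (e : G.Edge) :
    IsPrimOn (fun t => φ (G.toCompletion (G.pt e t)) * χ (u (G.toCompletion (G.pt e t))))
      (fun t => φ (G.toCompletion (G.pt e t)) * (deriv χ (u (G.toCompletion (G.pt e t))) * d e t))
      0 (G.len e) := by
  have hl := G.len_pos e
  have hc : ContinuousOn (fun t => u (G.toCompletion (G.pt e t))) (Icc 0 (G.len e)) :=
    h.continuousOn e
  have h1 : IsPrimOn (fun t => χ (u (G.toCompletion (G.pt e t))))
      (fun t => deriv χ (u (G.toCompletion (G.pt e t))) * d e t) 0 (G.len e) := by
    refine IsPrimOn.of_hasDerivWithinAt (fun t ht => ?_)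
      (((hχ.continuous_deriv le_rfl).comp_continuousOn hc).mul (h.continuousOn_deriv e)) hl.le
    exact ((hχ.differentiable (by simp) _).hasDerivAt).comp_hasDerivWithinAt t (h.hasDeriv e t ht)
  refine ((hφ.isPrimitive.isPrimOn e).mul h1 hl.le).congr hl.le (fun t _ => rfl) fun t ht => ?_
  have h2 : g e t * χ (u (G.toCompletion (G.pt e t))) = 0 := by
    by_cases hg : g e t = 0
    · rw [hg, zero_mul]
    · rw [hχ0 e t (Ioo_subset_Icc_self ht) hg, mul_zero]
  simp only [h2, zero_add]
  rfl

/-- Integration by parts of $u'$ against $\phi\chi(u)$: the equation produces the potential term,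
and the derivative of the cutoff a square of $u'$, whose sign is that of $\chi'$. -/
theorem edgeFlux_cutoff (h : IsSolution q (u ∘ G.toCompletion) d) (hq : G.IsPotential q)
    (hu : Continuous u) (hφ : IsStepFunction E φ g) (hχ : ContDiff ℝ 1 χ)
    (hχ0 : ∀ e, ∀ t ∈ Icc 0 (G.len e), g e t ≠ 0 → χ (u (G.toCompletion (G.pt e t))) = 0)
    (e : G.Edge) :
    G.edgeFlux d (fun v => φ (G.toCompletion (.vertex v)) * χ (u (G.toCompletion (.vertex v)))) e =
      G.fluxEnergy u φ d χ e + G.fluxPotential q u φ χ e := by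
  have hl := G.len_pos e
  have hφc := hφ.isTestFunction.eventuallyFlat.continuous
  have h1 := (h.isPrimOn e).integral_mul (isPrimOn_cutoff h hφ hχ hχ0 e) hl.le
  have hi := (continuousOn_fluxEnergy h hu hφc hχ e).intervalIntegrable_of_Icc hl.le (μ := volume)
  have hi' := hq.integrable_mul e ((continuousOn_onEdge hu e).mul
    ((continuousOn_onEdge hφc e).mul (hχ.continuous.comp_continuousOn (continuousOn_onEdge hu e))))
  rw [fluxEnergy, fluxPotential, ← intervalIntegral.integral_add hi]
  · simp only [pt_zero, pt_len] at h1
    rw [edgeFlux, ← h1]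
    congr 1
    ext t
    simp only [onEdge, Function.comp_apply]
    ring
  · exact hi'

/-- All but finitely many edges carry the same vertex values for a test function and its cutoff by
the solution. -/
theorem finite_setOf_cutoff_ne [CompactSpace G.Completion] (hu : Continuous u)
    (hφ : IsStepFunction E φ g) {I : Set ℝ} (hI : IsOpen I) (hχI : ∀ r ∈ I, χ r = 1)
    (hE : ∀ x ∈ E, u x ∈ I) {ψ : G.Completion → ℝ} (hψ : G.IsTestFunction E ψ) :
    ∃ F : Set G.Edge, F.Finite ∧ ∀ e ∉ F, ∃ c : ℝ, |c| ≤ 1 ∧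
      ∀ v, (v = G.src e ∨ v = G.tgt e) → ψ (G.toCompletion (.vertex v)) = c ∧
        φ (G.toCompletion (.vertex v)) * χ (u (G.toCompletion (.vertex v))) = c := by
  obtain ⟨S, Z, hS, hZ, hψZ, hψS⟩ := hψ.eventuallyFlat.exists_finite_values
  have hφc := hφ.isTestFunction.eventuallyFlat.continuous
  have hψc := hψ.eventuallyFlat.continuous
  -- The possible nonzero values of `ψ - φ` at vertices. Avoiding this finite set is an open
  -- condition, true on the boundary, and at a vertex it forces `ψ = φ`.
  set D : Set ℝ := (Z ∪ (fun z => z - 1) '' Z) \ {0} with hD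
  have hDf : D.Finite := (hZ.union (hZ.image _)).subset sdiff_subset
  -- At a vertex the second condition gives either `φ = 0` (its values there are `0` and `1`) or `χ
  -- (u) = 1`; in both cases the cutoff does not change `φ`.
  set N : Set G.Completion := {x | ψ x - φ x ∈ Dᶜ} ∩ ({x | φ x < 1 / 2} ∪ {x | u x ∈ I}) with hN
  have hNo : IsOpen N := (hDf.isClosed.isOpen_compl.preimage (hψc.sub hφc)).inter
    ((isOpen_lt hφc continuous_const).union (hI.preimage hu))
  have hNb : (range G.toCompletion)ᶜ ⊆ N := by
    intro x hx
    have hxb : x ∈ G.boundary := .inr hx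
    by_cases hxE : (⟨x, hxb⟩ : G.boundary) ∈ E
    · have h1 := hψ.eq_one _ hxE
      have h2 := hφ.isTestFunction.eq_one _ hxE
      simp only at h1 h2
      exact ⟨by simp [h1, h2, hD], .inr (hE _ hxE)⟩
    · have h1 := hψ.eq_zero _ hxE
      have h2 := hφ.isTestFunction.eq_zero _ hxE
      simp only at h1 h2
      exact ⟨by simp [h1, h2, hD], .inl (by simp [h2])⟩
  refine ⟨S ∪ {e | ∃ t ∈ Icc 0 (G.len e), g e t ≠ 0} ∪
    {e | ∃ t ∈ Icc 0 (G.len e), G.toCompletion (G.pt e t) ∉ N},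
    (hS.union hφ.isPrimitive.finite).union (finite_setOf_edge_notMem hNo hNb), fun e he => ?_⟩
  rw [mem_union, mem_union, not_or, not_or] at he
  obtain ⟨⟨heS, heg⟩, heN⟩ := he
  have hφe : φ (G.toCompletion (.vertex (G.src e))) = φ (G.toCompletion (.vertex (G.tgt e))) := by
    have h1 := (hφ.isPrimitive.isPrimOn e).sub_eq _ (zero_mem e) _ (len_mem e)
    rw [intervalIntegral.integral_congr (g := fun _ => 0)] at h1
    · simp only [onEdge, pt_zero, pt_len, Function.comp_apply, intervalIntegral.integral_zero] at h1
      linarith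
    · intro t ht
      rw [uIcc_of_le (G.len_pos e).le] at ht
      exact by_contra fun h => heg ⟨t, ht, h⟩
  have hvN : ∀ v, (v = G.src e ∨ v = G.tgt e) → G.toCompletion (.vertex v) ∈ N := by
    rintro v (rfl | rfl)
    · by_contra hn; exact heN ⟨0, zero_mem e, by rwa [pt_zero]⟩
    · by_contra hn; exact heN ⟨_, len_mem e, by rwa [pt_len]⟩
  have hψφ : ∀ v, (v = G.src e ∨ v = G.tgt e) →
      ψ (G.toCompletion (.vertex v)) = φ (G.toCompletion (.vertex v)) := by
    intro v hv
    by_contra hne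
    refine (hvN v hv).1 ⟨?_, sub_ne_zero.2 hne⟩
    rcases hφ.vertex v with h0 | h1
    · rw [h0, sub_zero]; exact .inl (hψZ v)
    · rw [h1]; exact .inr ⟨_, hψZ v, rfl⟩
  refine ⟨φ (G.toCompletion (.vertex (G.src e))), ?_, fun v hv => ?_⟩
  · rcases hφ.vertex (G.src e) with h | h <;> rw [h] <;> simp
  · have hv' : φ (G.toCompletion (.vertex v)) = φ (G.toCompletion (.vertex (G.src e))) := by
      rcases hv with rfl | rfl
      · rfl
      · exact hφe.symm
    refine ⟨(hψφ v hv).trans hv', ?_⟩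
    rw [← hv']
    rcases hφ.vertex v with h | h
    · rw [h, zero_mul]
    · rcases (hvN v hv).2 with h' | h'
      · rw [mem_ofPred_eq, h] at h'; norm_num at h'
      · rw [hχI _ h', mul_one]

/-- The Dirichlet-Neumann integral as a sum of localized energies. -/
theorem hasSum_flux [CompactSpace G.Completion] (h : IsSolution q (u ∘ G.toCompletion) d)
    (hq : G.IsPotential q) (hu : Continuous u) (hφ : IsStepFunction E φ g) (hχ : ContDiff ℝ 1 χ)
    (hχ0 : ∀ e, ∀ t ∈ Icc 0 (G.len e), g e t ≠ 0 → χ (u (G.toCompletion (G.pt e t))) = 0)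
    {I : Set ℝ} (hI : IsOpen I) (hχI : ∀ r ∈ I, χ r = 1) (hE : ∀ x ∈ E, u x ∈ I)
    {ψ : G.Completion → ℝ} (hψ : G.IsTestFunction E ψ) :
    HasSum (fun e => G.fluxEnergy u φ d χ e + G.fluxPotential q u φ χ e) (G.integralL q u ψ) := by
  set m : V → ℝ := fun v =>
    φ (G.toCompletion (.vertex v)) * χ (u (G.toCompletion (.vertex v))) with hm
  set ψv : V → ℝ := fun v => ψ (G.toCompletion (.vertex v)) with hψv
  have hflux : ∀ e, G.edgeFlux d m e = G.fluxEnergy u φ d χ e + G.fluxPotential q u φ χ e :=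
    edgeFlux_cutoff h hq hu hφ hχ hχ0
  simp only [← hflux]
  obtain ⟨F, hF, hFe⟩ := finite_setOf_cutoff_ne hu hφ hI hχI hE hψ
  -- The given test function and the cut-off step function agree at the ends of all but finitely
  -- many edges and at the vertices of degree one, so their fluxes have the same sum.
  have hzero : HasSum (G.edgeFlux d (fun v => ψv v - m v)) 0 := by
    refine h.hasSum_edgeFlux_zero hF (fun e he => ?_) fun v hv => ?_
    · obtain ⟨c, -, hc⟩ := hFe e he
      obtain ⟨h1, h2⟩ := hc _ (.inl rfl)
      obtain ⟨h3, h4⟩ := hc _ (.inr rfl)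
      simp only [hψv, hm, h1, h2, h3, h4, sub_self, and_self]
    · have hb : G.toCompletion (.vertex v) ∈ G.boundary := .inl ⟨v, hv, rfl⟩
      simp only [hψv, hm]
      by_cases hxE : (⟨_, hb⟩ : G.boundary) ∈ E
      · have h1 := hψ.eq_one _ hxE
        have h2 := hφ.isTestFunction.eq_one _ hxE
        have h3 := hχI _ (hE _ hxE)
        simp only at h1 h2 h3
        rw [h1, h2, h3]; ring
      · have h1 := hψ.eq_zero _ hxE
        have h2 := hφ.isTestFunction.eq_zero _ hxE
        simp only at h1 h2
        rw [h1, h2]; ring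
  obtain ⟨C, hC⟩ : ∃ C, ∀ x, |u x| ≤ C := by
    obtain ⟨C, hC⟩ := isCompact_univ.exists_bound_of_continuousOn hu.continuousOn
    exact ⟨C, fun x => hC x (mem_univ x)⟩
  -- With equal weights `c` at both ends the flux of an edge is $c\int qu$, and this is dominated by
  -- a multiple of $\int q$.
  have hsum : Summable (G.edgeFlux d m) := by
    refine Summable.of_norm_bounded_eventually (hq.summable.mul_left C) ?_
    filter_upwards [hF.compl_mem_cofinite] with e he
    obtain ⟨c, hc1, hc⟩ := hFe e he
    have h1 := (hc _ (.inl rfl)).2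
    have h2 := (hc _ (.inr rfl)).2
    have hl := G.len_pos e
    have h3 : G.edgeFlux d m e = c * (d e (G.len e) - d e 0) := by
      simp only [edgeFlux, hm, h1, h2]; ring
    rw [h3, (h.isPrimOn e).sub_eq _ (zero_mem e) _ (len_mem e), norm_mul]
    refine (mul_le_of_le_one_left (norm_nonneg _) hc1).trans ?_
    rw [← intervalIntegral.integral_const_mul]
    refine (intervalIntegral.norm_integral_le_integral_norm hl.le).trans ?_
    refine intervalIntegral.integral_mono_on hl.le (h.isPrimOn e).integrable.norm
      ((hq.integrable e).const_mul C) fun t _ => ?_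
    have hq0 : 0 ≤ G.onEdge q e t := hq.nonneg _
    rw [norm_mul, Real.norm_of_nonneg hq0, mul_comm]
    exact mul_le_mul_of_nonneg_right (hC _) hq0
  have h1 := hsum.hasSum.add hzero
  rw [add_zero] at h1
  have h2 : ∀ e, G.edgeFlux d m e + G.edgeFlux d (fun v => ψv v - m v) e =
      ∫ t in (0 : ℝ)..G.len e, G.onEdge (u ∘ G.toCompletion) e t *
        G.edgeL q (ψ ∘ G.toCompletion) e t := by
    intro e
    rw [integral_mul_edgeL h hψ.eventuallyFlat e]
    simp only [edgeFlux, hψv]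
    ring
  simp only [h2] at h1
  rw [integralL, h1.tsum_eq]
  exact hsum.hasSum

/-- The localized energy is positive on some edge. -/
theorem exists_fluxEnergy_integrand_ne_zero (h : IsSolution q (u ∘ G.toCompletion) d)
    (hu : Continuous u) (hφ : IsStepFunction E φ g) (hχ : ContDiff ℝ 1 χ)
    (hχ0 : ∀ e, ∀ t ∈ Icc 0 (G.len e), g e t ≠ 0 → χ (u (G.toCompletion (G.pt e t))) = 0)
    {x y : G.boundary} (hx : x ∈ E) (hχx : χ (u x) = 1) (hy : y ∉ E) :
    ∃ e, ∃ t ∈ Icc 0 (G.len e), φ (G.toCompletion (G.pt e t)) *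
      deriv χ (u (G.toCompletion (G.pt e t))) * d e t ^ 2 ≠ 0 := by
  by_contra hn
  push Not at hn
  have := nonempty_edge_of_boundary x.2
  set m : G.Completion → ℝ := fun z => φ z * χ (u z) with hm
  have hmc : Continuous m :=
    hφ.isTestFunction.eventuallyFlat.continuous.mul (hχ.continuous.comp hu)
  -- If the energy density vanishes, so does the derivative of $\phi\chi(u)$, which differs from it
  -- by one factor $u'$. The function is then constant on edges, and so everywhere.
  have hedge : ∀ e, ∀ t ∈ Icc 0 (G.len e),
      m (G.toCompletion (G.pt e t)) = m (G.toCompletion (.vertex (G.src e))) := by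
    intro e t ht
    have h1 := (isPrimOn_cutoff h hφ hχ hχ0 e).sub_eq _ (zero_mem e) _ ht
    rw [intervalIntegral.integral_congr (g := fun _ => 0)] at h1
    · rw [intervalIntegral.integral_zero, sub_eq_zero] at h1
      simp only [pt_zero] at h1
      exact h1
    · intro s hs
      rw [uIcc_of_le ht.1] at hs
      have h2 := hn e s ⟨hs.1, hs.2.trans ht.2⟩
      rcases mul_eq_zero.1 h2 with h3 | h3
      · simp only [← mul_assoc, h3, zero_mul]
      · simp only [pow_eq_zero_iff two_ne_zero |>.1 h3, mul_zero]
  obtain ⟨v₀⟩ := G.connected.nonempty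
  have hv : ∀ v, m (G.toCompletion (.vertex v)) = m (G.toCompletion (.vertex v₀)) :=
    vertex_induction (G := G)
      (P := fun v => m (G.toCompletion (.vertex v)) = m (G.toCompletion (.vertex v₀))) v₀ rfl
      fun e => by
        have h1 := hedge e _ (len_mem e)
        rw [pt_len] at h1
        rw [h1]
  have hall : ∀ z, m z = m (G.toCompletion (.vertex v₀)) := eq_const_of_forall_point hmc fun p => by
    obtain ⟨e, t, ht, rfl⟩ := exists_eq_pt p
    rw [hedge e t ht, hv]
  have h1 := (hall x).trans (hall y).symm
  simp only [hm] at h1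
  rw [hφ.isTestFunction.eq_one x hx, hχx, hφ.isTestFunction.eq_zero y hy] at h1
  norm_num at h1

end Flux

end MetricGraph

namespace MetricGraph

variable {V : Type*} {G : MetricGraph V} {q : G.Point → ℝ}

/-! ### Signs of the flux -/

/-- A smooth cutoff: equal to `1` on `(-∞, c/2]` and to `0` on `[c, ∞)`. -/
noncomputable def cutoff (c y : ℝ) : ℝ := Real.smoothTransition (2 - 2 * y / c)

theorem contDiff_cutoff (c : ℝ) : ContDiff ℝ 1 (cutoff c) :=
  Real.smoothTransition.contDiff.comp (by fun_prop)

theorem cutoff_of_lt {c y : ℝ} (hc : 0 < c) (hy : y < c / 2) : cutoff c y = 1 := by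
  refine Real.smoothTransition.one_of_one_le ?_
  have : 2 * y / c ≤ 1 := (div_le_one hc).2 (by linarith)
  linarith

theorem cutoff_of_ge {c y : ℝ} (hc : 0 < c) (hy : c ≤ y) : cutoff c y = 0 := by
  refine Real.smoothTransition.zero_of_nonpos ?_
  have : 2 ≤ 2 * y / c := by rw [le_div_iff₀ hc]; linarith
  linarith

theorem cutoff_nonneg (c y : ℝ) : 0 ≤ cutoff c y := Real.smoothTransition.nonneg _

theorem cutoff_le_one (c y : ℝ) : cutoff c y ≤ 1 := Real.smoothTransition.le_one _

theorem antitone_cutoff {c : ℝ} (hc : 0 < c) : Antitone (cutoff c) := fun x y hxy =>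
  Real.smoothTransition.monotone (by
    have : 2 * x / c ≤ 2 * y / c := by gcongr
    linarith)

section Signs

variable {u : G.Completion → ℝ} {d : G.Edge → ℝ → ℝ} {E : Set G.boundary}
  {φ : G.Completion → ℝ} {g : G.Edge → ℝ → ℝ}

/-- A continuous function which is positive on the open edges is bounded below on the support of
the derivative of a step function. -/
theorem IsStepFunction.exists_pos_le (hφ : IsStepFunction E φ g) {v : G.Completion → ℝ}
    (hv : Continuous v)
    (hpos : ∀ e, ∀ t ∈ Ioo 0 (G.len e), 0 < v (G.toCompletion (G.pt e t))) :
    ∃ c, 0 < c ∧ ∀ e, ∀ t ∈ Icc 0 (G.len e), g e t ≠ 0 → c ≤ v (G.toCompletion (G.pt e t)) := by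
  have hsub : ∀ e, Icc (G.len e / 3) (2 * G.len e / 3) ⊆ Ioo 0 (G.len e) := fun e t ht => by
    have := G.len_pos e
    exact ⟨by linarith [ht.1], by linarith [ht.2]⟩
  -- The middle thirds of finitely many edges: compact, and inside the open edges where `v` is
  -- positive.
  have hK : IsCompact (⋃ e ∈ {e | ∃ t ∈ Icc 0 (G.len e), g e t ≠ 0},
      (fun t => G.toCompletion (G.pt e t)) '' Icc (G.len e / 3) (2 * G.len e / 3)) :=
    hφ.isPrimitive.finite.isCompact_biUnion fun e _ => isCompact_Icc.image_of_continuousOn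
      ((continuousOn_toCompletion_pt e).mono ((hsub e).trans Ioo_subset_Icc_self))
  obtain ⟨c, hc, hcK⟩ := hK.exists_forall_le' hv.continuousOn (a := 0) (by
    intro x hx
    obtain ⟨e, -, t, ht, rfl⟩ := mem_iUnion₂.1 hx
    exact hpos e t (hsub e ht))
  exact ⟨c, hc, fun e t ht hg => hcK _ (mem_biUnion ⟨t, ht, hg⟩ ⟨t, hφ.support e t hg, rfl⟩)⟩

theorem pt_ne_vertex {e : G.Edge} {t : ℝ} (ht : t ∈ Ioo 0 (G.len e)) (v : V) :
    G.pt e t ≠ .vertex v := by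
  rw [pt_inner e t ht.1 ht.2]
  intro h
  cases h

theorem integral_pos_of_ne_zero {f : ℝ → ℝ} {l t : ℝ} (hl : 0 < l)
    (hf : ContinuousOn f (Icc 0 l)) (h0 : ∀ s ∈ Icc 0 l, 0 ≤ f s) (ht : t ∈ Icc 0 l)
    (hft : f t ≠ 0) : 0 < ∫ s in (0 : ℝ)..l, f s :=
  intervalIntegral.integral_pos hl hf (fun s hs => h0 s (Ioc_subset_Icc_self hs))
    ⟨t, ht, lt_of_le_of_ne (h0 t ht) hft.symm⟩

/-- The flux out of a part of the boundary where the solution attains its maximum is positive. -/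
theorem integralL_pos [CompactSpace G.Completion] (h : IsSolution q (u ∘ G.toCompletion) d)
    (hq : G.IsPotential q) (hu : Continuous u) (hφ : IsStepFunction E φ g) (hu0 : ∀ x, 0 ≤ u x)
    (hu1 : ∀ e, ∀ t ∈ Ioo 0 (G.len e), u (G.toCompletion (G.pt e t)) < 1)
    (hE : ∀ x ∈ E, u x = 1) {x y : G.boundary} (hx : x ∈ E) (hy : y ∉ E)
    {ψ : G.Completion → ℝ} (hψ : G.IsTestFunction E ψ) : 0 < G.integralL q u ψ := by
  have hφc := hφ.isTestFunction.eventuallyFlat.continuous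
  obtain ⟨c, hc, hcg⟩ := hφ.exists_pos_le (v := fun z => 1 - u z) (continuous_const.sub hu)
    fun e t ht => sub_pos.2 (hu1 e t ht)
  -- Increasing in the value of `u`, equal to `1` near the boundary value `1`, and zero up to `1 -
  -- c`.
  set χ : ℝ → ℝ := fun r => cutoff c (1 - r) with hχdef
  have hχ : ContDiff ℝ 1 χ := (contDiff_cutoff c).comp (contDiff_const.sub contDiff_id)
  have hmono : Monotone χ := fun a b hab => antitone_cutoff hc (by linarith)
  have hχ' : ∀ r, 0 ≤ deriv χ r := fun r => hmono.deriv_nonneg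
  have hχ0 : ∀ e, ∀ t ∈ Icc 0 (G.len e), g e t ≠ 0 → χ (u (G.toCompletion (G.pt e t))) = 0 :=
    fun e t ht hg => cutoff_of_ge hc (hcg e t ht hg)
  have hχI : ∀ r ∈ Ioi (1 - c / 2), χ r = 1 := fun r hr =>
    cutoff_of_lt hc (by linarith [mem_Ioi.1 hr])
  have hEI : ∀ x ∈ E, u x ∈ Ioi (1 - c / 2) := fun x hx => by
    rw [hE x hx, mem_Ioi]; linarith
  have hsum := hasSum_flux h hq hu hφ hχ hχ0 isOpen_Ioi hχI hEI hψ
  obtain ⟨e, t, ht, hne⟩ := exists_fluxEnergy_integrand_ne_zero h hu hφ hχ hχ0 hx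
    (hχI _ (hEI x hx)) hy
  have hen : ∀ e, 0 ≤ G.fluxEnergy u φ d χ e := fun e =>
    intervalIntegral.integral_nonneg (G.len_pos e).le fun s _ =>
      mul_nonneg (mul_nonneg (hφ.mem_Icc _).1 (hχ' _)) (sq_nonneg _)
  have hpo : ∀ e, 0 ≤ G.fluxPotential q u φ χ e := fun e =>
    intervalIntegral.integral_nonneg (G.len_pos e).le fun s _ =>
      mul_nonneg (hq.nonneg _) (mul_nonneg (hu0 _) (mul_nonneg (hφ.mem_Icc _).1 (cutoff_nonneg _ _)))
  rw [← hsum.tsum_eq]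
  refine hsum.summable.tsum_pos (fun e => add_nonneg (hen e) (hpo e)) e
    (add_pos_of_pos_of_nonneg ?_ (hpo e))
  exact integral_pos_of_ne_zero (G.len_pos e) (continuousOn_fluxEnergy h hu hφc hχ e)
    (fun s _ => mul_nonneg (mul_nonneg (hφ.mem_Icc _).1 (hχ' _)) (sq_nonneg _)) ht hne

/-- The flux out of a part of the boundary where the solution attains its minimum `0`, written
with a cutoff at a small level. -/
theorem exists_hasSum_cutoff [CompactSpace G.Completion] (h : IsSolution q (u ∘ G.toCompletion) d)
    (hq : G.IsPotential q) (hu : Continuous u) (hφ : IsStepFunction E φ g)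
    (hu1 : ∀ e, ∀ t ∈ Ioo 0 (G.len e), 0 < u (G.toCompletion (G.pt e t)))
    (hE : ∀ x ∈ E, u x = 0) {x y : G.boundary} (hx : x ∈ E) (hy : y ∉ E)
    {ψ : G.Completion → ℝ} (hψ : G.IsTestFunction E ψ) :
    ∃ c₀, 0 < c₀ ∧ ∀ c, 0 < c → c ≤ c₀ →
      HasSum (fun e => G.fluxEnergy u φ d (cutoff c) e + G.fluxPotential q u φ (cutoff c) e)
        (G.integralL q u ψ) ∧ (∀ e, G.fluxEnergy u φ d (cutoff c) e ≤ 0) ∧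
        ∃ e, G.fluxEnergy u φ d (cutoff c) e < 0 := by
  have hφc := hφ.isTestFunction.eventuallyFlat.continuous
  obtain ⟨c₀, hc₀, hcg⟩ := hφ.exists_pos_le hu hu1
  refine ⟨c₀, hc₀, fun c hc hcc => ?_⟩
  have hχ := contDiff_cutoff c
  have hχ' : ∀ r, deriv (cutoff c) r ≤ 0 := fun r => (antitone_cutoff hc).deriv_nonpos
  have hχ0 : ∀ e, ∀ t ∈ Icc 0 (G.len e), g e t ≠ 0 →
      cutoff c (u (G.toCompletion (G.pt e t))) = 0 :=
    fun e t ht hg => cutoff_of_ge hc (hcc.trans (hcg e t ht hg))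
  have hχI : ∀ r ∈ Iio (c / 2), cutoff c r = 1 := fun r hr => cutoff_of_lt hc hr
  have hEI : ∀ x ∈ E, u x ∈ Iio (c / 2) := fun x hx => by
    rw [hE x hx, mem_Iio]; positivity
  obtain ⟨e, t, ht, hne⟩ := exists_fluxEnergy_integrand_ne_zero h hu hφ hχ hχ0 hx
    (hχI _ (hEI x hx)) hy
  have hint : ∀ e s, 0 ≤ -(φ (G.toCompletion (G.pt e s)) *
      deriv (cutoff c) (u (G.toCompletion (G.pt e s))) * d e s ^ 2) := fun e s =>
    neg_nonneg.2 (mul_nonpos_of_nonpos_of_nonneg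
      (mul_nonpos_of_nonneg_of_nonpos (hφ.mem_Icc _).1 (hχ' _)) (sq_nonneg _))
  refine ⟨hasSum_flux h hq hu hφ hχ hχ0 isOpen_Iio hχI hEI hψ, fun e => ?_, e, ?_⟩
  · have := intervalIntegral.integral_nonneg (μ := volume) (G.len_pos e).le fun s _ => hint e s
    rw [intervalIntegral.integral_neg] at this
    exact neg_nonneg.1 this
  · have := integral_pos_of_ne_zero (G.len_pos e) (continuousOn_fluxEnergy h hu hφc hχ e).neg
      (fun s _ => hint e s) ht (neg_ne_zero.2 hne)
    simp only [Pi.neg_apply] at this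
    rw [intervalIntegral.integral_neg] at this
    exact neg_pos.1 this

/-- Only the potential term can be positive, and it is at most `c` times the integral of `q`, since
the cutoff vanishes unless `u < c`. The level `c` is arbitrarily small. -/
theorem integralL_nonpos [CompactSpace G.Completion] (h : IsSolution q (u ∘ G.toCompletion) d)
    (hq : G.IsPotential q) (hu : Continuous u) (hφ : IsStepFunction E φ g)
    (hu1 : ∀ e, ∀ t ∈ Ioo 0 (G.len e), 0 < u (G.toCompletion (G.pt e t)))
    (hE : ∀ x ∈ E, u x = 0) {x y : G.boundary} (hx : x ∈ E) (hy : y ∉ E)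
    {ψ : G.Completion → ℝ} (hψ : G.IsTestFunction E ψ) : G.integralL q u ψ ≤ 0 := by
  have hφc := hφ.isTestFunction.eventuallyFlat.continuous
  obtain ⟨c₀, hc₀, hsum⟩ := exists_hasSum_cutoff h hq hu hφ hu1 hE hx hy hψ
  set Q := ∑' e, ∫ t in (0 : ℝ)..G.len e, G.onEdge q e t with hQ
  have hQ0 : 0 ≤ Q := tsum_nonneg fun e =>
    intervalIntegral.integral_nonneg (G.len_pos e).le fun _ _ => hq.nonneg _
  have hle : ∀ c, 0 < c → c ≤ c₀ → G.integralL q u ψ ≤ c * Q := by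
    intro c hc hcc
    obtain ⟨h1, h2, -⟩ := hsum c hc hcc
    refine hasSum_le (fun e => ?_) h1 (hq.summable.hasSum.mul_left c)
    have h3 : G.fluxPotential q u φ (cutoff c) e ≤
        c * ∫ t in (0 : ℝ)..G.len e, G.onEdge q e t := by
      rw [← intervalIntegral.integral_const_mul]
      refine intervalIntegral.integral_mono_on (G.len_pos e).le
        (hq.integrable_mul e ((continuousOn_onEdge hu e).mul ((continuousOn_onEdge hφc e).mul
          ((contDiff_cutoff c).continuous.comp_continuousOn (continuousOn_onEdge hu e)))))
        ((hq.integrable e).const_mul c) fun t _ => ?_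
      have hq0 : 0 ≤ G.onEdge q e t := hq.nonneg _
      rw [mul_comm c]
      refine mul_le_mul_of_nonneg_left ?_ hq0
      rcases le_or_gt c (u (G.toCompletion (G.pt e t))) with hcu | hcu
      · rw [cutoff_of_ge hc hcu, mul_zero, mul_zero]; exact hc.le
      · have h4 : φ (G.toCompletion (G.pt e t)) * cutoff c (u (G.toCompletion (G.pt e t))) ≤ 1 :=
          mul_le_one₀ (hφ.mem_Icc _).2 (cutoff_nonneg _ _) (cutoff_le_one _ _)
        have h5 : 0 ≤ φ (G.toCompletion (G.pt e t)) * cutoff c (u (G.toCompletion (G.pt e t))) :=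
          mul_nonneg (hφ.mem_Icc _).1 (cutoff_nonneg _ _)
        calc _ ≤ c * (φ (G.toCompletion (G.pt e t)) *
              cutoff c (u (G.toCompletion (G.pt e t)))) := mul_le_mul_of_nonneg_right hcu.le h5
          _ ≤ c * 1 := mul_le_mul_of_nonneg_left h4 hc.le
          _ = c := mul_one c
    linarith [h2 e]
  by_contra hn
  push Not at hn
  -- For this level a positive value would be at most half of itself.
  have h6 := hle (min c₀ (G.integralL q u ψ / (2 * (Q + 1)))) (lt_min hc₀ (by positivity))
    (min_le_left _ _)
  have h7 : min c₀ (G.integralL q u ψ / (2 * (Q + 1))) * Q ≤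
      G.integralL q u ψ / (2 * (Q + 1)) * Q := mul_le_mul_of_nonneg_right (min_le_right _ _) hQ0
  have h8 : G.integralL q u ψ / (2 * (Q + 1)) * Q ≤ G.integralL q u ψ / 2 := by
    rw [div_mul_eq_mul_div, div_le_div_iff₀ (by positivity) (by positivity)]
    nlinarith
  linarith

/-- With a level not above the minimum of `u` on the compact complement of `N`, the cutoff lives
inside `N`, where `q = 0`. The potential term disappears and the strictly negative energy remains.
-/
theorem integralL_neg [CompactSpace G.Completion] (h : IsSolution q (u ∘ G.toCompletion) d)
    (hq : G.IsPotential q) (hu : Continuous u) (hφ : IsStepFunction E φ g)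
    (hu1 : ∀ e, ∀ t ∈ Ioo 0 (G.len e), 0 < u (G.toCompletion (G.pt e t)))
    (hE : ∀ x ∈ E, u x = 0) {x y : G.boundary} (hx : x ∈ E) (hy : y ∉ E)
    {ψ : G.Completion → ℝ} (hψ : G.IsTestFunction E ψ) {N : Set G.Completion} (hN : IsOpen N)
    (hNq : ∀ p : G.Point, G.toCompletion p ∈ N → q p = 0) (hNu : ∀ x ∉ N, 0 < u x) :
    G.integralL q u ψ < 0 := by
  obtain ⟨c₀, hc₀, hsum⟩ := exists_hasSum_cutoff h hq hu hφ hu1 hE hx hy hψ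
  obtain ⟨c₁, hc₁, hcN⟩ := hN.isClosed_compl.isCompact.exists_forall_le' hu.continuousOn
    (a := 0) hNu
  set c := min c₀ c₁ with hcdef
  have hc : 0 < c := lt_min hc₀ hc₁
  obtain ⟨h1, h2, e, he⟩ := hsum c hc (min_le_left _ _)
  have h3 : ∀ e, G.fluxPotential q u φ (cutoff c) e = 0 := by
    intro e
    rw [fluxPotential, intervalIntegral.integral_congr (g := fun _ => 0)]
    · simp
    · intro t _
      by_cases ht : G.toCompletion (G.pt e t) ∈ N
      · have hq0 : G.onEdge q e t = 0 := hNq _ ht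
        simp only [hq0, zero_mul]
      · have := cutoff_of_ge hc ((min_le_right c₀ c₁).trans (hcN _ ht))
        simp only [this, mul_zero]
  simp only [h3, add_zero] at h1
  have h4 := h1.summable.neg.tsum_pos (fun e => neg_nonneg.2 (h2 e)) e (neg_pos.2 he)
  rw [h1.neg.tsum_eq] at h4
  exact neg_pos.1 h4

end Signs

/-- The harmonic extension of the characteristic function of a proper nonempty subset of the
boundary has values strictly between `0` and `1` away from the boundary. -/
theorem IsQHarmonicExtension.bounds [CompactSpace G.Completion] (hq : G.IsPotential q)
    {Ω : Set G.boundary} {u : G.Completion → ℝ}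
    (hu : G.IsQHarmonicExtension q (Ω.indicator 1) u) {x y : G.boundary} (hx : x ∈ Ω)
    (hy : y ∉ Ω) :
    (∀ z, 0 ≤ u z) ∧ ∀ p : G.Point, (∀ v, p = .vertex v → G.degree v ≠ 1) →
      0 < u (G.toCompletion p) ∧ u (G.toCompletion p) < 1 := by
  have := nonempty_edge_of_boundary x.2
  have hx1 : u x = 1 := by rw [hu.eq_boundary, indicator_of_mem hx]; rfl
  have hy0 : u y = 0 := by rw [hu.eq_boundary, indicator_of_notMem hy]
  have hs := hu.qHarmonic.isSolution
  have hs' : IsSolution q ((fun z => -u z) ∘ G.toCompletion) (-G.edgeDeriv (u ∘ G.toCompletion)) :=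
    hs.neg
  have hb : ∀ z ∈ G.boundary, u z = 0 ∨ u z = 1 := by
    intro z hz
    have h := hu.eq_boundary ⟨z, hz⟩
    by_cases hzΩ : (⟨z, hz⟩ : G.boundary) ∈ Ω
    · rw [indicator_of_mem hzΩ] at h; exact .inr h
    · rw [indicator_of_notMem hzΩ] at h; exact .inl h
  have hle := hs.le_of_boundary hq hu.continuous zero_le_one
    (fun z hz => by rcases hb z hz with h | h <;> rw [h]; exact zero_le_one) x.2
  -- The maximum principle for `-u` with `M = 0`, against `M = 1` for `u` itself.
  have hge := hs'.le_of_boundary hq hu.continuous.neg le_rfl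
    (fun z hz => by rcases hb z hz with h | h <;> rw [h] <;> norm_num) x.2
  refine ⟨fun z => neg_nonpos.1 (hge z), fun p hp => ⟨?_, ?_⟩⟩
  · exact neg_lt_zero.1 (hs'.lt_of_ne hq hu.continuous.neg le_rfl hge (b := x)
      (by rw [hx1]; norm_num) hp)
  · exact hs.lt_of_ne hq hu.continuous zero_le_one hle (b := y) (by rw [hy0]; norm_num) hp

end MetricGraph

/-! ### The signs of the Dirichlet–Neumann function -/

theorem mainTheorem3 {V : Type*} [Countable V] (G : MetricGraph V)
    (hcompact : CompactSpace G.Completion) (hweak : G.WeaklyConnected)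
    (q : G.Point → ℝ) (hq : G.IsAdmissible q)
    (Ω E₁ E₂ : Set G.boundary) (hΩ : IsClopen Ω) (hE₁ : IsClopen E₁) (hE₂ : IsClopen E₂)
    (hΩ_ne : Ω.Nonempty) (hE₁_ne : E₁.Nonempty) (hE₂_ne : E₂.Nonempty)
    (hΩ_univ : Ω ≠ Set.univ) (hE₁_sub : E₁ ⊆ Ω) (hE₂_sub : E₂ ⊆ Ωᶜ) :
    0 < G.dirichletNeumann q (Ω.indicator 1) E₁ ∧
    G.dirichletNeumann q (Ω.indicator 1) E₂ ≤ 0 ∧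
    ((∃ N : Set G.Completion, IsOpen N ∧ G.boundary ⊆ N ∧
        ∀ x : G.Point, G.toCompletion x ∈ N → q x = 0) →
      G.dirichletNeumann q (Ω.indicator 1) E₂ < 0) := by
  obtain ⟨x, hx⟩ := hΩ_ne
  obtain ⟨y, hy⟩ := (Set.ne_univ_iff_exists_notMem Ω).1 hΩ_univ
  obtain ⟨x₁, hx₁⟩ := hE₁_ne
  obtain ⟨x₂, hx₂⟩ := hE₂_ne
  have hedge := MetricGraph.nonempty_edge_of_boundary x.2
  have hbne : Nonempty G.boundary := ⟨x⟩
  have hpot := hq.isPotential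
  obtain ⟨φ, g, hφ⟩ := hweak.exists_isStepFunction hΩ
  obtain ⟨φ₁, g₁, hφ₁⟩ := hweak.exists_isStepFunction hE₁
  obtain ⟨φ₂, g₂, hφ₂⟩ := hweak.exists_isStepFunction hE₂
  have hex := MetricGraph.exists_isQHarmonicExtension hpot hφ
  -- Existence rules out the default value `0` of the definition; likewise for the test functions
  -- below.
  have hu : G.IsQHarmonicExtension q (Ω.indicator 1) (G.qHarmonicExtension q (Ω.indicator 1)) := by
    rw [MetricGraph.qHarmonicExtension, dif_pos hex]
    exact hex.choose_spec
  have htest : ∀ {E : Set G.boundary}, (∃ φ, G.IsTestFunction E φ) →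
      G.IsTestFunction E (G.testFunction E) := fun {E} h => by
    rw [MetricGraph.testFunction, dif_pos h]
    exact h.choose_spec
  have ht₁ := htest ⟨φ₁, hφ₁.isTestFunction⟩
  have ht₂ := htest ⟨φ₂, hφ₂.isTestFunction⟩
  simp only [MetricGraph.dirichletNeumann]
  -- The remaining argument works for any extension, so uniqueness is not needed.
  generalize G.qHarmonicExtension q (Ω.indicator 1) = u at hu
  have hs := hu.qHarmonic.isSolution
  obtain ⟨hu0, hstrict⟩ := hu.bounds hpot hx hy
  have hinner : ∀ e, ∀ t ∈ Set.Ioo 0 (G.len e), 0 < u (G.toCompletion (G.pt e t)) ∧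
      u (G.toCompletion (G.pt e t)) < 1 := fun e t ht =>
    hstrict _ fun v hv => absurd hv (MetricGraph.pt_ne_vertex ht v)
  have h1 : ∀ z ∈ E₁, u z = 1 := fun z hz => by
    rw [hu.eq_boundary, Set.indicator_of_mem (hE₁_sub hz)]; rfl
  have h2 : ∀ z ∈ E₂, u z = 0 := fun z hz => by
    rw [hu.eq_boundary, Set.indicator_of_notMem (hE₂_sub hz)]
  refine ⟨MetricGraph.integralL_pos hs hpot hu.continuous hφ₁ hu0 (fun e t ht => (hinner e t ht).2)
      h1 hx₁ (fun h => hy (hE₁_sub h)) ht₁,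
    MetricGraph.integralL_nonpos hs hpot hu.continuous hφ₂ (fun e t ht => (hinner e t ht).1) h2 hx₂
      (fun h => hE₂_sub h hx) ht₂, fun ⟨N, hN, hbN, hNq⟩ => ?_⟩
  refine MetricGraph.integralL_neg hs hpot hu.continuous hφ₂ (fun e t ht => (hinner e t ht).1) h2
    hx₂ (fun h => hE₂_sub h hx) ht₂ hN hNq fun z hz => ?_
  have hzb : z ∉ G.boundary := fun h => hz (hbN h)
  obtain ⟨h3, h4⟩ := not_or.1 hzb
  obtain ⟨p, rfl⟩ := not_not.1 h4
  exact (hstrict p fun v hv hd => h3 ⟨v, hd, by rw [hv]⟩).1
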